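/- **Theorem (weak–strong uniqueness for the Landau–Lifshitz equation).** Consider, for maps with values in $\mathbb{R}^3$, the equation $$\partial_t m + m\wedge\partial_t m = 2\, m\wedge\Delta m \qquad (1)$$ on $\mathbb{R}^3$. Let $m_0\in L^\infty(\mathbb{R}^3;\mathbb{R}^3)$ be smooth ($C^\infty$) with $|m_0|=1$ almost everywhere and $\nabla m_0\in L^2(\mathbb{R}^3;\mathbb{R}^9)$. Assume the following. * $m_2:(0,\infty)\times\mathbb{R}^3\to\mathbb{R}^3$ is a global weak solution of (1) with initial value $m_0$. That is, $|m_2|=1$ almost everywhere; $m_2$ has weak derivatives with $\nabla m_2\in L^\infty((0,T);L^2(\mathbb{R}^3;\mathbb{R}^9))$ and $\partial_t m_2\in L^2((0,T)\times\mathbb{R}^3;\mathbb{R}^3)$ for all $T>0$; $m_2$ has trace $m_0$ at $t=0$; and for every $\Psi\in H^1((0,\infty)\times\mathbb{R}^3;\mathbb{R}^3)$ and every $T>0$, $$\int_0^T\!\!\int_{\mathbb{R}^3}(\partial_t m_2+m_2\wedge\partial_t m_2)\cdot\Psi\,dx\,dt=-2\sum_{i=1}^3\int_0^T\!\!\int_{\mathbb{R}^3}(m_2\wedge\partial_i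 m_2)\cdot\partial_i\Psi\,dx\,dt .$$ Moreover $m_2$ satisfies the energy inequality: for almost every $T\ge 0$, $$\int_{\mathbb{R}^3}|\nabla m_2(T,x)|^2\,dx+\int_0^T\!\!\int_{\mathbb{R}^3}|\partial_t m_2|^2\,dx\,dt\le\int_{\mathbb{R}^3}|\nabla m_0|^2\,dx .$$ * $T>0$ and $m_1$ is a smooth solution of (1) up to time $T$ with the same initial data $m_0$. That is, $m_1\in C^\infty([0,T)\times\mathbb{R}^3;\mathbb{R}^3)$, its space-time derivatives of orders $1$, $2$ and $3$ are bounded on $(0,T')\times\mathbb{R}^3$ for every $T'<T$, $m_1$ satisfies (1) pointwise on $(0,T)\times\mathbb{R}^3$, and $m_1(0,\cdot)=m_0$. Then $m_2=m_1$ almost everywhere on $(0,T)\times\mathbb{R}^3$. -/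

import Mathlib

open MeasureTheory Set
open scoped ContDiff

noncomputable section

namespace LandauLifshitz

/-- The Euclidean space `ℝ³`; it serves both as physical space and as the space of values. -/
abbrev E3 : Type := EuclideanSpace ℝ (Fin 3)

/-- The vector product `u ∧ v` of `ℝ³`. -/
def wedge (u v : E3) : E3 := WithLp.toLp 2 (crossProduct u.ofLp v.ofLp)

/-- The `i`-th vector of the canonical basis of `ℝ³`. -/
def basisVec (i : Fin 3) : E3 := EuclideanSpace.single i (1 : ℝ)

/-- The time direction in `ℝ × ℝ³`. -/
def timeDir : ℝ × E3 := ((1 : ℝ), (0 : E3))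

/-- The `i`-th space direction in `ℝ × ℝ³`. -/
def spaceDir (i : Fin 3) : ℝ × E3 := ((0 : ℝ), basisVec i)

/-- The space-time domain `(0,∞) × ℝ³`. -/
def halfSpace : Set (ℝ × E3) := Ioi (0 : ℝ) ×ˢ univ

/-- The space-time slab `(0,T) × ℝ³`. -/
def slab (T : ℝ) : Set (ℝ × E3) := Ioo (0 : ℝ) T ×ˢ univ

/-- `g` is the weak derivative of `f` on `(0,∞) × ℝ³` in the direction `v`. -/
def IsWeakDeriv (v : ℝ × E3) (f g : ℝ × E3 → E3) : Prop :=
  LocallyIntegrableOn f halfSpace ∧ LocallyIntegrableOn g halfSpace ∧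
    ∀ φ : ℝ × E3 → ℝ, ContDiff ℝ ∞ φ → HasCompactSupport φ → tsupport φ ⊆ halfSpace →
      ∫ z in halfSpace, (fderiv ℝ φ z v) • f z = - ∫ z in halfSpace, φ z • g z

/-- `Ψ ∈ H¹((0,∞) × ℝ³; ℝ³)`, with weak time derivative `Ψt` and weak space derivatives
`Ψx i`. -/
structure IsH1 (Ψ Ψt : ℝ × E3 → E3) (Ψx : Fin 3 → ℝ × E3 → E3) : Prop where
  weak_dt : IsWeakDeriv timeDir Ψ Ψt
  weak_dx : ∀ i, IsWeakDeriv (spaceDir i) Ψ (Ψx i)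
  memLp : MemLp Ψ 2 (volume.restrict halfSpace)
  memLp_dt : MemLp Ψt 2 (volume.restrict halfSpace)
  memLp_dx : ∀ i, MemLp (Ψx i) 2 (volume.restrict halfSpace)

/-- `m₀` is the trace at time `0` of `m : (0,∞) × ℝ³ → ℝ³`, whose weak time derivative is `mt`:
Green's formula in time holds for test functions that need not vanish at time `0`. -/
def HasInitialTrace (m mt : ℝ × E3 → E3) (m₀ : E3 → E3) : Prop :=
  ∀ φ : ℝ × E3 → ℝ, ContDiff ℝ ∞ φ → HasCompactSupport φ →
    ∫ z in halfSpace, (fderiv ℝ φ z timeDir) • m z =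
      - (∫ z in halfSpace, φ z • mt z) - ∫ x : E3, φ ((0 : ℝ), x) • m₀ x

/-- `m` is a global weak solution on `(0,∞) × ℝ³` of
`∂ₜm + m ∧ ∂ₜm = 2 m ∧ Δm = 2 ∑ᵢ ∂ᵢ (m ∧ ∂ᵢm)`, with initial value `m₀`;
`mt` and `mx i` are its weak derivatives `∂ₜm` and `∂ᵢm`. -/
structure IsGlobalWeakSolution (m₀ : E3 → E3) (m mt : ℝ × E3 → E3)
    (mx : Fin 3 → ℝ × E3 → E3) : Prop where
  weak_dt : IsWeakDeriv timeDir m mt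
  weak_dx : ∀ i, IsWeakDeriv (spaceDir i) m (mx i)
  /-- `|m| = 1` almost everywhere. -/
  norm_eq_one : ∀ᵐ z ∂(volume.restrict halfSpace), ‖m z‖ = 1
  /-- `∂ₜm ∈ L²((0,T) × ℝ³)` for every `T`. -/
  memLp_dt : ∀ T : ℝ, 0 < T → MemLp mt 2 (volume.restrict (slab T))
  /-- `∇m ∈ L^∞((0,T); L²(ℝ³))` for every `T`. -/
  bound_dx : ∀ T : ℝ, 0 < T → ∃ C : NNReal, ∀ᵐ t ∂(volume.restrict (Ioo (0 : ℝ) T)),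
    ∫⁻ x : E3, ∑ i, ‖mx i (t, x)‖ₑ ^ 2 ≤ C
  /-- The weak formulation, against every `Ψ ∈ H¹((0,∞) × ℝ³; ℝ³)`. -/
  weak_eq : ∀ (Ψ Ψt : ℝ × E3 → E3) (Ψx : Fin 3 → ℝ × E3 → E3), IsH1 Ψ Ψt Ψx →
    ∀ T : ℝ, 0 < T →
      ∫ z in slab T, inner ℝ (mt z + wedge (m z) (mt z)) (Ψ z) =
        - 2 * ∑ i, ∫ z in slab T, inner ℝ (wedge (m z) (mx i z)) (Ψx i z)
  /-- The initial value is `m₀`, in the sense of traces. -/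
  initial : HasInitialTrace m mt m₀

/-- The energy inequality: for almost every `T ≥ 0`,
`∫ |∇m(T)|² dx + ∫₀ᵀ ∫ |∂ₜm|² dx dt ≤ ∫ |∇m₀|² dx`. -/
def EnergyInequality (m₀ : E3 → E3) (mt : ℝ × E3 → E3) (mx : Fin 3 → ℝ × E3 → E3) : Prop :=
  ∀ᵐ T ∂(volume.restrict (Ici (0 : ℝ))),
    (∫⁻ x : E3, ∑ i, ‖mx i (T, x)‖ₑ ^ 2)
        + ∫⁻ t in Ioo (0 : ℝ) T, ∫⁻ x : E3, ‖mt (t, x)‖ₑ ^ 2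
      ≤ ∫⁻ x : E3, ∑ i, ‖fderiv ℝ m₀ x (basisVec i)‖ₑ ^ 2

/-- `m` is a smooth solution of `∂ₜm + m ∧ ∂ₜm = 2 m ∧ Δm` up to time `T`, with initial value
`m₀`: it is `C^∞` on `[0,T) × ℝ³`, with space-time derivatives of order `1`, `2`, `3` bounded on
`(0,T') × ℝ³` for every `T' < T`, and it satisfies the equation pointwise. -/
structure IsSmoothSolution (T : ℝ) (m₀ : E3 → E3) (m : ℝ × E3 → E3) : Prop where
  smooth : ContDiffOn ℝ ∞ m (Ico (0 : ℝ) T ×ˢ univ)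
  bounded : ∀ T' : ℝ, T' < T → ∀ k ∈ Finset.Icc 1 3, ∃ C : ℝ, ∀ z ∈ slab T',
    ‖iteratedFDeriv ℝ k m z‖ ≤ C
  equation : ∀ t ∈ Ioo (0 : ℝ) T, ∀ x : E3,
    deriv (fun s => m (s, x)) t + wedge (m (t, x)) (deriv (fun s => m (s, x)) t) =
      (2 : ℝ) • wedge (m (t, x)) (Laplacian.laplacian (fun y => m (t, y)) x)
  initial : ∀ x : E3, m (0, x) = m₀ x

end LandauLifshitz

end

/-! Write `u` for the smooth solution and `v` for the weak one. The argument is the relative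
energy method, localized by cutoffs `χ` of radius `R`.

Testing the weak equation with `v ∧ Φ` puts it in the geometric form
`∂ₜv - v ∧ ∂ₜv - 2 Δv = 2 |∇v|² v`, again weakly, and `u` satisfies the same equation pointwise.
The energy `∫ χ |∇v - ∇u|²` is then expanded: its quadratic terms are controlled by the energy
inequality for `v` and the energy identity for `u`, and its cross term by the geometric equation
tested with `χ ∂ₜu`. As `|u| = |v| = 1` makes `u · ∂ₜu = v · ∂ₜv = 0`, what remains is quadratic in
`v - u`, so Grönwall's lemma bounds the relative energy by the error due to the cutoff. That error
tends to `0` as `R → ∞` because `u`, like `v`, has finite energy: the localized energy estimate for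
`u` bounds its energy in the ball of radius `R` in terms of `R⁻²` times the one in the ball of
radius `2R`, which improves the a priori growth `R³` first to `R` and then to a constant. -/

open Filter Topology

noncomputable section

namespace LandauLifshitz

/-! ### Calculus up to the initial time -/

/-- The closed space-time domain `[0,∞) × ℝ³`. -/
def closedHalfSpace : Set (ℝ × E3) := Ici (0 : ℝ) ×ˢ univ

variable {F : Type*} [NormedAddCommGroup F] [NormedSpace ℝ F]

/-- The derivative in the direction `v` of a function on `[0,∞) × ℝ³`, one-sided at time `0`. -/
def dirDeriv (v : ℝ × E3) (f : ℝ × E3 → F) (z : ℝ × E3) : F :=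
  fderivWithin ℝ f closedHalfSpace z v

local notation "∂ₜ" => dirDeriv timeDir

local notation "∂ₓ[" i "]" => dirDeriv (spaceDir i)

theorem uniqueDiffOn_closedHalfSpace : UniqueDiffOn ℝ closedHalfSpace :=
  (uniqueDiffOn_Ici 0).prod uniqueDiffOn_univ

theorem isOpen_halfSpace : IsOpen halfSpace := isOpen_Ioi.prod isOpen_univ

theorem measurableSet_halfSpace : MeasurableSet halfSpace := isOpen_halfSpace.measurableSet

theorem measurableSet_slab (S : ℝ) : MeasurableSet (slab S) :=
  measurableSet_Ioo.prod MeasurableSet.univ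

theorem halfSpace_subset_closedHalfSpace : halfSpace ⊆ closedHalfSpace :=
  prod_mono Ioi_subset_Ici_self subset_rfl

theorem slab_subset_halfSpace (S : ℝ) : slab S ⊆ halfSpace :=
  prod_mono Ioo_subset_Ioi_self subset_rfl

theorem slab_subset_closedHalfSpace (S : ℝ) : slab S ⊆ closedHalfSpace :=
  (slab_subset_halfSpace S).trans halfSpace_subset_closedHalfSpace

theorem closedHalfSpace_mem_nhds {z : ℝ × E3} (hz : z ∈ halfSpace) : closedHalfSpace ∈ 𝓝 z :=
  mem_of_superset (isOpen_halfSpace.mem_nhds hz) halfSpace_subset_closedHalfSpace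

theorem mem_closedHalfSpace {t : ℝ} {x : E3} : (t, x) ∈ closedHalfSpace ↔ 0 ≤ t := by
  simp [closedHalfSpace]

theorem mem_halfSpace {t : ℝ} {x : E3} : (t, x) ∈ halfSpace ↔ 0 < t := by
  simp [halfSpace]

theorem mem_slab {S t : ℝ} {x : E3} : (t, x) ∈ slab S ↔ 0 < t ∧ t < S := by
  simp [slab]

theorem continuousOn_time {X : Type*} [TopologicalSpace X] {f : ℝ × E3 → X}
    (hf : ContinuousOn f closedHalfSpace) (x : E3) : ContinuousOn (fun s => f (s, x)) (Ici 0) :=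
  hf.comp (by fun_prop) fun _ hs => mem_closedHalfSpace.2 hs

theorem contDiffOn_dirDeriv {f : ℝ × E3 → F} (hf : ContDiffOn ℝ ∞ f closedHalfSpace)
    (v : ℝ × E3) : ContDiffOn ℝ ∞ (dirDeriv v f) closedHalfSpace :=
  (hf.fderivWithin uniqueDiffOn_closedHalfSpace (by simp)).clm_apply contDiffOn_const

theorem dirDeriv_eq_fderiv {f : ℝ × E3 → F} {z : ℝ × E3} (hz : z ∈ halfSpace) (v : ℝ × E3) :
    dirDeriv v f z = fderiv ℝ f z v := by
  rw [dirDeriv, fderivWithin_of_mem_nhds (closedHalfSpace_mem_nhds hz)]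

theorem contDiffAt_of_mem_halfSpace {f : ℝ × E3 → F} (hf : ContDiffOn ℝ ∞ f closedHalfSpace)
    {z : ℝ × E3} (hz : z ∈ halfSpace) : ContDiffAt ℝ ∞ f z :=
  hf.contDiffAt (closedHalfSpace_mem_nhds hz)

theorem hasFDerivAt_of_mem_halfSpace {f : ℝ × E3 → F} (hf : ContDiffOn ℝ ∞ f closedHalfSpace)
    {z : ℝ × E3} (hz : z ∈ halfSpace) : HasFDerivAt f (fderiv ℝ f z) z :=
  ((contDiffAt_of_mem_halfSpace hf hz).differentiableAt (by simp)).hasFDerivAt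

theorem hasDerivAt_time {f : ℝ × E3 → F} (hf : ContDiffOn ℝ ∞ f closedHalfSpace)
    {t : ℝ} (ht : 0 < t) (x : E3) : HasDerivAt (fun s => f (s, x)) (∂ₜ f (t, x)) t := by
  have hz : (t, x) ∈ halfSpace := mem_halfSpace.2 ht
  have hline : HasDerivAt (fun s : ℝ => (s, x)) timeDir t :=
    (hasDerivAt_id t).prodMk (hasDerivAt_const t x)
  rw [dirDeriv_eq_fderiv hz]
  exact (hasFDerivAt_of_mem_halfSpace hf hz).comp_hasDerivAt t hline

theorem contDiff_space {f : ℝ × E3 → F} (hf : ContDiffOn ℝ ∞ f closedHalfSpace)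
    {t : ℝ} (ht : 0 ≤ t) : ContDiff ℝ ∞ (fun y => f (t, y)) := by
  rw [← contDiffOn_univ]
  exact hf.comp (by fun_prop) fun _ _ => mem_closedHalfSpace.2 ht

theorem hasFDerivAt_space {f : ℝ × E3 → F} (hf : ContDiffOn ℝ ∞ f closedHalfSpace)
    {t : ℝ} (ht : 0 ≤ t) (x : E3) :
    HasFDerivAt (fun y => f (t, y))
      ((fderivWithin ℝ f closedHalfSpace (t, x)).comp (ContinuousLinearMap.inr ℝ ℝ E3)) x := by
  have hf' : HasFDerivWithinAt f (fderivWithin ℝ f closedHalfSpace (t, x)) closedHalfSpace (t, x) :=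
    (hf.differentiableOn (by simp) _ (mem_closedHalfSpace.2 ht)).hasFDerivWithinAt
  rw [← hasFDerivWithinAt_univ]
  exact hf'.comp x (hasFDerivAt_prodMk_right t x).hasFDerivWithinAt
    fun _ _ => mem_closedHalfSpace.2 ht

theorem fderiv_space_apply {f : ℝ × E3 → F} (hf : ContDiffOn ℝ ∞ f closedHalfSpace)
    {t : ℝ} (ht : 0 ≤ t) (x : E3) (i : Fin 3) :
    fderiv ℝ (fun y => f (t, y)) x (basisVec i) = ∂ₓ[i] f (t, x) := by
  rw [(hasFDerivAt_space hf ht x).fderiv]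
  simp [dirDeriv, spaceDir]

theorem dirDeriv_dirDeriv_eq_fderiv_fderiv {f : ℝ × E3 → F}
    (hf : ContDiffOn ℝ ∞ f closedHalfSpace) (v w : ℝ × E3) {z : ℝ × E3} (hz : z ∈ halfSpace) :
    dirDeriv v (dirDeriv w f) z = fderiv ℝ (fderiv ℝ f) z v w := by
  have hlocal : dirDeriv w f =ᶠ[𝓝 z] fun y => fderiv ℝ f y w := by
    filter_upwards [isOpen_halfSpace.mem_nhds hz] with y hy using dirDeriv_eq_fderiv hy w
  have hdiff : DifferentiableAt ℝ (fderiv ℝ f) z :=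
    ((contDiffAt_of_mem_halfSpace hf hz).fderiv_right (m := ∞) (by simp)).differentiableAt (by simp)
  rw [dirDeriv_eq_fderiv hz, hlocal.fderiv_eq, fderiv_clm_apply hdiff (by fun_prop)]
  simp

theorem dirDeriv_comm {f : ℝ × E3 → F} (hf : ContDiffOn ℝ ∞ f closedHalfSpace)
    (v w : ℝ × E3) {z : ℝ × E3} (hz : z ∈ halfSpace) :
    dirDeriv v (dirDeriv w f) z = dirDeriv w (dirDeriv v f) z := by
  simp only [dirDeriv_dirDeriv_eq_fderiv_fderiv hf _ _ hz]
  exact ((contDiffAt_of_mem_halfSpace hf hz).isSymmSndFDerivAt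
    (by rw [minSmoothness_of_isRCLikeNormedField]; exact WithTop.coe_le_coe.2 le_top)).eq v w

theorem dirDeriv_smul {a : ℝ × E3 → ℝ} {f : ℝ × E3 → F}
    (ha : ContDiffOn ℝ ∞ a closedHalfSpace) (hf : ContDiffOn ℝ ∞ f closedHalfSpace)
    (v : ℝ × E3) {z : ℝ × E3} (hz : z ∈ closedHalfSpace) :
    dirDeriv v (fun y => a y • f y) z = a z • dirDeriv v f z + dirDeriv v a z • f z := by
  rw [dirDeriv, fderivWithin_fun_smul (uniqueDiffOn_closedHalfSpace z hz)
    (ha.differentiableOn (by simp) z hz) (hf.differentiableOn (by simp) z hz)]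
  simp [dirDeriv]

theorem dirDeriv_inner {f g : ℝ × E3 → E3} (hf : ContDiffOn ℝ ∞ f closedHalfSpace)
    (hg : ContDiffOn ℝ ∞ g closedHalfSpace) (v : ℝ × E3) {z : ℝ × E3} (hz : z ∈ closedHalfSpace) :
    dirDeriv v (fun y => inner ℝ (f y) (g y)) z =
      inner ℝ (f z) (dirDeriv v g z) + inner ℝ (dirDeriv v f z) (g z) := by
  have h := (hf.differentiableOn (by simp) z hz).hasFDerivWithinAt.inner ℝ
    (hg.differentiableOn (by simp) z hz).hasFDerivWithinAt
  rw [dirDeriv, h.fderivWithin (uniqueDiffOn_closedHalfSpace z hz)]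
  simp [dirDeriv, fderivInnerCLM_apply]

theorem contDiffOn_spatial {χ : E3 → F} (hχ : ContDiff ℝ ∞ χ) :
    ContDiffOn ℝ ∞ (fun z : ℝ × E3 => χ z.2) closedHalfSpace :=
  (hχ.comp contDiff_snd).contDiffOn

theorem dirDeriv_spatial {χ : E3 → F} (hχ : ContDiff ℝ ∞ χ) (v : ℝ × E3) {z : ℝ × E3}
    (hz : z ∈ closedHalfSpace) :
    dirDeriv v (fun z : ℝ × E3 => χ z.2) z = fderiv ℝ χ z.2 v.2 := by
  have h : HasFDerivAt (fun z : ℝ × E3 => χ z.2)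
      ((fderiv ℝ χ z.2).comp (ContinuousLinearMap.snd ℝ ℝ E3)) z :=
    ((hχ.differentiable (by simp)) z.2).hasFDerivAt.comp z hasFDerivAt_snd
  rw [dirDeriv, h.hasFDerivWithinAt.fderivWithin (uniqueDiffOn_closedHalfSpace z hz)]
  simp

/-- The bounded space-time cylinder `(0,S) × {|x| ≤ R}`. -/
def cylinder (S R : ℝ) : Set (ℝ × E3) := Ioo (0 : ℝ) S ×ˢ Metric.closedBall (0 : E3) R

/-- `f` is integrable on bounded cylinders: local integrability in `[0,∞) × ℝ³`, that is, up to
the initial time. -/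
def CylinderIntegrable {F : Type*} [NormedAddCommGroup F] (f : ℝ × E3 → F) : Prop :=
  ∀ S R : ℝ, IntegrableOn f (cylinder S R)

/-- `G` vanishes on `[0,∞) × ℝ³` outside of a bounded set of positions. -/
def HasBoundedSpatialSupport {F : Type*} [NormedAddCommGroup F] (G : ℝ × E3 → F) : Prop :=
  ∃ R : ℝ, ∀ z ∈ closedHalfSpace, R < ‖z.2‖ → G z = 0

theorem measurableSet_cylinder (S R : ℝ) : MeasurableSet (cylinder S R) :=
  measurableSet_Ioo.prod Metric.isClosed_closedBall.measurableSet

theorem cylinder_subset_slab (S R : ℝ) : cylinder S R ⊆ slab S :=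
  prod_mono subset_rfl (subset_univ _)

theorem mem_cylinder {S R : ℝ} {z : ℝ × E3} : z ∈ cylinder S R ↔ z ∈ slab S ∧ ‖z.2‖ ≤ R := by
  simp [cylinder, slab]

theorem slab_eq_iUnion_cylinder (S : ℝ) : slab S = ⋃ n : ℕ, cylinder S n := by
  ext z
  simp only [mem_iUnion, mem_cylinder, exists_and_left]
  exact ⟨fun hz => ⟨hz, exists_nat_ge _⟩, fun hz => hz.1⟩

theorem dirDeriv_eq_zero_of_isOpen {G : ℝ × E3 → F} {U : Set (ℝ × E3)} (hU : IsOpen U)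
    (hG : ∀ z ∈ closedHalfSpace, z ∈ U → G z = 0) (v : ℝ × E3) {z : ℝ × E3}
    (hz : z ∈ closedHalfSpace) (hzU : z ∈ U) : dirDeriv v G z = 0 := by
  have hzero : G =ᶠ[𝓝[closedHalfSpace] z] fun _ => 0 := by
    filter_upwards [mem_nhdsWithin_of_mem_nhds (hU.mem_nhds hzU), self_mem_nhdsWithin]
      with y hyU hy using hG y hy hyU
  rw [dirDeriv, hzero.fderivWithin_eq (hG z hz hzU)]
  simp

theorem HasBoundedSpatialSupport.dirDeriv {G : ℝ × E3 → F} (hG : HasBoundedSpatialSupport G)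
    (v : ℝ × E3) : HasBoundedSpatialSupport (dirDeriv v G) := by
  obtain ⟨R, hR⟩ := hG
  have hU : IsOpen {z : ℝ × E3 | R < ‖z.2‖} := isOpen_lt continuous_const (by fun_prop)
  exact ⟨R, fun z hz hzR => dirDeriv_eq_zero_of_isOpen hU hR v hz hzR⟩

theorem HasBoundedSpatialSupport.exists_bound {F : Type*} [NormedAddCommGroup F]
    {G : ℝ × E3 → F} (hG : HasBoundedSpatialSupport G)
    (hc : ContinuousOn G closedHalfSpace) (S : ℝ) :
    ∃ C : ℝ, ∀ z ∈ closedHalfSpace, z.1 ≤ S → ‖G z‖ ≤ C := by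
  obtain ⟨R, hR⟩ := hG
  obtain ⟨C, hC⟩ := ((isCompact_Icc (a := (0 : ℝ)) (b := S)).prod
    (isCompact_closedBall (0 : E3) R)).exists_bound_of_continuousOn
      (hc.mono (prod_mono Icc_subset_Ici_self (subset_univ _)))
  refine ⟨max C 0, fun z hz hzS => ?_⟩
  by_cases hzR : R < ‖z.2‖
  · rw [hR z hz hzR, norm_zero]
    exact le_max_right _ _
  · exact (hC z ⟨⟨hz.1, hzS⟩, by simpa using hzR⟩).trans (le_max_left _ _)

instance isAddHaarMeasure_volume : (volume : Measure (ℝ × E3)).IsAddHaarMeasure := by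
  rw [Measure.volume_eq_prod]
  infer_instance

theorem restrict_slab (S : ℝ) :
    (volume : Measure (ℝ × E3)).restrict (slab S) =
      (volume.restrict (Ioo (0 : ℝ) S)).prod (volume : Measure E3) := by
  rw [slab, Measure.volume_eq_prod, ← Measure.prod_restrict, Measure.restrict_univ]

theorem restrict_halfSpace :
    (volume : Measure (ℝ × E3)).restrict halfSpace =
      (volume.restrict (Ioi (0 : ℝ))).prod (volume : Measure E3) := by
  rw [halfSpace, Measure.volume_eq_prod, ← Measure.prod_restrict, Measure.restrict_univ]

theorem integral_slab {S : ℝ} {f : ℝ × E3 → F} (hf : IntegrableOn f (slab S)) :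
    ∫ z in slab S, f z = ∫ t in Ioo (0 : ℝ) S, ∫ x, f (t, x) := by
  rw [IntegrableOn, restrict_slab] at hf
  rw [restrict_slab, integral_prod _ hf]

theorem integrableOn_integral_slab {S : ℝ} {f : ℝ × E3 → F} (hf : IntegrableOn f (slab S)) :
    IntegrableOn (fun t => ∫ x, f (t, x)) (Ioo 0 S) := by
  rw [IntegrableOn, restrict_slab] at hf
  exact hf.integral_prod_left

theorem ae_integrable_slice {F : Type*} [NormedAddCommGroup F] {S : ℝ} {f : ℝ × E3 → F}
    (hf : IntegrableOn f (slab S)) :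
    ∀ᵐ t ∂(volume.restrict (Ioo 0 S)), Integrable (fun x => f (t, x)) := by
  rw [IntegrableOn, restrict_slab] at hf
  exact hf.prod_right_ae

theorem ae_restrict_Ioi_of_forall_Ioo {p : ℝ → Prop} {a : ℝ}
    (h : ∀ b : ℝ, ∀ᵐ t ∂(volume.restrict (Ioo a b)), p t) :
    ∀ᵐ t ∂(volume.restrict (Ioi a)), p t := by
  have hU : Ioi a = ⋃ n : ℕ, Ioo a n := by
    ext t
    simp only [mem_Ioi, mem_iUnion, mem_Ioo, exists_and_left]
    exact ⟨fun ht => ⟨ht, exists_nat_gt t⟩, fun ht => ht.1⟩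
  rw [hU, ae_restrict_iUnion_iff]
  exact fun n => h n

theorem aestronglyMeasurable_slab_of_continuousOn {F : Type*} [NormedAddCommGroup F]
    [SecondCountableTopology F] {G : ℝ × E3 → F}
    (hc : ContinuousOn G closedHalfSpace) (S : ℝ) :
    AEStronglyMeasurable G (volume.restrict (slab S)) :=
  (hc.mono (slab_subset_closedHalfSpace S)).aestronglyMeasurable (measurableSet_slab S)

section CylinderIntegrable

variable {F : Type*} [NormedAddCommGroup F]

theorem cylinderIntegrable_of_continuousOn {f : ℝ × E3 → F}
    (hf : ContinuousOn f closedHalfSpace) : CylinderIntegrable f := by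
  intro S R
  refine IntegrableOn.mono_set (t := Icc 0 S ×ˢ Metric.closedBall 0 R) ?_
    (prod_mono Ioo_subset_Icc_self subset_rfl)
  exact (hf.mono (prod_mono Icc_subset_Ici_self (subset_univ _))).integrableOn_compact
    (isCompact_Icc.prod (isCompact_closedBall _ _))

theorem CylinderIntegrable.aestronglyMeasurable {f : ℝ × E3 → F} (hf : CylinderIntegrable f)
    (S : ℝ) : AEStronglyMeasurable f (volume.restrict (slab S)) := by
  rw [slab_eq_iUnion_cylinder]
  exact AEStronglyMeasurable.iUnion fun n => (hf S n).aestronglyMeasurable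

theorem CylinderIntegrable.integrableOn_slab_of_norm_le {F₁ F₂ : Type*}
    [NormedAddCommGroup F₁] [NormedAddCommGroup F₂] {f : ℝ × E3 → F} {G : ℝ × E3 → F₁}
    {h : ℝ × E3 → F₂} (hf : CylinderIntegrable f) (hG : HasBoundedSpatialSupport G)
    (hc : ContinuousOn G closedHalfSpace) {S : ℝ}
    (hm : AEStronglyMeasurable h (volume.restrict (slab S)))
    (hle : ∀ z, ‖h z‖ ≤ ‖G z‖ * ‖f z‖) : IntegrableOn h (slab S) := by
  obtain ⟨C, hC⟩ := hG.exists_bound hc S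
  obtain ⟨R, hR⟩ := hG
  have hcyl : IntegrableOn h (cylinder S R) := by
    refine ((hf S R).norm.const_mul C).mono'
      (hm.mono_measure (Measure.restrict_mono (cylinder_subset_slab S R) le_rfl)) ?_
    filter_upwards [ae_restrict_mem (measurableSet_cylinder S R)] with z hz
    exact (hle z).trans (mul_le_mul_of_nonneg_right
      (hC z (slab_subset_closedHalfSpace S (cylinder_subset_slab S R hz)) hz.1.2.le)
      (norm_nonneg _))
  refine hcyl.of_forall_sdiff_eq_zero (measurableSet_slab S) fun z hz => ?_
  have hzR : R < ‖z.2‖ := lt_of_not_ge fun hle => hz.2 (mem_cylinder.2 ⟨hz.1, hle⟩)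
  have hzero := hle z
  rw [hR z (slab_subset_closedHalfSpace S hz.1) hzR, norm_zero, zero_mul] at hzero
  exact norm_le_zero_iff.1 hzero

theorem integrableOn_slab_of_continuousOn [SecondCountableTopology F] {G : ℝ × E3 → F}
    (hG : HasBoundedSpatialSupport G) (hc : ContinuousOn G closedHalfSpace) (S : ℝ) :
    IntegrableOn G (slab S) :=
  (cylinderIntegrable_of_continuousOn (f := fun _ => (1 : ℝ))
    continuousOn_const).integrableOn_slab_of_norm_le hG hc
      (aestronglyMeasurable_slab_of_continuousOn hc S) fun z => by simp

theorem CylinderIntegrable.integrableOn_inner {G f : ℝ × E3 → E3} (hf : CylinderIntegrable f)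
    (hG : HasBoundedSpatialSupport G) (hc : ContinuousOn G closedHalfSpace) (S : ℝ) :
    IntegrableOn (fun z => inner ℝ (G z) (f z)) (slab S) :=
  hf.integrableOn_slab_of_norm_le hG hc
    ((aestronglyMeasurable_slab_of_continuousOn hc S).inner (hf.aestronglyMeasurable S))
    fun _ => norm_inner_le_norm _ _

end CylinderIntegrable

/-! ### Weak derivatives -/

theorem integrable_smul_of_tsupport_subset {X : Type*} [TopologicalSpace X] [T2Space X]
    [MeasurableSpace X] [OpensMeasurableSpace X] {μ : Measure X} {s : Set X} {φ : X → ℝ}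
    {f : X → F} (hφ : Continuous φ) (hcs : HasCompactSupport φ) (hsub : tsupport φ ⊆ s)
    (hf : LocallyIntegrableOn f s μ) : Integrable (fun z => φ z • f z) μ := by
  have hsupp : Function.support (fun z => φ z • f z) ⊆ tsupport φ :=
    (Function.support_smul_subset_left φ f).trans (subset_tsupport φ)
  rw [← integrableOn_iff_integrable_of_support_subset hsupp]
  exact (hf.integrableOn_compact_subset hsub hcs).continuousOn_smul hφ.continuousOn hcs

theorem contDiff_of_forall_tsupport {E : Type*} [NormedAddCommGroup E] [NormedSpace ℝ E]
    {f : E → F} (h : ∀ x ∈ tsupport f, ContDiffAt ℝ ∞ f x) : ContDiff ℝ ∞ f := by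
  refine contDiff_iff_contDiffAt.2 fun x => ?_
  by_cases hx : x ∈ tsupport f
  · exact h x hx
  · exact contDiffAt_const.congr_of_eventuallyEq (notMem_tsupport_iff_eventuallyEq.1 hx)

theorem setIntegral_smul_of_tsupport_subset {X : Type*} [TopologicalSpace X] [MeasurableSpace X]
    {μ : Measure X} {s : Set X} {φ : X → ℝ} (hsub : tsupport φ ⊆ s) (f : X → F) :
    ∫ z in s, φ z • f z ∂μ = ∫ z, φ z • f z ∂μ :=
  setIntegral_eq_integral_of_forall_compl_eq_zero fun z hz => by
    rw [image_eq_zero_of_notMem_tsupport fun hz' => hz (hsub hz'), zero_smul]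

theorem isWeakDeriv_dirDeriv {f : ℝ × E3 → E3} (hf : ContDiffOn ℝ ∞ f closedHalfSpace)
    (v : ℝ × E3) : IsWeakDeriv v f (dirDeriv v f) := by
  have hf_loc : LocallyIntegrableOn f halfSpace :=
    (hf.continuousOn.mono halfSpace_subset_closedHalfSpace).locallyIntegrableOn
      measurableSet_halfSpace
  have hdf_loc : LocallyIntegrableOn (dirDeriv v f) halfSpace :=
    ((contDiffOn_dirDeriv hf v).continuousOn.mono
      halfSpace_subset_closedHalfSpace).locallyIntegrableOn measurableSet_halfSpace
  refine ⟨hf_loc, hdf_loc, fun φ hφ hcs hsub => ?_⟩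
  have hφ_cont : Continuous fun z => fderiv ℝ φ z v :=
    (hφ.continuous_fderiv (by simp)).clm_apply continuous_const
  have hsub' : tsupport (fun z => fderiv ℝ φ z v) ⊆ halfSpace :=
    (tsupport_fderiv_apply_subset ℝ v).trans hsub
  have hclassical : (fun z => φ z • dirDeriv v f z) = fun z => φ z • fderiv ℝ f z v := by
    funext z
    by_cases hz : z ∈ halfSpace
    · rw [dirDeriv_eq_fderiv hz]
    · rw [image_eq_zero_of_notMem_tsupport fun hz' => hz (hsub hz'), zero_smul, zero_smul]
  rw [setIntegral_smul_of_tsupport_subset hsub', setIntegral_smul_of_tsupport_subset hsub,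
    hclassical,
    integral_smul_fderiv_eq_neg_fderiv_smul_of_integrable
      (integrable_smul_of_tsupport_subset hφ_cont (hcs.fderiv_apply ℝ v) hsub' hf_loc)
      (hclassical ▸ integrable_smul_of_tsupport_subset hφ.continuous hcs hsub hdf_loc)
      (integrable_smul_of_tsupport_subset hφ.continuous hcs hsub hf_loc)
      (fun z _ => hφ.differentiable (by simp) z)
      fun z hz => (hasFDerivAt_of_mem_halfSpace hf (hsub hz)).differentiableAt, neg_neg]

theorem inner_eq_sum (a b : E3) : inner ℝ a b = ∑ j, a j * b j := by
  simp [PiLp.inner_apply, mul_comm]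

theorem sum_smul_basisVec (a : E3) : ∑ j, a j • basisVec j = a := by
  ext k
  simp [basisVec, Pi.single_apply]

theorem integral_bilinear_eq_sum {X : Type*} [MeasurableSpace X] {μ : Measure X} [CompleteSpace F]
    (B : E3 →L[ℝ] E3 →L[ℝ] F) {Ψ f : X → E3} (hf : ∀ j, Integrable (fun z => Ψ z j • f z) μ) :
    ∫ z, B (Ψ z) (f z) ∂μ = ∑ j, B (basisVec j) (∫ z, Ψ z j • f z ∂μ) := by
  have hexpand : ∀ z, B (Ψ z) (f z) = ∑ j, B (basisVec j) (Ψ z j • f z) := fun z => by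
    conv_lhs => rw [← sum_smul_basisVec (Ψ z)]
    simp
  simp_rw [hexpand]
  rw [integral_finsetSum _ fun j _ => (B (basisVec j)).integrable_comp (hf j)]
  exact Finset.sum_congr rfl fun j _ => (B (basisVec j)).integral_comp_comm (hf j)

theorem tsupport_apply_subset {X : Type*} [TopologicalSpace X] (Φ : X → E3) (j : Fin 3) :
    tsupport (fun z => Φ z j) ⊆ tsupport Φ :=
  closure_mono fun z hz h => hz (by simp [h])

theorem fderiv_apply_apply {E : Type*} [NormedAddCommGroup E] [NormedSpace ℝ E] {Φ : E → E3}
    {z : E} (hΦ : DifferentiableAt ℝ Φ z) (v : E) (j : Fin 3) :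
    fderiv ℝ (fun y => Φ y j) z v = fderiv ℝ Φ z v j := by
  have h : HasFDerivAt (fun y => Φ y j) _ z :=
    (EuclideanSpace.proj (𝕜 := ℝ) j).hasFDerivAt.comp z hΦ.hasFDerivAt
  rw [h.fderiv]
  rfl

/-- `g` is the weak derivative of `f` on `Ω` in the direction `v`. The weak derivatives
`IsWeakDeriv` are the case `Ω = (0,∞) × ℝ³`; the case `Ω = ℝ × ℝ³` serves for localized maps. -/
def IsWeakDerivOn (Ω : Set (ℝ × E3)) (v : ℝ × E3) (f g : ℝ × E3 → E3) : Prop :=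
  LocallyIntegrableOn f Ω ∧ LocallyIntegrableOn g Ω ∧
    ∀ φ : ℝ × E3 → ℝ, ContDiff ℝ ∞ φ → HasCompactSupport φ → tsupport φ ⊆ Ω →
      ∫ z in Ω, (fderiv ℝ φ z v) • f z = - ∫ z in Ω, φ z • g z

theorem IsWeakDeriv.isWeakDerivOn {v : ℝ × E3} {f g : ℝ × E3 → E3} (h : IsWeakDeriv v f g) :
    IsWeakDerivOn halfSpace v f g := h

theorem IsWeakDerivOn.integral_bilinear [CompleteSpace F] {Ω : Set (ℝ × E3)} {v : ℝ × E3}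
    {f g : ℝ × E3 → E3} (h : IsWeakDerivOn Ω v f g) (B : E3 →L[ℝ] E3 →L[ℝ] F)
    {Φ : ℝ × E3 → E3} (hΦ : ContDiff ℝ ∞ Φ) (hcs : HasCompactSupport Φ)
    (hsub : tsupport Φ ⊆ Ω) :
    ∫ z in Ω, B (fderiv ℝ Φ z v) (f z) = - ∫ z in Ω, B (Φ z) (g z) := by
  obtain ⟨hf, hg, hweak⟩ := h
  have hΦ_smooth : ∀ j, ContDiff ℝ ∞ (fun z => Φ z j) := fun j => contDiff_euclidean.1 hΦ j
  have hΦ_cs : ∀ j, HasCompactSupport (fun z => Φ z j) := fun j =>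
    hcs.mono' ((subset_tsupport _).trans (tsupport_apply_subset Φ j))
  have hΦ_sub : ∀ j, tsupport (fun z => Φ z j) ⊆ Ω := fun j =>
    (tsupport_apply_subset Φ j).trans hsub
  have hcoord : ∀ j z, fderiv ℝ Φ z v j = fderiv ℝ (fun z => Φ z j) z v := fun j z =>
    (fderiv_apply_apply (hΦ.differentiable (by simp) z) v j).symm
  rw [integral_bilinear_eq_sum B fun j => ?_, integral_bilinear_eq_sum B fun j => ?_,
    ← Finset.sum_neg_distrib]
  · simp only [hcoord, hweak _ (hΦ_smooth _) (hΦ_cs _) (hΦ_sub _), map_neg]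
  · exact (integrable_smul_of_tsupport_subset (hΦ_smooth j).continuous (hΦ_cs j) (hΦ_sub j)
      hg).integrableOn
  · simp only [hcoord]
    exact (integrable_smul_of_tsupport_subset
      (((hΦ_smooth j).continuous_fderiv (by simp)).clm_apply continuous_const)
      ((hΦ_cs j).fderiv_apply ℝ v) ((tsupport_fderiv_apply_subset ℝ v).trans (hΦ_sub j))
      hf).integrableOn

theorem integrableOn_halfSpace_time_mul {J : ℝ × E3 → ℝ} (hJ : ∀ S, IntegrableOn J (slab S))
    {α : ℝ → ℝ} (hα : Continuous α) (hαc : HasCompactSupport α) :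
    IntegrableOn (fun z => α z.1 * J z) halfSpace := by
  obtain ⟨S, hS⟩ := hαc.isBounded.bddAbove
  obtain ⟨C, hC⟩ := hαc.exists_bound_of_continuous hα
  have hslab : IntegrableOn (fun z => α z.1 * J z) (slab (S + 1)) :=
    Integrable.bdd_mul (hJ _) (hα.comp continuous_fst).aestronglyMeasurable
      (Eventually.of_forall fun z => hC z.1)
  refine hslab.of_forall_sdiff_eq_zero measurableSet_halfSpace fun z hz => ?_
  have hzS : z.1 ∉ tsupport α := fun h =>
    hz.2 ⟨⟨hz.1.1, (hS h).trans_lt (lt_add_one S)⟩, mem_univ _⟩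
  rw [image_eq_zero_of_notMem_tsupport hzS, zero_mul]

theorem integral_halfSpace_time_mul {J : ℝ × E3 → ℝ} (hJ : ∀ S, IntegrableOn J (slab S))
    {α : ℝ → ℝ} (hα : Continuous α) (hαc : HasCompactSupport α) :
    ∫ z in halfSpace, α z.1 * J z = ∫ t in Ioi (0 : ℝ), α t * ∫ x, J (t, x) := by
  have hint := integrableOn_halfSpace_time_mul hJ hα hαc
  rw [IntegrableOn, restrict_halfSpace] at hint
  rw [restrict_halfSpace, integral_prod _ hint]
  simp only [integral_const_mul]

theorem locallyIntegrableOn_Ioi_of_forall_Ioo {f : ℝ → ℝ} {a : ℝ}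
    (hf : ∀ b, IntegrableOn f (Ioo a b)) : LocallyIntegrableOn f (Ioi a) := by
  rw [locallyIntegrableOn_iff isOpen_Ioi.isLocallyClosed]
  intro k hk hkc
  obtain ⟨S, hS⟩ := hkc.isBounded.bddAbove
  exact (hf (S + 1)).mono_set fun t ht => ⟨hk ht, (hS ht).trans_lt (lt_add_one S)⟩

theorem ae_Ioi_eq_zero_of_integral_mul {f : ℝ → ℝ} {a : ℝ} (hf : ∀ b, IntegrableOn f (Ioo a b))
    (h : ∀ ψ : ℝ → ℝ, ContDiff ℝ ∞ ψ → HasCompactSupport ψ → tsupport ψ ⊆ Ioi a →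
      ∫ t in Ioi a, ψ t * f t = 0) : ∀ᵐ t ∂(volume.restrict (Ioi a)), f t = 0 := by
  rw [ae_restrict_iff' measurableSet_Ioi]
  refine isOpen_Ioi.ae_eq_zero_of_integral_contDiff_smul_eq_zero
    (locallyIntegrableOn_Ioi_of_forall_Ioo hf) fun ψ hψ hψc hψs => ?_
  rw [← setIntegral_smul_of_tsupport_subset hψs]
  exact h ψ hψ hψc hψs

section TimeCutoff

variable {G : ℝ × E3 → E3} {α : ℝ → ℝ}

theorem tsupport_time_smul_subset (hαs : tsupport α ⊆ Ioi 0) :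
    tsupport (fun z : ℝ × E3 => α z.1 • G z) ⊆ halfSpace := by
  have hclosure : tsupport (fun z : ℝ × E3 => α z.1 • G z) ⊆ tsupport α ×ˢ univ :=
    closure_minimal (fun z hz => ⟨subset_tsupport _ fun h => hz (by simp [h]), mem_univ _⟩)
      ((isClosed_tsupport α).prod isClosed_univ)
  exact hclosure.trans (prod_mono hαs subset_rfl)

theorem contDiff_time_smul (hG : ContDiffOn ℝ ∞ G closedHalfSpace) (hα : ContDiff ℝ ∞ α)
    (hαs : tsupport α ⊆ Ioi 0) : ContDiff ℝ ∞ (fun z : ℝ × E3 => α z.1 • G z) :=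
  contDiff_of_forall_tsupport fun z hz => (hα.contDiffAt.comp z contDiffAt_fst).smul
    (contDiffAt_of_mem_halfSpace hG (tsupport_time_smul_subset hαs hz))

theorem hasCompactSupport_time_smul (hG : HasBoundedSpatialSupport G)
    (hαc : HasCompactSupport α) (hαs : tsupport α ⊆ Ioi 0) :
    HasCompactSupport (fun z : ℝ × E3 => α z.1 • G z) := by
  obtain ⟨R, hR⟩ := hG
  refine HasCompactSupport.of_support_subset_isCompact
    (hαc.isCompact.prod (isCompact_closedBall 0 R)) fun z hz =>
      ⟨subset_tsupport _ fun h => hz (by simp [h]), by_contra fun h => hz ?_⟩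
  have hzR : R < ‖z.2‖ := by simpa using h
  have hzΩ : z ∈ halfSpace := tsupport_time_smul_subset hαs (subset_tsupport _ hz)
  simp [hR z (halfSpace_subset_closedHalfSpace hzΩ) hzR]

theorem fderiv_time_smul (hG : ContDiffOn ℝ ∞ G closedHalfSpace) (hα : ContDiff ℝ ∞ α)
    (v : ℝ × E3) {z : ℝ × E3} (hz : z ∈ halfSpace) :
    fderiv ℝ (fun z : ℝ × E3 => α z.1 • G z) z v =
      α z.1 • dirDeriv v G z + (v.1 * deriv α z.1) • G z := by
  have hαz : HasFDerivAt (fun z : ℝ × E3 => α z.1) _ z :=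
    ((hα.differentiable (by simp)) z.1).hasFDerivAt.comp z hasFDerivAt_fst
  have hprod : HasFDerivAt (fun z : ℝ × E3 => α z.1 • G z) _ z :=
    hαz.smul (hasFDerivAt_of_mem_halfSpace hG hz)
  rw [dirDeriv_eq_fderiv hz, hprod.fderiv]
  simp [fderiv_eq_smul_deriv]

theorem IsWeakDeriv.integral_time_smul {v : ℝ × E3} {f g : ℝ × E3 → E3} (h : IsWeakDeriv v f g)
    (hG : ContDiffOn ℝ ∞ G closedHalfSpace) (hG_supp : HasBoundedSpatialSupport G)
    (hα : ContDiff ℝ ∞ α) (hαc : HasCompactSupport α) (hαs : tsupport α ⊆ Ioi 0) :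
    ∫ z in halfSpace, inner ℝ (α z.1 • dirDeriv v G z + (v.1 * deriv α z.1) • G z) (f z) =
      - ∫ z in halfSpace, α z.1 * inner ℝ (G z) (g z) := by
  have hpair := h.isWeakDerivOn.integral_bilinear (innerSL ℝ) (contDiff_time_smul hG hα hαs)
    (hasCompactSupport_time_smul hG_supp hαc hαs) (tsupport_time_smul_subset hαs)
  rw [setIntegral_congr_fun measurableSet_halfSpace fun z hz => by
    rw [fderiv_time_smul hG hα v hz]] at hpair
  simpa only [innerSL_apply_apply ℝ, real_inner_smul_left] using hpair

end TimeCutoff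

theorem IsWeakDeriv.integral_slice_space {i : Fin 3} {f g : ℝ × E3 → E3}
    (h : IsWeakDeriv (spaceDir i) f g) (hf : CylinderIntegrable f) (hg : CylinderIntegrable g)
    {G : ℝ × E3 → E3} (hG : ContDiffOn ℝ ∞ G closedHalfSpace)
    (hG_supp : HasBoundedSpatialSupport G) :
    ∀ᵐ t ∂(volume.restrict (Ioi (0 : ℝ))),
      ∫ x, inner ℝ (∂ₓ[i] G (t, x)) (f (t, x)) = - ∫ x, inner ℝ (G (t, x)) (g (t, x)) := by
  have hf_int := hf.integrableOn_inner (hG_supp.dirDeriv (spaceDir i))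
    (contDiffOn_dirDeriv hG _).continuousOn
  have hg_int := hg.integrableOn_inner hG_supp hG.continuousOn
  have hsum_int : ∀ S, IntegrableOn
      (fun z => inner ℝ (∂ₓ[i] G z) (f z) + inner ℝ (G z) (g z)) (slab S) := fun S =>
    (hf_int S).add (hg_int S)
  have hzero : ∀ᵐ t ∂(volume.restrict (Ioi (0 : ℝ))),
      ∫ x, (inner ℝ (∂ₓ[i] G (t, x)) (f (t, x)) + inner ℝ (G (t, x)) (g (t, x))) = 0 := by
    refine ae_Ioi_eq_zero_of_integral_mul (fun S => integrableOn_integral_slab (hsum_int S))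
      fun α hα hαc hαs => ?_
    have htest := h.integral_time_smul hG hG_supp hα hαc hαs
    simp only [spaceDir, zero_mul, zero_smul, add_zero, real_inner_smul_left] at htest
    rw [← integral_halfSpace_time_mul hsum_int hα.continuous hαc]
    simp only [mul_add]
    rw [integral_add (integrableOn_halfSpace_time_mul hf_int hα.continuous hαc)
      (integrableOn_halfSpace_time_mul hg_int hα.continuous hαc)]
    exact (congrArg (· + _) htest).trans (neg_add_cancel _)
  refine ae_restrict_Ioi_of_forall_Ioo fun S => ?_
  filter_upwards [ae_restrict_of_ae_restrict_of_subset Ioo_subset_Ioi_self hzero,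
    ae_integrable_slice (hf_int S), ae_integrable_slice (hg_int S)] with t ht htf htg
  rw [integral_add htf htg] at ht
  linarith

theorem IsWeakDeriv.integral_slab_space {i : Fin 3} {f g : ℝ × E3 → E3}
    (h : IsWeakDeriv (spaceDir i) f g) (hf : CylinderIntegrable f) (hg : CylinderIntegrable g)
    {G : ℝ × E3 → E3} (hG : ContDiffOn ℝ ∞ G closedHalfSpace)
    (hG_supp : HasBoundedSpatialSupport G) (S : ℝ) :
    ∫ z in slab S, (inner ℝ (∂ₓ[i] G z) (f z) : ℝ) =
      - ∫ z in slab S, (inner ℝ (G z) (g z) : ℝ) := by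
  rw [integral_slab (hf.integrableOn_inner (hG_supp.dirDeriv _)
    (contDiffOn_dirDeriv hG _).continuousOn S),
    integral_slab (hg.integrableOn_inner hG_supp hG.continuousOn S), ← integral_neg]
  exact integral_congr_ae (ae_restrict_of_ae_restrict_of_subset Ioo_subset_Ioi_self
    (h.integral_slice_space hf hg hG hG_supp))

open scoped Convolution in
/-- Regularization of `h` by convolution with the normalized bump function `ρ`. -/
def mollify (ρ : ContDiffBump (0 : ℝ × E3)) (h : ℝ × E3 → E3) : ℝ × E3 → E3 :=
  ρ.normed volume ⋆[ContinuousLinearMap.lsmul ℝ ℝ, volume] h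

theorem mollify_apply (ρ : ContDiffBump (0 : ℝ × E3)) (h : ℝ × E3 → E3) (z : ℝ × E3) :
    mollify ρ h z = ∫ y, ρ.normed volume (z - y) • h y := by
  rw [mollify, convolution_eq_swap]
  rfl

theorem contDiff_mollify (ρ : ContDiffBump (0 : ℝ × E3)) {h : ℝ × E3 → E3}
    (hh : LocallyIntegrable h) : ContDiff ℝ ∞ (mollify ρ h) :=
  ρ.hasCompactSupport_normed.contDiff_convolution_left _ ρ.contDiff_normed hh

theorem norm_mollify_le (ρ : ContDiffBump (0 : ℝ × E3)) {h : ℝ × E3 → E3} {C : ℝ}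
    (hC : ∀ᵐ y, ‖h y‖ ≤ C) (z : ℝ × E3) : ‖mollify ρ h z‖ ≤ C := by
  have hρ : Integrable (fun y => ρ.normed volume (z - y)) :=
    (ρ.integrable_normed (μ := volume)).comp_sub_left z
  have hle : ‖∫ y, ρ.normed volume (z - y) • h y‖ ≤ ∫ y, ρ.normed volume (z - y) * C := by
    refine norm_integral_le_of_norm_le (hρ.mul_const C) ?_
    filter_upwards [hC] with y hy
    rw [norm_smul, Real.norm_of_nonneg (ρ.nonneg_normed _)]
    exact mul_le_mul_of_nonneg_left hy (ρ.nonneg_normed _)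
  rwa [mollify_apply, ← one_mul C, ← ρ.integral_normed (μ := volume),
    ← integral_sub_left_eq_self (fun y => ρ.normed volume y) volume z, ← integral_mul_const]

theorem integral_inner_mollify (ρ : ContDiffBump (0 : ℝ × E3)) {f g : ℝ × E3 → E3}
    (hf : Integrable f) (hg : Integrable g) :
    ∫ z, inner ℝ (mollify ρ f z) (g z) = ∫ z, inner ℝ (f z) (mollify ρ g z) := by
  obtain ⟨C, hC⟩ := (ρ.hasCompactSupport_normed (μ := volume)).exists_bound_of_continuous
    ρ.continuous_normed
  have hρ_bdd : ∀ (z : ℝ × E3) {h : ℝ × E3 → E3}, Integrable h →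
      Integrable fun y => ρ.normed volume (z - y) • h y := fun z h hh =>
    hh.bdd_smul C (ρ.continuous_normed.comp (by fun_prop)).aestronglyMeasurable
      (Eventually.of_forall fun y => hC _)
  have hpair : Integrable (fun p : (ℝ × E3) × (ℝ × E3) =>
      ρ.normed volume (p.1 - p.2) * inner ℝ (f p.2) (g p.1)) (volume.prod volume) := by
    refine Integrable.bdd_mul ((hg.norm.mul_prod hf.norm).mono'
        (hf.aestronglyMeasurable.comp_snd.inner hg.aestronglyMeasurable.comp_fst)
        (Eventually.of_forall fun p => ?_))
      (ρ.continuous_normed.comp (by fun_prop)).aestronglyMeasurable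
      (Eventually.of_forall fun p => hC _)
    rw [mul_comm]
    exact norm_inner_le_norm _ _
  have hleft : ∀ z, inner ℝ (mollify ρ f z) (g z) =
      ∫ y, ρ.normed volume (z - y) * inner ℝ (f y) (g z) := fun z => by
    rw [mollify_apply, real_inner_comm, ← integral_inner (hρ_bdd z hf)]
    simp only [real_inner_smul_right, real_inner_comm]
  have hright : ∀ y, inner ℝ (f y) (mollify ρ g y) =
      ∫ z, ρ.normed volume (z - y) * inner ℝ (f y) (g z) := fun y => by
    rw [mollify_apply, ← integral_inner (hρ_bdd y hg)]
    simp only [real_inner_smul_right, ← neg_sub _ y, ρ.normed_neg]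
  simp_rw [hleft, hright]
  exact integral_integral_swap hpair

theorem exists_seq_mollify_tendsto : ∃ ρ : ℕ → ContDiffBump (0 : ℝ × E3),
    ∀ h : ℝ × E3 → E3, LocallyIntegrable h →
      ∀ᵐ z, Tendsto (fun n => mollify (ρ n) h z) atTop (𝓝 (h z)) := by
  have hpos : ∀ n : ℕ, (0 : ℝ) < 1 / (n + 1) := fun n => by positivity
  refine ⟨fun n => ⟨1 / (n + 1) / 2, 1 / (n + 1), half_pos (hpos n), half_lt_self (hpos n)⟩,
    fun h hh => ?_⟩
  exact ContDiffBump.ae_convolution_tendsto_right_of_locallyIntegrable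
    tendsto_one_div_add_atTop_nhds_zero_nat
    (Eventually.of_forall fun n => (mul_div_cancel₀ _ two_ne_zero).ge) hh

theorem tendsto_integral_inner_mollify {ρ : ℕ → ContDiffBump (0 : ℝ × E3)}
    {f g : ℝ × E3 → E3} {C : ℝ} (hf : LocallyIntegrable f) (hfC : ∀ᵐ z, ‖f z‖ ≤ C)
    (hg : Integrable g)
    (hρ : ∀ᵐ z, Tendsto (fun n => mollify (ρ n) f z) atTop (𝓝 (f z))) :
    Tendsto (fun n => ∫ z, inner ℝ (mollify (ρ n) f z) (g z)) atTop
      (𝓝 (∫ z, inner ℝ (f z) (g z))) := by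
  refine tendsto_integral_of_dominated_convergence (fun z => C * ‖g z‖)
    (fun n => (contDiff_mollify _ hf).continuous.aestronglyMeasurable.inner
      hg.aestronglyMeasurable) (hg.norm.const_mul C)
    (fun n => Eventually.of_forall fun z => (norm_inner_le_norm _ _).trans
      (mul_le_mul_of_nonneg_right (norm_mollify_le _ hfC z) (norm_nonneg _))) ?_
  filter_upwards [hρ] with z hz using hz.inner tendsto_const_nhds

theorem IsWeakDerivOn.fderiv_mollify {v : ℝ × E3} {f g : ℝ × E3 → E3}
    (h : IsWeakDerivOn univ v f g) (ρ : ContDiffBump (0 : ℝ × E3)) (z : ℝ × E3) :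
    fderiv ℝ (mollify ρ f) z v = mollify ρ g z := by
  obtain ⟨hf, -, hweak⟩ := h
  have hρ : ContDiff ℝ ∞ (ρ.normed volume) := ρ.contDiff_normed
  have hρ_cs : HasCompactSupport (ρ.normed volume) := ρ.hasCompactSupport_normed
  have hconv : HasFDerivAt (mollify ρ f) _ z :=
    hρ_cs.hasFDerivAt_convolution_left _ (hρ.of_le (by simp)) (locallyIntegrableOn_univ.1 hf) z
  have hψ_smooth : ContDiff ℝ ∞ fun y => ρ.normed volume (z - y) :=
    hρ.comp (contDiff_const.sub contDiff_id)
  have hψ_deriv : ∀ y, fderiv ℝ (fun y => ρ.normed volume (z - y)) y v =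
      - fderiv ℝ (ρ.normed volume) (z - y) v := fun y => by
    have hcomp : HasFDerivAt (fun y => ρ.normed volume (z - y)) _ y :=
      (hρ.differentiable (by simp) (z - y)).hasFDerivAt.comp y ((hasFDerivAt_id y).const_sub z)
    rw [hcomp.fderiv]
    simp
  have htest := hweak _ hψ_smooth (hρ_cs.comp_homeomorph (Homeomorph.subLeft z)) (subset_univ _)
  simp only [setIntegral_univ, hψ_deriv, neg_smul, integral_neg, neg_inj] at htest
  have hexists := (hρ_cs.fderiv ℝ).convolutionExists_left
    ((ContinuousLinearMap.lsmul ℝ ℝ).precompL (ℝ × E3)) (hρ.continuous_fderiv (by simp))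
    (locallyIntegrableOn_univ.1 hf) z
  rw [hconv.fderiv, convolution_def, ContinuousLinearMap.integral_apply hexists, mollify_apply,
    ← htest, ← integral_sub_left_eq_self _ volume z]
  simp [ContinuousLinearMap.precompL_apply]

theorem IsWeakDerivOn.smul_univ {Ω : Set (ℝ × E3)} {v : ℝ × E3} {f g : ℝ × E3 → E3}
    (h : IsWeakDerivOn Ω v f g) {φ : ℝ × E3 → ℝ} (hφ : ContDiff ℝ ∞ φ)
    (hcs : HasCompactSupport φ) (hsub : tsupport φ ⊆ Ω) :
    IsWeakDerivOn univ v (fun z => φ z • f z) (fun z => fderiv ℝ φ z v • f z + φ z • g z) := by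
  obtain ⟨hf, hg, hweak⟩ := h
  have hdφ_supp : tsupport (fun z => fderiv ℝ φ z v) ⊆ tsupport φ :=
    tsupport_fderiv_apply_subset ℝ v
  have hdφ_cont : ∀ {η : ℝ × E3 → ℝ}, ContDiff ℝ ∞ η → Continuous fun z => fderiv ℝ η z v :=
    fun hη => (hη.continuous_fderiv (by simp)).clm_apply continuous_const
  have hint : ∀ {η ψ : ℝ × E3 → ℝ} {k : ℝ × E3 → E3}, Continuous η → Continuous ψ →
      tsupport ψ ⊆ tsupport φ → LocallyIntegrableOn k Ω →
        Integrable fun z => (η z * ψ z) • k z := fun {η ψ k} hη hψ hψφ hk =>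
    integrable_smul_of_tsupport_subset (hη.mul hψ)
      (HasCompactSupport.mul_left (hcs.of_isClosed_subset (isClosed_tsupport ψ) hψφ))
      ((tsupport_mul_subset_right).trans (hψφ.trans hsub)) hk
  have hloc : ∀ {ψ : ℝ × E3 → ℝ} {k : ℝ × E3 → E3}, Continuous ψ → tsupport ψ ⊆ tsupport φ →
      LocallyIntegrableOn k Ω → Integrable fun z => ψ z • k z := fun {ψ k} hψ hψφ hk => by
    simpa using hint (η := fun _ => 1) continuous_const hψ hψφ hk
  have hdφ_int := hloc (hdφ_cont hφ) hdφ_supp hf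
  refine ⟨locallyIntegrableOn_univ.2 (hloc hφ.continuous subset_rfl hf).locallyIntegrable,
    locallyIntegrableOn_univ.2
      (hdφ_int.add (hloc hφ.continuous subset_rfl hg)).locallyIntegrable, fun η hη _ _ => ?_⟩
  have hηφ_supp : tsupport (fun z => η z * φ z) ⊆ tsupport φ := tsupport_mul_subset_right
  have htest := hweak (fun z => η z * φ z) (hη.mul hφ) hcs.mul_left (hηφ_supp.trans hsub)
  have hleibniz : ∀ z, fderiv ℝ (fun z => η z * φ z) z v =
      η z * fderiv ℝ φ z v + fderiv ℝ η z v * φ z := fun z => by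
    rw [fderiv_fun_mul (hη.differentiable (by simp) z) (hφ.differentiable (by simp) z)]
    simp [mul_comm]
  rw [setIntegral_smul_of_tsupport_subset (φ := fun z => fderiv ℝ (fun z => η z * φ z) z v)
      ((tsupport_fderiv_apply_subset ℝ v).trans (hηφ_supp.trans hsub)),
    setIntegral_smul_of_tsupport_subset (hηφ_supp.trans hsub)] at htest
  simp only [hleibniz, add_smul] at htest
  rw [integral_add (hint hη.continuous (hdφ_cont hφ) hdφ_supp hf)
    (hint (hdφ_cont hη) hφ.continuous subset_rfl hf)] at htest
  simp only [setIntegral_univ, smul_add, smul_smul]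
  rw [integral_add (hint hη.continuous (hdφ_cont hφ) hdφ_supp hf)
    (hint hη.continuous hφ.continuous subset_rfl hg), neg_add, ← htest]
  abel

theorem integral_inner_eq_neg_of_isWeakDerivOn_univ {v : ℝ × E3} {f f' g g' : ℝ × E3 → E3}
    (hf : IsWeakDerivOn univ v f f') (hg : IsWeakDerivOn univ v g g') (hf_cs : HasCompactSupport f)
    (hf_int : Integrable f) (hf'_int : Integrable f') (hg_int : Integrable g)
    (hg'_int : Integrable g') {C : ℝ} (hfC : ∀ᵐ z, ‖f z‖ ≤ C) (hgC : ∀ᵐ z, ‖g z‖ ≤ C) :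
    ∫ z, inner ℝ (f' z) (g z) = - ∫ z, inner ℝ (f z) (g' z) := by
  obtain ⟨ρ, hρ⟩ := exists_seq_mollify_tendsto
  have hmollified : ∀ n, ∫ z, inner ℝ (mollify (ρ n) g z) (f' z) =
      - ∫ z, inner ℝ (mollify (ρ n) f z) (g' z) := fun n => by
    have hcs : HasCompactSupport (mollify (ρ n) f) :=
      (ρ n).hasCompactSupport_normed.convolution _ hf_cs
    have htest := hg.integral_bilinear (innerSL ℝ)
      (contDiff_mollify (ρ n) hf_int.locallyIntegrable) hcs (subset_univ _)
    simp only [setIntegral_univ, innerSL_apply_apply ℝ, hf.fderiv_mollify] at htest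
    rw [← htest, integral_inner_mollify _ hf'_int hg_int]
    simp only [real_inner_comm]
  have hleft := tendsto_integral_inner_mollify hg_int.locallyIntegrable hgC hf'_int
    (hρ g hg_int.locallyIntegrable)
  have hright := tendsto_integral_inner_mollify hf_int.locallyIntegrable hfC hg'_int
    (hρ f hf_int.locallyIntegrable)
  simp only [hmollified] at hleft
  simpa only [real_inner_comm] using tendsto_nhds_unique hleft hright.neg

open scoped Manifold in
theorem exists_contDiff_eq_one_tsupport_subset {E : Type*} [NormedAddCommGroup E]
    [NormedSpace ℝ E] [FiniteDimensional ℝ E] {K U : Set E} (hK : IsCompact K) (hU : IsOpen U)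
    (hKU : K ⊆ U) : ∃ χ : E → ℝ, ContDiff ℝ ∞ χ ∧ HasCompactSupport χ ∧ tsupport χ ⊆ U ∧
      ∀ᶠ x in 𝓝ˢ K, χ x = 1 := by
  obtain ⟨L, hL, hKL, hLU⟩ := exists_compact_between hK hU hKU
  obtain ⟨χ, hχ_one, hχ_zero, -⟩ := exists_contMDiffMap_one_nhds_of_subset_interior 𝓘(ℝ, E)
    (n := ⊤) hK.isClosed hKL
  have hχ_supp : Function.support χ ⊆ L := fun x hx => by_contra fun h => hx (hχ_zero x h)
  exact ⟨χ, χ.contMDiff.contDiff, HasCompactSupport.of_support_subset_isCompact hL hχ_supp,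
    (closure_minimal hχ_supp hL.isClosed).trans hLU, hχ_one⟩

theorem IsWeakDeriv.localized_product_rule {v : ℝ × E3} {f g : ℝ × E3 → E3}
    (h : IsWeakDeriv v f g) (hn : ∀ᵐ z, z ∈ halfSpace → ‖f z‖ = 1) {φ χ : ℝ × E3 → ℝ}
    (hφ : ContDiff ℝ ∞ φ) (hφ_cs : HasCompactSupport φ) (hφ_sub : tsupport φ ⊆ halfSpace)
    (hχ : ContDiff ℝ ∞ χ) (hχ_cs : HasCompactSupport χ) (hχ_sub : tsupport χ ⊆ halfSpace) :
    ∫ z, inner ℝ (fderiv ℝ φ z v • f z + φ z • g z) (χ z • f z) =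
      - ∫ z, inner ℝ (φ z • f z) (fderiv ℝ χ z v • f z + χ z • g z) := by
  obtain ⟨C, hC⟩ := hφ_cs.exists_bound_of_continuous hφ.continuous
  obtain ⟨D, hD⟩ := hχ_cs.exists_bound_of_continuous hχ.continuous
  have hbound : ∀ {ψ : ℝ × E3 → ℝ} {B : ℝ}, tsupport ψ ⊆ halfSpace → (∀ z, ‖ψ z‖ ≤ B) →
      B ≤ max C D → ∀ᵐ z, ‖ψ z • f z‖ ≤ max C D := fun {ψ B} hψ hB hBmax => by
    filter_upwards [hn] with z hz
    refine le_trans ?_ ((hB z).trans hBmax)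
    by_cases hzΩ : z ∈ halfSpace
    · rw [norm_smul, hz hzΩ, mul_one]
    · rw [image_eq_zero_of_notMem_tsupport fun hz' => hzΩ (hψ hz')]
      simp
  have hint : ∀ {ψ : ℝ × E3 → ℝ} {k : ℝ × E3 → E3}, ContDiff ℝ ∞ ψ → HasCompactSupport ψ →
      tsupport ψ ⊆ halfSpace → LocallyIntegrableOn k halfSpace → Integrable fun z => ψ z • k z :=
    fun hψ hψ_cs hψ_sub hk => integrable_smul_of_tsupport_subset hψ.continuous hψ_cs hψ_sub hk
  have hint_deriv : ∀ {ψ : ℝ × E3 → ℝ}, ContDiff ℝ ∞ ψ → HasCompactSupport ψ →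
      tsupport ψ ⊆ halfSpace → Integrable fun z => fderiv ℝ ψ z v • f z + ψ z • g z :=
    fun hψ hψ_cs hψ_sub => (integrable_smul_of_tsupport_subset
      ((hψ.continuous_fderiv (by simp)).clm_apply continuous_const) (hψ_cs.fderiv_apply ℝ v)
      ((tsupport_fderiv_apply_subset ℝ v).trans hψ_sub) h.1).add (hint hψ hψ_cs hψ_sub h.2.1)
  exact integral_inner_eq_neg_of_isWeakDerivOn_univ (h.isWeakDerivOn.smul_univ hφ hφ_cs hφ_sub)
    (h.isWeakDerivOn.smul_univ hχ hχ_cs hχ_sub) hφ_cs.smul_right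
    (hint hφ hφ_cs hφ_sub h.1) (hint_deriv hφ hφ_cs hφ_sub)
    (hint hχ hχ_cs hχ_sub h.1) (hint_deriv hχ hχ_cs hχ_sub)
    (hbound hφ_sub hC (le_max_left C D)) (hbound hχ_sub hD (le_max_right C D))

theorem IsWeakDeriv.locallyIntegrableOn_inner {v : ℝ × E3} {f g : ℝ × E3 → E3}
    (h : IsWeakDeriv v f g) (hn : ∀ᵐ z ∂(volume.restrict halfSpace), ‖f z‖ = 1) :
    LocallyIntegrableOn (fun z => (inner ℝ (f z) (g z) : ℝ)) halfSpace := fun z hz => by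
  obtain ⟨s, hs, hint⟩ := h.2.1 z hz
  refine ⟨s ∩ halfSpace, inter_mem hs self_mem_nhdsWithin, ?_⟩
  refine (hint.mono_set inter_subset_left).norm.mono'
    ((h.1.aestronglyMeasurable.inner h.2.1.aestronglyMeasurable).mono_measure
      (Measure.restrict_mono inter_subset_right le_rfl)) ?_
  filter_upwards [ae_restrict_of_ae_restrict_of_subset inter_subset_right hn] with y hy
  simpa [hy] using norm_inner_le_norm (𝕜 := ℝ) (f y) (g y)

theorem integral_fderiv_apply_eq_zero {φ : ℝ × E3 → ℝ} (hφ : ContDiff ℝ ∞ φ)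
    (hφ_cs : HasCompactSupport φ) (v : ℝ × E3) : ∫ z, fderiv ℝ φ z v = 0 := by
  have hdφ_int : Integrable fun z => fderiv ℝ φ z v :=
    ((hφ.continuous_fderiv (by simp)).clm_apply
      continuous_const).integrable_of_hasCompactSupport (hφ_cs.fderiv_apply ℝ v)
  simpa using integral_mul_fderiv_eq_neg_fderiv_mul_of_integrable (μ := volume) (𝕜 := ℝ)
    (f := fun _ : ℝ × E3 => (1 : ℝ)) (g := φ) (v := v) (by simp) (by simpa using hdφ_int)
    (by simpa using hφ.continuous.integrable_of_hasCompactSupport hφ_cs) (by fun_prop)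
    fun z _ => hφ.differentiable (by simp) z

theorem IsWeakDeriv.inner_eq_zero {v : ℝ × E3} {f g : ℝ × E3 → E3} (h : IsWeakDeriv v f g)
    (hn : ∀ᵐ z ∂(volume.restrict halfSpace), ‖f z‖ = 1) :
    ∀ᵐ z ∂(volume.restrict halfSpace), (inner ℝ (f z) (g z) : ℝ) = 0 := by
  have hn' : ∀ᵐ z, z ∈ halfSpace → ‖f z‖ = 1 := (ae_restrict_iff' measurableSet_halfSpace).1 hn
  have hloc := h.locallyIntegrableOn_inner hn
  rw [ae_restrict_iff' measurableSet_halfSpace]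
  refine isOpen_halfSpace.ae_eq_zero_of_integral_contDiff_smul_eq_zero hloc
    fun φ hφ hcs hsub => ?_
  -- For `χ = 1` near the support of `φ`, the product rule reads `2 ∫ φ (f · g) = -∫ ∂ᵥφ = 0`.
  obtain ⟨χ, hχ, hχ_cs, hχ_sub, hχ_one⟩ :=
    exists_contDiff_eq_one_tsupport_subset hcs isOpen_halfSpace hsub
  have hproduct := h.localized_product_rule hn' hφ hcs hsub hχ hχ_cs hχ_sub
  have hleft : ∀ᵐ z, inner ℝ (fderiv ℝ φ z v • f z + φ z • g z) (χ z • f z) =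
      fderiv ℝ φ z v + φ z • (inner ℝ (f z) (g z) : ℝ) := by
    filter_upwards [hn'] with z hz
    by_cases hzφ : z ∈ tsupport φ
    · rw [(hχ_one.self_of_nhdsSet z hzφ), one_smul, inner_add_left, real_inner_smul_left,
        real_inner_smul_left, real_inner_self_eq_norm_sq, hz (hsub hzφ), real_inner_comm]
      simp
    · rw [image_eq_zero_of_notMem_tsupport hzφ, image_eq_zero_of_notMem_tsupport
        (f := fun z => fderiv ℝ φ z v) fun hz' => hzφ (tsupport_fderiv_apply_subset ℝ v hz')]
      simp
  have hright : ∀ z, inner ℝ (φ z • f z) (fderiv ℝ χ z v • f z + χ z • g z) =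
      φ z • (inner ℝ (f z) (g z) : ℝ) := fun z => by
    by_cases hzφ : z ∈ tsupport φ
    · have hχz : χ =ᶠ[𝓝 z] fun _ => 1 := hχ_one.filter_mono (nhds_le_nhdsSet hzφ)
      rw [hχz.fderiv_eq, hχz.self_of_nhds, real_inner_smul_left]
      simp
    · simp [image_eq_zero_of_notMem_tsupport hzφ]
  have hdφ_int : Integrable fun z => fderiv ℝ φ z v :=
    ((hφ.continuous_fderiv (by simp)).clm_apply
      continuous_const).integrable_of_hasCompactSupport (hcs.fderiv_apply ℝ v)
  have hφ_int : Integrable fun z => φ z • (inner ℝ (f z) (g z) : ℝ) :=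
    integrable_smul_of_tsupport_subset hφ.continuous hcs hsub hloc
  rw [integral_congr_ae hleft, integral_congr_ae (Eventually.of_forall hright),
    integral_add hdφ_int hφ_int, integral_fderiv_apply_eq_zero hφ hcs, zero_add] at hproduct
  linarith

/-! ### Time slices and initial traces -/

theorem integral_Ioi_deriv_mul_primitive {α B : ℝ → ℝ} (hα : ContDiff ℝ ∞ α)
    (hαc : HasCompactSupport α) (hB : ∀ S, IntegrableOn B (Ioo 0 S)) (c : ℝ) :
    ∫ t in Ioi (0 : ℝ), (deriv α t * (c + ∫ s in (0 : ℝ)..t, B s) + α t * B t) = - (α 0 * c) := by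
  obtain ⟨S, hS⟩ := (hαc.isBounded.union (Bornology.isBounded_singleton (x := (0 : ℝ)))).bddAbove
  have hS0 : 0 ≤ S := hS (Or.inr rfl)
  have hvanish : ∀ t, S < t → t ∉ tsupport α := fun t ht h => ht.not_ge (hS (Or.inl h))
  have hB' : IntervalIntegrable B volume 0 (S + 1) :=
    (intervalIntegrable_iff_integrableOn_Ioo_of_le (by linarith)).2 (hB (S + 1))
  have hparts := (hα.contDiffOn.of_le (by simp)).absolutelyContinuousOnInterval
    |>.integral_deriv_mul_eq_sub (contDiffOn_const (c := c).absolutelyContinuousOnInterval.fun_add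
      (hB'.absolutelyContinuousOnInterval_intervalIntegral left_mem_uIcc))
  rw [image_eq_zero_of_notMem_tsupport (hvanish (S + 1) (lt_add_one S)),
    intervalIntegral.integral_same, add_zero, zero_mul, zero_sub] at hparts
  rw [← hparts, intervalIntegral.integral_of_le (by linarith)]
  refine (setIntegral_eq_of_subset_of_forall_sdiff_eq_zero measurableSet_Ioi Ioc_subset_Ioi_self
    fun t ht => ?_).trans (setIntegral_congr_ae measurableSet_Ioc ?_)
  · have htS : t ∉ tsupport α := hvanish t (by
      by_contra! hle
      exact ht.2 ⟨ht.1, hle.trans (by linarith)⟩)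
    rw [image_eq_zero_of_notMem_tsupport htS,
      image_eq_zero_of_notMem_tsupport fun h => htS (tsupport_deriv_subset h)]
    simp
  · filter_upwards [hB'.ae_hasDerivAt_integral] with t hderiv ht
    have ht' : t ∈ uIcc 0 (S + 1) := uIoc_subset_uIcc (by rwa [uIoc_of_le (by linarith)])
    rw [((hderiv ht' 0 left_mem_uIcc).const_add c).deriv]

theorem exists_contDiff_deriv_eq {β : ℝ → ℝ} {a : ℝ} (hβ : ContDiff ℝ ∞ β)
    (hβc : HasCompactSupport β) (hβs : tsupport β ⊆ Ioi a) (hβ_int : ∫ t, β t = 0) :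
    ∃ α : ℝ → ℝ, ContDiff ℝ ∞ α ∧ HasCompactSupport α ∧ tsupport α ⊆ Ioi a ∧ deriv α = β := by
  set α : ℝ → ℝ := fun t => ∫ s in Iic t, β s
  have hβi : Integrable β := hβ.continuous.integrable_of_hasCompactSupport hβc
  have hderiv : ∀ t, HasDerivAt α (β t) t := fun t => by
    have hα_eq : α = fun t => (∫ s in Iic 0, β s) + ∫ s in (0 : ℝ)..t, β s := funext fun t => by
      rw [← intervalIntegral.integral_Iic_sub_Iic hβi.integrableOn hβi.integrableOn]
      ring
    rw [hα_eq]
    exact (hβ.continuous.integral_hasStrictDerivAt 0 t).hasDerivAt.const_add _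
  have hderiv_eq : deriv α = β := funext fun t => (hderiv t).deriv
  obtain ⟨b, c, hab, hbc⟩ : ∃ b c, a < b ∧ tsupport β ⊆ Icc b c := by
    rcases (tsupport β).eq_empty_or_nonempty with hempty | hne
    · exact ⟨a + 1, a + 1, lt_add_one a, by simp [hempty]⟩
    · obtain ⟨b, hb⟩ := hβc.isCompact.exists_isLeast hne
      obtain ⟨c, hc⟩ := hβc.isCompact.exists_isGreatest hne
      exact ⟨b, c, hβs hb.1, fun s hs => ⟨hb.2 hs, hc.2 hs⟩⟩
  have hsupp : Function.support α ⊆ Icc b c := fun t ht => by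
    refine ⟨le_of_not_gt fun htb => ht ?_, le_of_not_gt fun hct => ht ?_⟩
    · exact setIntegral_eq_zero_of_forall_eq_zero fun s hs =>
        image_eq_zero_of_notMem_tsupport fun hsβ => ((hbc hsβ).1.trans hs).not_gt htb
    · rw [← hβ_int]
      exact setIntegral_eq_integral_of_forall_compl_eq_zero fun s hs =>
        image_eq_zero_of_notMem_tsupport fun hsβ => hs ((hbc hsβ).2.trans hct.le)
  exact ⟨α, contDiff_infty_iff_deriv.2 ⟨fun t => (hderiv t).differentiableAt, hderiv_eq ▸ hβ⟩,
    HasCompactSupport.of_support_subset_isCompact isCompact_Icc hsupp,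
    (closure_minimal hsupp isClosed_Icc).trans fun t ht => hab.trans_le ht.1, hderiv_eq⟩

theorem integrableOn_Ioi_mul {f ψ : ℝ → ℝ} (hf : ∀ S, IntegrableOn f (Ioo 0 S))
    (hψ : Continuous ψ) (hψc : HasCompactSupport ψ) :
    IntegrableOn (fun t => ψ t * f t) (Ioi 0) := by
  obtain ⟨S, hS⟩ := hψc.isBounded.bddAbove
  obtain ⟨C, hC⟩ := hψc.exists_bound_of_continuous hψ
  have hIoo : IntegrableOn (fun t => ψ t * f t) (Ioo 0 (S + 1)) :=
    Integrable.bdd_mul (hf _) hψ.aestronglyMeasurable (Eventually.of_forall hC)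
  refine hIoo.of_forall_sdiff_eq_zero measurableSet_Ioi fun t ht => ?_
  rw [image_eq_zero_of_notMem_tsupport fun h => ht.2 ⟨ht.1, (hS h).trans_lt (lt_add_one S)⟩,
    zero_mul]

theorem exists_ae_eq_const {D : ℝ → ℝ} (hD : ∀ S, IntegrableOn D (Ioo 0 S))
    (h : ∀ α : ℝ → ℝ, ContDiff ℝ ∞ α → HasCompactSupport α → tsupport α ⊆ Ioi 0 →
      ∫ t in Ioi (0 : ℝ), deriv α t * D t = 0) :
    ∃ c, ∀ᵐ t ∂(volume.restrict (Ioi (0 : ℝ))), D t = c := by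
  let ρ : ContDiffBump (2 : ℝ) := ⟨1 / 2, 1, by norm_num, by norm_num⟩
  set η : ℝ → ℝ := ρ.normed volume with hη_def
  have hη : ContDiff ℝ ∞ η := ρ.contDiff_normed
  have hηc : HasCompactSupport η := ρ.hasCompactSupport_normed
  have hηs : tsupport η ⊆ Ioi 0 := by
    rw [hη_def, ρ.tsupport_normed_eq, Real.closedBall_eq_Icc]
    exact fun t ht => lt_of_lt_of_le (by norm_num [ρ]) ht.1
  have hη_one : ∫ t, η t = 1 := ρ.integral_normed
  refine ⟨∫ t in Ioi 0, η t * D t, ?_⟩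
  set c := ∫ t in Ioi 0, η t * D t
  have hDc : ∀ S, IntegrableOn (fun t => D t - c) (Ioo 0 S) := fun S =>
    (hD S).sub (integrableOn_const (by simp))
  suffices hzero : ∀ᵐ t ∂(volume.restrict (Ioi (0 : ℝ))), D t - c = 0 from
    hzero.mono fun t ht => sub_eq_zero.1 ht
  refine ae_Ioi_eq_zero_of_integral_mul hDc fun ψ hψ hψc hψs => ?_
  have hψi : Integrable ψ := hψ.continuous.integrable_of_hasCompactSupport hψc
  have hηi : Integrable η := hη.continuous.integrable_of_hasCompactSupport hηc
  have hψ_Ioi : ∫ t in Ioi 0, ψ t = ∫ t, ψ t := setIntegral_eq_integral_of_forall_compl_eq_zero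
    fun t ht => image_eq_zero_of_notMem_tsupport fun h => ht (hψs h)
  obtain ⟨α, hα, hαc, hαs, hα_deriv⟩ := exists_contDiff_deriv_eq (a := 0)
    (β := fun t => ψ t - (∫ s, ψ s) * η t) (hψ.sub (contDiff_const.mul hη))
    (hψc.sub hηc.mul_left)
    ((tsupport_sub _ _).trans (union_subset hψs (tsupport_mul_subset_right.trans hηs)))
    (by rw [integral_sub hψi (hηi.const_mul _), integral_const_mul, hη_one, mul_one, sub_self])
  have htest := h α hα hαc hαs
  simp only [hα_deriv, sub_mul, mul_assoc] at htest
  rw [integral_sub (integrableOn_Ioi_mul hD hψ.continuous hψc)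
    ((integrableOn_Ioi_mul hD hη.continuous hηc).const_mul _), integral_const_mul] at htest
  simp only [mul_sub]
  rw [integral_sub (integrableOn_Ioi_mul hD hψ.continuous hψc) (hψi.integrableOn.mul_const c),
    integral_mul_const, hψ_Ioi, htest]

theorem continuousOn_primitive_Ici {B : ℝ → ℝ} (hB : ∀ S, IntegrableOn B (Ioo 0 S)) :
    ContinuousOn (fun t => ∫ s in (0 : ℝ)..t, B s) (Ici 0) := by
  intro t ht
  have hBt : IntervalIntegrable B volume 0 (t + 1) :=
    (intervalIntegrable_iff_integrableOn_Ioo_of_le (add_nonneg ht zero_le_one)).2 (hB (t + 1))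
  have hcont := intervalIntegral.continuousOn_primitive_interval' hBt left_mem_uIcc
  rw [uIcc_of_le (add_nonneg ht zero_le_one)] at hcont
  refine (hcont t ⟨ht, (lt_add_one t).le⟩).mono_of_mem_nhdsWithin ?_
  filter_upwards [self_mem_nhdsWithin, mem_nhdsWithin_of_mem_nhds (Iio_mem_nhds (lt_add_one t))]
    with s hs hst using ⟨hs, hst.le⟩

theorem integrableOn_primitive {B : ℝ → ℝ} (hB : ∀ S, IntegrableOn B (Ioo 0 S)) (S : ℝ) :
    IntegrableOn (fun t => ∫ s in (0 : ℝ)..t, B s) (Ioo 0 S) :=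
  ((continuousOn_primitive_Ici hB).mono Icc_subset_Ici_self).integrableOn_Icc.mono_set
    Ioo_subset_Icc_self

theorem exists_ae_eq_const_add_primitive {A B : ℝ → ℝ} (hA : ∀ S, IntegrableOn A (Ioo 0 S))
    (hB : ∀ S, IntegrableOn B (Ioo 0 S))
    (h : ∀ α : ℝ → ℝ, ContDiff ℝ ∞ α → HasCompactSupport α → tsupport α ⊆ Ioi 0 →
      ∫ t in Ioi (0 : ℝ), (deriv α t * A t + α t * B t) = 0) :
    ∃ c, ∀ᵐ t ∂(volume.restrict (Ioi (0 : ℝ))), A t = c + ∫ s in (0 : ℝ)..t, B s := by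
  have hP := integrableOn_primitive hB
  suffices hconst : ∃ c, ∀ᵐ t ∂(volume.restrict (Ioi (0 : ℝ))),
      A t - ∫ s in (0 : ℝ)..t, B s = c by
    obtain ⟨c, hc⟩ := hconst
    exact ⟨c, hc.mono fun t ht => sub_eq_iff_eq_add.1 ht⟩
  refine exists_ae_eq_const (fun S => (hA S).sub (hP S)) fun α hα hαc hαs => ?_
  have hα' : Continuous (deriv α) := hα.continuous_deriv (by simp)
  have hAα := integrableOn_Ioi_mul hA hα' hαc.deriv
  have hPα := integrableOn_Ioi_mul hP hα' hαc.deriv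
  have hBα := integrableOn_Ioi_mul hB hα.continuous hαc
  have hprimitive := integral_Ioi_deriv_mul_primitive hα hαc hB 0
  have htest := h α hα hαc hαs
  simp only [zero_add, mul_zero, neg_zero] at hprimitive
  rw [integral_add hPα hBα] at hprimitive
  rw [integral_add hAα hBα] at htest
  simp only [mul_sub]
  rw [integral_sub hAα hPα]
  linarith

theorem frequently_nhdsGT_of_ae {p : ℝ → Prop} {a : ℝ}
    (h : ∀ᵐ t ∂(volume.restrict (Ioi a)), p t) : ∃ᶠ t in 𝓝[>] a, p t := fun hnot => by
  obtain ⟨b, hab, hb⟩ := mem_nhdsGT_iff_exists_Ioo_subset.1 hnot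
  have hnull : volume (Ioo a b) = 0 := by
    rw [ae_restrict_iff' measurableSet_Ioi] at h
    exact measure_mono_null (fun t ht => fun hpt => hb ht (hpt ht.1)) (ae_iff.1 h)
  rw [Real.volume_Ioo, ENNReal.ofReal_eq_zero, sub_nonpos] at hnull
  exact hnull.not_gt hab

/-- The time derivative of `G · V`, when `Vt` is the weak time derivative of `V`. -/
def pairingRate (G V Vt : ℝ × E3 → E3) (z : ℝ × E3) : ℝ :=
  inner ℝ (∂ₜ G z) (V z) + inner ℝ (G z) (Vt z)

/-- `V` evolves from `m₀` with velocity `Vt` and weak space derivatives `Vx i`. The initial value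
problem `∂ₜV = Vt`, `V(0) = m₀` is expressed on almost every time slice, by pairing with maps that
are smooth up to time `0`. -/
structure IsEvolution (m₀ : E3 → E3) (V Vt : ℝ × E3 → E3) (Vx : Fin 3 → ℝ × E3 → E3) : Prop where
  cylinderIntegrable : CylinderIntegrable V
  cylinderIntegrable_dt : CylinderIntegrable Vt
  cylinderIntegrable_dx : ∀ i, CylinderIntegrable (Vx i)
  weak_dx : ∀ i, IsWeakDeriv (spaceDir i) V (Vx i)
  integral_slice : ∀ G : ℝ × E3 → E3, ContDiffOn ℝ ∞ G closedHalfSpace →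
    HasBoundedSpatialSupport G → ∀ᵐ t ∂(volume.restrict (Ioi (0 : ℝ))),
      ∫ x, inner ℝ (G (t, x)) (V (t, x)) =
        (∫ x, inner ℝ (G (0, x)) (m₀ x)) + ∫ z in slab t, pairingRate G V Vt z

theorem integral_slab_eq_intervalIntegral {S : ℝ} (hS : 0 ≤ S) {f : ℝ × E3 → F}
    (hf : IntegrableOn f (slab S)) :
    ∫ z in slab S, f z = ∫ t in (0 : ℝ)..S, ∫ x, f (t, x) := by
  rw [integral_slab hf, intervalIntegral.integral_of_le hS, integral_Ioc_eq_integral_Ioo]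

theorem HasBoundedSpatialSupport.hasCompactSupport_slice {F : Type*} [NormedAddCommGroup F]
    {G : ℝ × E3 → F} (hG : HasBoundedSpatialSupport G) {t : ℝ} (ht : 0 ≤ t) :
    HasCompactSupport fun x => G (t, x) := by
  obtain ⟨R, hR⟩ := hG
  exact HasCompactSupport.intro (isCompact_closedBall 0 R) fun x hx =>
    hR (t, x) (mem_closedHalfSpace.2 ht) (by simpa using hx)

theorem hasBoundedSpatialSupport_of_hasCompactSupport {F : Type*} [NormedAddCommGroup F]
    {G : ℝ × E3 → F} (hG : HasCompactSupport G) : HasBoundedSpatialSupport G := by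
  obtain ⟨R, hR⟩ := hG.isBounded.subset_closedBall 0
  exact ⟨R, fun z _ hz => image_eq_zero_of_notMem_tsupport fun h =>
    hz.not_ge ((norm_snd_le z).trans (by simpa using hR h))⟩

theorem hasBoundedSpatialSupport_spatial {F : Type*} [NormedAddCommGroup F] {g : E3 → F}
    (hg : HasCompactSupport g) : HasBoundedSpatialSupport fun z => g z.2 := by
  obtain ⟨R, hR⟩ := hg.isBounded.subset_closedBall 0
  exact ⟨R, fun z _ hz => image_eq_zero_of_notMem_tsupport fun h =>
    hz.not_ge (by simpa using hR h)⟩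

theorem HasBoundedSpatialSupport.inner {G : ℝ × E3 → E3} (hG : HasBoundedSpatialSupport G)
    (f : ℝ × E3 → E3) : HasBoundedSpatialSupport fun z => (inner ℝ (G z) (f z) : ℝ) := by
  obtain ⟨R, hR⟩ := hG
  exact ⟨R, fun z hz hzR => by simp [hR z hz hzR]⟩

theorem integrable_slice {G : ℝ × E3 → F} (hG : ContDiffOn ℝ ∞ G closedHalfSpace)
    (hG_supp : HasBoundedSpatialSupport G) {t : ℝ} (ht : 0 ≤ t) : Integrable fun x => G (t, x) :=
  (contDiff_space hG ht).continuous.integrable_of_hasCompactSupport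
    (hG_supp.hasCompactSupport_slice ht)

section Pairing

variable {G V Vt : ℝ × E3 → E3}

theorem integrableOn_pairingRate (hV : CylinderIntegrable V) (hVt : CylinderIntegrable Vt)
    (hG : ContDiffOn ℝ ∞ G closedHalfSpace) (hG_supp : HasBoundedSpatialSupport G) (S : ℝ) :
    IntegrableOn (pairingRate G V Vt) (slab S) :=
  (hV.integrableOn_inner (hG_supp.dirDeriv _) (contDiffOn_dirDeriv hG _).continuousOn S).add
    (hVt.integrableOn_inner hG_supp hG.continuousOn S)

theorem integral_Ioi_deriv_mul_pairing (hV : CylinderIntegrable V) (hVt : CylinderIntegrable Vt)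
    (hG : ContDiffOn ℝ ∞ G closedHalfSpace) (hG_supp : HasBoundedSpatialSupport G) {α : ℝ → ℝ}
    (hα : ContDiff ℝ ∞ α) (hαc : HasCompactSupport α) :
    ∫ t in Ioi (0 : ℝ), (deriv α t * (∫ x, inner ℝ (G (t, x)) (V (t, x))) +
        α t * ∫ x, pairingRate G V Vt (t, x)) =
      (∫ z in halfSpace, inner ℝ (α z.1 • ∂ₜ G z + deriv α z.1 • G z) (V z)) +
        ∫ z in halfSpace, inner ℝ (α z.1 • G z) (Vt z) := by
  have hα' : Continuous (deriv α) := hα.continuous_deriv (by simp)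
  have hpair_int := hV.integrableOn_inner hG_supp hG.continuousOn
  have hdt_int := hV.integrableOn_inner (hG_supp.dirDeriv timeDir)
    (contDiffOn_dirDeriv hG timeDir).continuousOn
  have hvel_int := hVt.integrableOn_inner hG_supp hG.continuousOn
  have hrate_int := integrableOn_pairingRate hV hVt hG hG_supp
  rw [integral_add (integrableOn_Ioi_mul (fun S => integrableOn_integral_slab (hpair_int S)) hα'
      hαc.deriv) (integrableOn_Ioi_mul (fun S => integrableOn_integral_slab (hrate_int S))
      hα.continuous hαc), ← integral_halfSpace_time_mul hpair_int hα' hαc.deriv,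
    ← integral_halfSpace_time_mul hrate_int hα.continuous hαc]
  simp only [pairingRate, mul_add, inner_add_left, real_inner_smul_left]
  rw [integral_add, integral_add]
  · ring
  all_goals first
    | exact integrableOn_halfSpace_time_mul hpair_int hα' hαc.deriv
    | exact integrableOn_halfSpace_time_mul hdt_int hα.continuous hαc
    | exact integrableOn_halfSpace_time_mul hvel_int hα.continuous hαc

theorem IsWeakDeriv.exists_integral_slice_eq (h : IsWeakDeriv timeDir V Vt)
    (hV : CylinderIntegrable V) (hVt : CylinderIntegrable Vt)
    (hG : ContDiffOn ℝ ∞ G closedHalfSpace) (hG_supp : HasBoundedSpatialSupport G) :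
    ∃ c, ∀ᵐ t ∂(volume.restrict (Ioi (0 : ℝ))),
      ∫ x, inner ℝ (G (t, x)) (V (t, x)) =
        c + ∫ s in (0 : ℝ)..t, ∫ x, pairingRate G V Vt (s, x) := by
  refine exists_ae_eq_const_add_primitive
    (fun S => integrableOn_integral_slab (hV.integrableOn_inner hG_supp hG.continuousOn S))
    (fun S => integrableOn_integral_slab (integrableOn_pairingRate hV hVt hG hG_supp S))
    fun α hα hαc hαs => ?_
  have htest := h.integral_time_smul hG hG_supp hα hαc hαs
  simp only [timeDir, one_mul] at htest
  rw [integral_Ioi_deriv_mul_pairing hV hVt hG hG_supp hα hαc]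
  simp only [timeDir, real_inner_smul_left] at htest ⊢
  exact add_eq_zero_iff_eq_neg.2 htest

end Pairing

theorem CylinderIntegrable.integrableOn_smul {f : ℝ × E3 → F} (hf : CylinderIntegrable f)
    {φ : ℝ × E3 → ℝ} (hφ : Continuous φ) (hφc : HasCompactSupport φ) :
    IntegrableOn (fun z => φ z • f z) halfSpace := by
  obtain ⟨R, hR⟩ := hφc.isBounded.subset_closedBall 0
  obtain ⟨C, hC⟩ := hφc.exists_bound_of_continuous hφ
  have hcyl : IntegrableOn (fun z => φ z • f z) (cylinder (R + 1) R) :=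
    Integrable.bdd_smul (hf _ _) C hφ.aestronglyMeasurable (Eventually.of_forall hC)
  refine hcyl.of_forall_sdiff_eq_zero measurableSet_halfSpace fun z hz => ?_
  suffices hzφ : z ∉ tsupport φ by rw [image_eq_zero_of_notMem_tsupport hzφ, zero_smul]
  refine fun hzφ => hz.2 ?_
  have hzR : ‖z‖ ≤ R := by simpa using hR hzφ
  exact mem_cylinder.2 ⟨⟨⟨hz.1.1, ((Real.le_norm_self _).trans (norm_fst_le z)).trans_lt
    (hzR.trans_lt (lt_add_one R))⟩, mem_univ _⟩, (norm_snd_le z).trans hzR⟩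

theorem tendsto_primitive {B : ℝ → ℝ} (hB : ∀ S, IntegrableOn B (Ioo 0 S)) :
    Tendsto (fun t => ∫ s in (0 : ℝ)..t, B s) (𝓝[>] 0) (𝓝 0) := by
  have hcont := (continuousOn_primitive_Ici hB 0 self_mem_Ici).mono Ioi_subset_Ici_self
  rwa [ContinuousWithinAt, intervalIntegral.integral_same] at hcont

theorem tendsto_integral_norm_sub_initial {F : Type*} [NormedAddCommGroup F]
    {G : ℝ × E3 → F} (hG : ContinuousOn G closedHalfSpace)
    (hG_supp : HasBoundedSpatialSupport G) :
    Tendsto (fun t => ∫ x, ‖G (t, x) - G (0, x)‖) (𝓝[>] 0) (𝓝 0) := by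
  obtain ⟨R, hR⟩ := hG_supp
  have hG₀ : ContinuousOn (fun z : ℝ × E3 => G (0, z.2)) closedHalfSpace :=
    hG.comp (by fun_prop) fun z _ => mem_closedHalfSpace.2 le_rfl
  have hcont : ContinuousOn (fun t => ∫ x, ‖G (t, x) - G (0, x)‖) (Ici 0) := by
    refine continuousOn_integral_of_compact_support (isCompact_closedBall (0 : E3) R)
      (hG.sub hG₀).norm fun t x ht hx => ?_
    have hxR : R < ‖x‖ := by simpa using hx
    rw [hR (t, x) (mem_closedHalfSpace.2 ht) hxR, hR (0, x) (mem_closedHalfSpace.2 le_rfl) hxR]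
    simp
  have hcont₀ := (hcont 0 self_mem_Ici).mono Ioi_subset_Ici_self
  simpa [ContinuousWithinAt] using hcont₀

section InitialTrace

variable {m₀ : E3 → E3} {m mt : ℝ × E3 → E3}

theorem HasInitialTrace.integral_inner (h : HasInitialTrace m mt m₀) (hm₀ : Continuous m₀)
    (hm : CylinderIntegrable m) (hmt : CylinderIntegrable mt) {Φ : ℝ × E3 → E3}
    (hΦ : ContDiff ℝ ∞ Φ) (hΦc : HasCompactSupport Φ) :
    ∫ z in halfSpace, inner ℝ (fderiv ℝ Φ z timeDir) (m z) =
      - (∫ z in halfSpace, inner ℝ (Φ z) (mt z)) - ∫ x, inner ℝ (Φ (0, x)) (m₀ x) := by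
  have hΦ_smooth : ∀ j, ContDiff ℝ ∞ (fun z => Φ z j) := fun j => contDiff_euclidean.1 hΦ j
  have hΦ_cs : ∀ j, HasCompactSupport (fun z => Φ z j) := fun j =>
    hΦc.mono' ((subset_tsupport _).trans (tsupport_apply_subset Φ j))
  have hcoord : ∀ j z, fderiv ℝ Φ z timeDir j = fderiv ℝ (fun z => Φ z j) z timeDir := fun j z =>
    (fderiv_apply_apply (hΦ.differentiable (by simp) z) timeDir j).symm
  have hinit : ∀ j, HasCompactSupport fun x => Φ (0, x) j := fun j =>
    (hasBoundedSpatialSupport_of_hasCompactSupport (hΦ_cs j)).hasCompactSupport_slice le_rfl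
  simp only [← innerSL_apply_apply ℝ]
  rw [integral_bilinear_eq_sum (innerSL ℝ) fun j => ?_,
    integral_bilinear_eq_sum (innerSL ℝ) fun j => ?_,
    integral_bilinear_eq_sum (innerSL ℝ) fun j => ?_, ← Finset.sum_neg_distrib,
    ← Finset.sum_sub_distrib]
  · simp only [hcoord, h _ (hΦ_smooth _) (hΦ_cs _), map_neg, map_sub]
  · refine Continuous.integrable_of_hasCompactSupport ?_ (hinit j).smul_right
    exact ((hΦ_smooth j).continuous.comp (by fun_prop)).smul hm₀
  · exact hmt.integrableOn_smul (hΦ_smooth j).continuous (hΦ_cs j)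
  · simp only [hcoord]
    exact hm.integrableOn_smul (((hΦ_smooth j).continuous_fderiv (by simp)).clm_apply
      continuous_const) ((hΦ_cs j).fderiv_apply ℝ timeDir)

theorem HasInitialTrace.integral_slice_spatial (h : HasInitialTrace m mt m₀)
    (hw : IsWeakDeriv timeDir m mt) (hm₀ : Continuous m₀) (hm : CylinderIntegrable m)
    (hmt : CylinderIntegrable mt) {g : E3 → E3} (hg : ContDiff ℝ ∞ g)
    (hgc : HasCompactSupport g) :
    ∀ᵐ t ∂(volume.restrict (Ioi (0 : ℝ))),
      ∫ x, inner ℝ (g x) (m (t, x)) = (∫ x, inner ℝ (g x) (m₀ x)) +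
        ∫ s in (0 : ℝ)..t, ∫ x, pairingRate (fun z => g z.2) m mt (s, x) := by
  have hG := contDiffOn_spatial hg
  have hG_supp := hasBoundedSpatialSupport_spatial hgc
  obtain ⟨c, hc⟩ := hw.exists_integral_slice_eq hm hmt hG hG_supp
  suffices hc_eq : c = ∫ x, inner ℝ (g x) (m₀ x) by rwa [← hc_eq]
  let ρ : ContDiffBump (0 : ℝ) := ⟨1, 2, one_pos, one_lt_two⟩
  have hρ : ContDiff ℝ ∞ ρ := ρ.contDiff
  have hρ0 : ρ 0 = 1 := ρ.one_of_mem_closedBall (Metric.mem_closedBall_self zero_le_one)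
  set Φ : ℝ × E3 → E3 := fun z => ρ z.1 • g z.2
  have hΦ : ContDiff ℝ ∞ Φ := (hρ.comp contDiff_fst).smul (hg.comp contDiff_snd)
  have hΦc : HasCompactSupport Φ :=
    HasCompactSupport.of_support_subset_isCompact (ρ.hasCompactSupport.isCompact.prod hgc.isCompact)
      fun z hz => ⟨subset_tsupport _ (left_ne_zero_of_smul hz),
        subset_tsupport _ (right_ne_zero_of_smul hz)⟩
  have hΦ_dt : ∀ z ∈ halfSpace, fderiv ℝ Φ z timeDir =
      ρ z.1 • ∂ₜ (fun z => g z.2) z + deriv ρ z.1 • g z.2 := fun z hz => by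
    have hderiv := fderiv_time_smul hG hρ timeDir hz
    rwa [timeDir, one_mul] at hderiv
  have htrace := h.integral_inner hm₀ hm hmt hΦ hΦc
  rw [setIntegral_congr_fun measurableSet_halfSpace fun z hz => by rw [hΦ_dt z hz]] at htrace
  have hpair := integral_Ioi_deriv_mul_pairing hm hmt hG hG_supp hρ ρ.hasCompactSupport
  rw [integral_congr_ae (g := fun t => deriv ρ t * (c + ∫ s in (0 : ℝ)..t, ∫ x,
        pairingRate (fun z => g z.2) m mt (s, x)) +
          ρ t * ∫ x, pairingRate (fun z => g z.2) m mt (t, x))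
      (by filter_upwards [hc] with t ht using by rw [ht]),
    integral_Ioi_deriv_mul_primitive hρ ρ.hasCompactSupport (fun S => integrableOn_integral_slab
      (integrableOn_pairingRate hm hmt hG hG_supp S)), htrace] at hpair
  simp only [Φ, hρ0, one_mul, one_smul] at hpair
  linarith

theorem ae_abs_integral_inner_sub_initial_le (hm : CylinderIntegrable m)
    (hnorm : ∀ᵐ z ∂(volume.restrict halfSpace), ‖m z‖ = 1) {G : ℝ × E3 → E3}
    (hG : ContDiffOn ℝ ∞ G closedHalfSpace) (hG_supp : HasBoundedSpatialSupport G) :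
    ∀ᵐ t ∂(volume.restrict (Ioi (0 : ℝ))),
      |(∫ x, inner ℝ (G (t, x)) (m (t, x))) - ∫ x, inner ℝ (G (0, x)) (m (t, x))| ≤
        ∫ x, ‖G (t, x) - G (0, x)‖ := by
  have hnorm_slice : ∀ᵐ t ∂(volume.restrict (Ioi (0 : ℝ))), ∀ᵐ x, ‖m (t, x)‖ = 1 := by
    rw [restrict_halfSpace] at hnorm
    exact Measure.ae_ae_of_ae_prod hnorm
  refine ae_restrict_Ioi_of_forall_Ioo fun S => ?_
  filter_upwards [ae_integrable_slice (hm.integrableOn_inner hG_supp hG.continuousOn S),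
    ae_integrable_slice (hm.integrableOn_inner (hasBoundedSpatialSupport_spatial
      (hG_supp.hasCompactSupport_slice le_rfl))
      (contDiffOn_spatial (contDiff_space hG le_rfl)).continuousOn S),
    ae_restrict_of_ae_restrict_of_subset Ioo_subset_Ioi_self hnorm_slice,
    ae_restrict_mem measurableSet_Ioo] with t ht ht₀ hnorm_t hpos
  rw [← integral_sub ht ht₀, ← Real.norm_eq_abs]
  refine norm_integral_le_of_norm_le ((integrable_slice hG hG_supp hpos.1.le).sub
    (integrable_slice hG hG_supp le_rfl)).norm ?_
  filter_upwards [hnorm_t] with x hx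
  rw [← inner_sub_left]
  exact (norm_inner_le_norm _ _).trans_eq (by rw [hx, mul_one])

theorem HasInitialTrace.integral_slice (h : HasInitialTrace m mt m₀)
    (hw : IsWeakDeriv timeDir m mt) (hm₀ : Continuous m₀) (hm : CylinderIntegrable m)
    (hmt : CylinderIntegrable mt) (hnorm : ∀ᵐ z ∂(volume.restrict halfSpace), ‖m z‖ = 1)
    {G : ℝ × E3 → E3} (hG : ContDiffOn ℝ ∞ G closedHalfSpace)
    (hG_supp : HasBoundedSpatialSupport G) :
    ∀ᵐ t ∂(volume.restrict (Ioi (0 : ℝ))),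
      ∫ x, inner ℝ (G (t, x)) (m (t, x)) =
        (∫ x, inner ℝ (G (0, x)) (m₀ x)) + ∫ z in slab t, pairingRate G m mt z := by
  have hG₀ : ContDiff ℝ ∞ fun x => G (0, x) := contDiff_space hG le_rfl
  have hG₀c : HasCompactSupport fun x => G (0, x) := hG_supp.hasCompactSupport_slice le_rfl
  have hrate_int := integrableOn_pairingRate hm hmt hG hG_supp
  have hrate_int₀ := integrableOn_pairingRate hm hmt (contDiffOn_spatial hG₀)
    (hasBoundedSpatialSupport_spatial hG₀c)
  obtain ⟨c, hc⟩ := hw.exists_integral_slice_eq hm hmt hG hG_supp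
  have hc₀ := h.integral_slice_spatial hw hm₀ hm hmt hG₀ hG₀c
  suffices hc_eq : c = ∫ x, inner ℝ (G (0, x)) (m₀ x) by
    filter_upwards [hc, ae_restrict_mem measurableSet_Ioi] with t ht ht0
    rw [ht, hc_eq, integral_slab_eq_intervalIntegral (le_of_lt ht0) (hrate_int t)]
  have hle : ∀ᵐ t ∂(volume.restrict (Ioi (0 : ℝ))),
      |(c + ∫ s in (0 : ℝ)..t, ∫ x, pairingRate G m mt (s, x)) -
        ((∫ x, inner ℝ (G (0, x)) (m₀ x)) +
          ∫ s in (0 : ℝ)..t, ∫ x, pairingRate (fun z => G (0, z.2)) m mt (s, x))| ≤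
        ∫ x, ‖G (t, x) - G (0, x)‖ := by
    filter_upwards [hc, hc₀, ae_abs_integral_inner_sub_initial_le hm hnorm hG hG_supp]
      with t ht ht₀ hle
    rwa [← ht, ← ht₀]
  have hlim := ((tendsto_const_nhds (x := c)).add (tendsto_primitive fun S =>
    integrableOn_integral_slab (hrate_int S))).sub ((tendsto_const_nhds
      (x := ∫ x, inner ℝ (G (0, x)) (m₀ x))).add (tendsto_primitive fun S =>
        integrableOn_integral_slab (hrate_int₀ S)))
  have hdist := le_of_tendsto_of_tendsto_of_frequently hlim.abs
    (tendsto_integral_norm_sub_initial hG.continuousOn hG_supp) (frequently_nhdsGT_of_ae hle)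
  simpa [sub_eq_zero] using hdist

end InitialTrace

theorem integral_slice_eq_add_integral_slab [CompleteSpace F] [SecondCountableTopology F]
    {H : ℝ × E3 → F} (hH : ContDiffOn ℝ ∞ H closedHalfSpace)
    (hH_supp : HasBoundedSpatialSupport H) {S : ℝ} (hS : 0 ≤ S) :
    ∫ x, H (S, x) = (∫ x, H (0, x)) + ∫ z in slab S, ∂ₜ H z := by
  have hdt := (contDiffOn_dirDeriv hH timeDir).continuousOn
  have hdt_int := integrableOn_slab_of_continuousOn (hH_supp.dirDeriv timeDir) hdt S
  have hftc : ∀ x, ∫ t in Ioo 0 S, ∂ₜ H (t, x) = H (S, x) - H (0, x) := fun x => by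
    rw [← integral_Ioc_eq_integral_Ioo, ← intervalIntegral.integral_of_le hS]
    refine intervalIntegral.integral_eq_sub_of_hasDerivAt_of_le hS
      ((continuousOn_time hH.continuousOn x).mono Icc_subset_Ici_self)
      (fun t ht => hasDerivAt_time hH ht.1 x) ?_
    exact ((continuousOn_time hdt x).mono
      (uIcc_of_le hS ▸ Icc_subset_Ici_self)).intervalIntegrable
  rw [IntegrableOn, restrict_slab] at hdt_int
  rw [restrict_slab, integral_prod_symm _ hdt_int]
  simp only [hftc]
  rw [integral_sub (integrable_slice hH hH_supp hS) (integrable_slice hH hH_supp le_rfl)]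
  abel

theorem integral_inner_fderiv_eq_neg {G m₀ : E3 → E3} (hG : ContDiff ℝ ∞ G)
    (hGc : HasCompactSupport G) (hm₀ : ContDiff ℝ ∞ m₀) (e : E3) :
    ∫ x, inner ℝ (G x) (fderiv ℝ m₀ x e) = - ∫ x, inner ℝ (fderiv ℝ G x e) (m₀ x) := by
  have hint : ∀ {f g : E3 → E3}, Continuous f → Continuous g → HasCompactSupport f →
      Integrable fun x => innerSL ℝ (f x) (g x) := fun hf hg hfc =>
    (hf.inner (𝕜 := ℝ) hg).integrable_of_hasCompactSupport
      (hfc.mono fun x hx h => hx (by simp [h]))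
  have hG_deriv : Continuous fun x => fderiv ℝ G x e :=
    (hG.continuous_fderiv (by simp)).clm_apply continuous_const
  have hm₀_deriv : Continuous fun x => fderiv ℝ m₀ x e :=
    (hm₀.continuous_fderiv (by simp)).clm_apply continuous_const
  exact integral_bilinear_fderiv_right_eq_neg_left_of_integrable (B := innerSL ℝ)
    (hint hG_deriv hm₀.continuous (hGc.fderiv_apply ℝ e))
    (hint hG.continuous hm₀_deriv hGc) (hint hG.continuous hm₀.continuous hGc)
    (fun x _ => hG.differentiable (by simp) x) (fun x _ => hm₀.differentiable (by simp) x)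

theorem IsEvolution.integral_slice_dx {m₀ : E3 → E3} {V Vt : ℝ × E3 → E3}
    {Vx : Fin 3 → ℝ × E3 → E3} (h : IsEvolution m₀ V Vt Vx) (hm₀ : ContDiff ℝ ∞ m₀) (i : Fin 3)
    {G : ℝ × E3 → E3} (hG : ContDiffOn ℝ ∞ G closedHalfSpace)
    (hG_supp : HasBoundedSpatialSupport G) :
    ∀ᵐ S ∂(volume.restrict (Ioi (0 : ℝ))),
      ∫ x, inner ℝ (G (S, x)) (Vx i (S, x)) =
        (∫ x, inner ℝ (G (0, x)) (fderiv ℝ m₀ x (basisVec i))) +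
          ∫ z in slab S, (inner ℝ (∂ₜ G z) (Vx i z) - inner ℝ (∂ₓ[i] G z) (Vt z)) := by
  have hGt := contDiffOn_dirDeriv hG timeDir
  have hGt_supp := hG_supp.dirDeriv timeDir
  have hGx := contDiffOn_dirDeriv hG (spaceDir i)
  have hGx_supp := hG_supp.dirDeriv (spaceDir i)
  have hV := h.cylinderIntegrable
  have hVt := h.cylinderIntegrable_dt
  have hVx := h.cylinderIntegrable_dx i
  filter_upwards [h.integral_slice _ hGx hGx_supp,
    (h.weak_dx i).integral_slice_space hV hVx hG hG_supp] with S hslice hparts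
  have hinit := integral_inner_fderiv_eq_neg (contDiff_space hG le_rfl)
    (hG_supp.hasCompactSupport_slice le_rfl) hm₀ (basisVec i)
  simp only [fderiv_space_apply hG le_rfl] at hinit
  have hcomm : ∫ z in slab S, inner ℝ (∂ₜ (∂ₓ[i] G) z) (V z) =
      - ∫ z in slab S, inner ℝ (∂ₜ G z) (Vx i z) := by
    rw [← (h.weak_dx i).integral_slab_space hV hVx hGt hGt_supp S]
    refine setIntegral_congr_fun (measurableSet_slab S) fun z hz => ?_
    simp only [dirDeriv_comm hG timeDir (spaceDir i) (slab_subset_halfSpace S hz)]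
  have hrate : ∫ z in slab S, pairingRate (∂ₓ[i] G) V Vt z =
      (∫ z in slab S, inner ℝ (∂ₜ (∂ₓ[i] G) z) (V z)) +
        ∫ z in slab S, inner ℝ (∂ₓ[i] G z) (Vt z) :=
    integral_add (hV.integrableOn_inner (hGx_supp.dirDeriv timeDir)
      (contDiffOn_dirDeriv hGx timeDir).continuousOn S)
      (hVt.integrableOn_inner hGx_supp hGx.continuousOn S)
  rw [integral_sub (hVx.integrableOn_inner hGt_supp hGt.continuousOn S)
    (hVt.integrableOn_inner hGx_supp hGx.continuousOn S)]
  linarith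

/-! ### The geometric form of the weak equation -/

theorem wedge_apply_zero (a b : E3) : wedge a b 0 = a 1 * b 2 - a 2 * b 1 := by
  simp [wedge, cross_apply]

theorem wedge_apply_one (a b : E3) : wedge a b 1 = a 2 * b 0 - a 0 * b 2 := by
  simp [wedge, cross_apply]

theorem wedge_apply_two (a b : E3) : wedge a b 2 = a 0 * b 1 - a 1 * b 0 := by
  simp [wedge, cross_apply]

theorem inner_wedge_wedge (a b c d : E3) :
    inner ℝ (wedge a b) (wedge c d) =
      (inner ℝ a c * inner ℝ b d - inner ℝ a d * inner ℝ b c : ℝ) := by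
  simp only [inner_eq_sum, Fin.sum_univ_three, wedge_apply_zero, wedge_apply_one, wedge_apply_two]
  ring

theorem inner_wedge_swap (a b c : E3) :
    inner ℝ a (wedge b c) = - (inner ℝ (wedge b a) c : ℝ) := by
  simp only [inner_eq_sum, Fin.sum_univ_three, wedge_apply_zero, wedge_apply_one, wedge_apply_two]
  ring

theorem inner_self_wedge (a b : E3) : (inner ℝ a (wedge a b) : ℝ) = 0 := by
  simp only [inner_eq_sum, Fin.sum_univ_three, wedge_apply_zero, wedge_apply_one, wedge_apply_two]
  ring

theorem inner_wedge_self (a b : E3) : (inner ℝ (wedge a b) b : ℝ) = 0 := by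
  simp only [inner_eq_sum, Fin.sum_univ_three, wedge_apply_zero, wedge_apply_one, wedge_apply_two]
  ring

theorem norm_wedge_le (a b : E3) : ‖wedge a b‖ ≤ ‖a‖ * ‖b‖ := by
  have hLagrange := inner_wedge_wedge a b a b
  rw [real_inner_self_eq_norm_sq, real_inner_self_eq_norm_sq, real_inner_self_eq_norm_sq,
    real_inner_comm] at hLagrange
  refine le_of_sq_le_sq ?_ (by positivity)
  nlinarith [sq_nonneg (inner ℝ b a : ℝ), real_inner_comm a b]

/-- The vector product as a continuous bilinear map. -/
def wedgeL : E3 →L[ℝ] E3 →L[ℝ] E3 :=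
  (LinearMap.mk₂ ℝ wedge (fun a b c => by simp [wedge]) (fun r a b => by simp [wedge])
    (fun a b c => by simp [wedge]) (fun r a b => by simp [wedge])).mkContinuous₂ 1
    fun a b => (norm_wedge_le a b).trans (by rw [one_mul])

theorem wedgeL_apply (a b : E3) : wedgeL a b = wedge a b := rfl

theorem wedge_zero (a : E3) : wedge a 0 = 0 := (wedgeL a).map_zero

theorem aestronglyMeasurable_wedge {X : Type*} [MeasurableSpace X] {μ : Measure X} {f g : X → E3}
    (hf : AEStronglyMeasurable f μ) (hg : AEStronglyMeasurable g μ) :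
    AEStronglyMeasurable (fun z => wedge (f z) (g z)) μ :=
  wedgeL.aestronglyMeasurable_comp₂ hf hg

theorem locallyIntegrableOn_wedge {f Φ : ℝ × E3 → E3} (hf : LocallyIntegrableOn f halfSpace)
    (hΦ : ContinuousOn Φ closedHalfSpace) :
    LocallyIntegrableOn (fun z => wedge (f z) (Φ z)) halfSpace := by
  rw [locallyIntegrableOn_iff isOpen_halfSpace.isLocallyClosed]
  intro k hk hkc
  have hΦk : ContinuousOn Φ k := hΦ.mono (hk.trans halfSpace_subset_closedHalfSpace)
  obtain ⟨C, hC⟩ := hkc.exists_bound_of_continuousOn hΦk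
  have hfk := hf.integrableOn_compact_subset hk hkc
  refine (hfk.norm.mul_const C).mono'
    (aestronglyMeasurable_wedge hfk.aestronglyMeasurable
      (hΦk.aestronglyMeasurable hkc.measurableSet)) ?_
  filter_upwards [ae_restrict_mem hkc.measurableSet] with z hz
  exact (norm_wedge_le _ _).trans (mul_le_mul_of_nonneg_left (hC z hz) (norm_nonneg _))

theorem IsWeakDeriv.wedge {v : ℝ × E3} {f g Φ : ℝ × E3 → E3} (h : IsWeakDeriv v f g)
    (hΦ : ContDiffOn ℝ ∞ Φ closedHalfSpace) :
    IsWeakDeriv v (fun z => wedge (f z) (Φ z))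
      (fun z => LandauLifshitz.wedge (g z) (Φ z) +
        LandauLifshitz.wedge (f z) (dirDeriv v Φ z)) := by
  have hf_loc := locallyIntegrableOn_wedge h.1 hΦ.continuousOn
  have hg_loc := locallyIntegrableOn_wedge h.2.1 hΦ.continuousOn
  have hfd_loc := locallyIntegrableOn_wedge h.1 (contDiffOn_dirDeriv hΦ v).continuousOn
  refine ⟨hf_loc, hg_loc.add hfd_loc, fun φ hφ hcs hsub => ?_⟩
  have hsupp : tsupport (fun z => φ z • Φ z) ⊆ tsupport φ := tsupport_smul_subset_left _ _
  have hsmooth : ContDiff ℝ ∞ fun z => φ z • Φ z := contDiff_of_forall_tsupport fun z hz =>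
    hφ.contDiffAt.smul (contDiffAt_of_mem_halfSpace hΦ (hsub (hsupp hz)))
  have hderiv : ∀ z ∈ halfSpace, wedgeL.flip (fderiv ℝ (fun z => φ z • Φ z) z v) (f z) =
      φ z • LandauLifshitz.wedge (f z) (dirDeriv v Φ z) +
        fderiv ℝ φ z v • LandauLifshitz.wedge (f z) (Φ z) := fun z hz => by
    have hprod : HasFDerivAt (fun z => φ z • Φ z) _ z :=
      (hφ.differentiable (by simp) z).hasFDerivAt.smul (hasFDerivAt_of_mem_halfSpace hΦ hz)
    rw [hprod.fderiv, dirDeriv_eq_fderiv hz]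
    simp [wedgeL_apply]
  have hparts := h.isWeakDerivOn.integral_bilinear wedgeL.flip hsmooth
    (hcs.mono' ((subset_tsupport _).trans hsupp)) (hsupp.trans hsub)
  have hφf := (integrable_smul_of_tsupport_subset
    ((hφ.continuous_fderiv (by simp)).clm_apply continuous_const) (hcs.fderiv_apply ℝ v)
    ((tsupport_fderiv_apply_subset ℝ v).trans hsub) hf_loc).integrableOn (s := halfSpace)
  have hφg := (integrable_smul_of_tsupport_subset hφ.continuous hcs hsub hg_loc).integrableOn
    (s := halfSpace)
  have hφd := (integrable_smul_of_tsupport_subset hφ.continuous hcs hsub hfd_loc).integrableOn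
    (s := halfSpace)
  rw [setIntegral_congr_fun measurableSet_halfSpace hderiv, integral_add hφd hφf] at hparts
  simp only [map_smul, smul_apply, ContinuousLinearMap.flip_apply, wedgeL_apply]
    at hparts
  simp_rw [smul_add]
  rw [integral_add hφg hφd, neg_add, ← hparts]
  abel

theorem memLp_restrict_of_forall_notMem {X : Type*} [MeasurableSpace X] {μ : Measure X}
    {F : Type*} [NormedAddCommGroup F] {f : X → F} {p : ENNReal} {s t : Set X}
    (hs : MeasurableSet s) (ht : MeasurableSet t) (hf : MemLp f p (μ.restrict s))
    (hzero : ∀ x ∈ t, x ∉ s → f x = 0) : MemLp f p (μ.restrict t) := by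
  refine (((memLp_indicator_iff_restrict hs).2 hf).restrict t).ae_eq ?_
  filter_upwards [ae_restrict_mem ht] with x hx
  by_cases hxs : x ∈ s
  · rw [indicator_of_mem hxs]
  · rw [indicator_of_notMem hxs, hzero x hx hxs]

theorem integrable_inner_of_memLp_two {X : Type*} [MeasurableSpace X] {μ : Measure X}
    {f g : X → E3} (hf : MemLp f 2 μ) (hg : MemLp g 2 μ) :
    Integrable (fun z => inner ℝ (f z) (g z)) μ :=
  (hf.norm.integrable_mul hg.norm).mono' (hf.1.inner hg.1)
    (Eventually.of_forall fun _ => norm_inner_le_norm _ _)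

theorem memLp_two_wedge_of_norm_eq_one {X : Type*} [MeasurableSpace X] {μ : Measure X}
    {m g : X → E3} (hm : AEStronglyMeasurable m μ) (hnorm : ∀ᵐ x ∂μ, ‖m x‖ = 1)
    (hg : MemLp g 2 μ) : MemLp (fun x => wedge (m x) (g x)) 2 μ := by
  refine hg.of_le (aestronglyMeasurable_wedge hm hg.1) ?_
  filter_upwards [hnorm] with x hx
  simpa [hx] using norm_wedge_le (m x) (g x)

section BoundedSupport

/-- `G` vanishes on `[0,∞) × ℝ³` outside of a bounded set. -/
def HasBoundedSupport (G : ℝ × E3 → E3) : Prop :=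
  ∃ R : ℝ, ∀ z ∈ closedHalfSpace, R < ‖z‖ → G z = 0

variable {Φ : ℝ × E3 → E3}

theorem HasBoundedSupport.hasBoundedSpatialSupport (h : HasBoundedSupport Φ) :
    HasBoundedSpatialSupport Φ := by
  obtain ⟨R, hR⟩ := h
  exact ⟨R, fun z hz hzR => hR z hz (hzR.trans_le (norm_snd_le z))⟩

theorem HasBoundedSupport.dirDeriv (h : HasBoundedSupport Φ) (v : ℝ × E3) :
    HasBoundedSupport (dirDeriv v Φ) := by
  obtain ⟨R, hR⟩ := h
  have hU : IsOpen {z : ℝ × E3 | R < ‖z‖} := isOpen_lt continuous_const continuous_norm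
  exact ⟨R, fun z hz hzR => dirDeriv_eq_zero_of_isOpen hU hR v hz hzR⟩

theorem HasBoundedSupport.exists_forall_notMem_slab (h : HasBoundedSupport Φ) :
    ∃ N : ℝ, 0 < N ∧ ∀ z ∈ halfSpace, z ∉ slab N → Φ z = 0 := by
  obtain ⟨R, hR⟩ := h
  refine ⟨max R 0 + 1, by positivity, fun z hz hzN => hR z (halfSpace_subset_closedHalfSpace hz) ?_⟩
  have hlate : max R 0 + 1 ≤ z.1 := by
    by_contra! hlt
    exact hzN ⟨⟨hz.1, hlt⟩, mem_univ _⟩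
  linarith [le_max_left R 0, (le_abs_self z.1).trans (norm_fst_le z)]

theorem memLp_two_wedge_slab (hΦ : ContinuousOn Φ closedHalfSpace)
    (hsupp : HasBoundedSpatialSupport Φ) {g : ℝ × E3 → E3} {S : ℝ}
    (hg : MemLp g 2 (volume.restrict (slab S))) :
    MemLp (fun z => wedge (g z) (Φ z)) 2 (volume.restrict (slab S)) := by
  obtain ⟨C, hC⟩ := hsupp.exists_bound hΦ S
  refine hg.of_le_mul (c := C)
    (aestronglyMeasurable_wedge hg.1 (aestronglyMeasurable_slab_of_continuousOn hΦ S)) ?_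
  filter_upwards [ae_restrict_mem (measurableSet_slab S)] with z hz
  refine (norm_wedge_le _ _).trans ?_
  rw [mul_comm]
  exact mul_le_mul_of_nonneg_right (hC z (slab_subset_closedHalfSpace S hz) hz.1.2.le)
    (norm_nonneg _)

theorem HasBoundedSupport.memLp_two_wedge (h : HasBoundedSupport Φ)
    (hΦ : ContinuousOn Φ closedHalfSpace) {g : ℝ × E3 → E3}
    (hg : ∀ S, 0 < S → MemLp g 2 (volume.restrict (slab S))) :
    MemLp (fun z => LandauLifshitz.wedge (g z) (Φ z)) 2 (volume.restrict halfSpace) := by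
  obtain ⟨N, hN, hzero⟩ := h.exists_forall_notMem_slab
  refine memLp_restrict_of_forall_notMem (measurableSet_slab N) measurableSet_halfSpace
    (memLp_two_wedge_slab hΦ h.hasBoundedSpatialSupport (hg N hN)) fun z hz hzN => ?_
  rw [hzero z hz hzN, wedge_zero]

theorem HasBoundedSupport.memLp (h : HasBoundedSupport Φ) (hΦ : ContinuousOn Φ closedHalfSpace)
    (p : ENNReal) : MemLp Φ p (volume.restrict halfSpace) := by
  obtain ⟨R, hR⟩ := h
  set K : Set (ℝ × E3) := Metric.closedBall 0 R ∩ closedHalfSpace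
  have hK_compact : IsCompact K :=
    (isCompact_closedBall 0 R).inter_right (isClosed_Ici.prod isClosed_univ)
  obtain ⟨C, hC⟩ := hK_compact.exists_bound_of_continuousOn (hΦ.mono inter_subset_right)
  have : Fact (volume K < ⊤) := ⟨hK_compact.measure_lt_top⟩
  have hΦK : MemLp Φ p (volume.restrict K) := MemLp.of_bound
    ((hΦ.mono inter_subset_right).aestronglyMeasurable hK_compact.measurableSet) C
    (by filter_upwards [ae_restrict_mem hK_compact.measurableSet] using hC)
  refine memLp_restrict_of_forall_notMem hK_compact.measurableSet measurableSet_halfSpace hΦK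
    fun z hz hzK => hR z (halfSpace_subset_closedHalfSpace hz) ?_
  by_contra! hle
  exact hzK ⟨by simpa using hle, halfSpace_subset_closedHalfSpace hz⟩

end BoundedSupport

section WeakSolution

theorem isFiniteMeasure_restrict_cylinder (S R : ℝ) :
    IsFiniteMeasure ((volume : Measure (ℝ × E3)).restrict (cylinder S R)) := by
  refine ⟨?_⟩
  rw [Measure.restrict_apply_univ, cylinder, Measure.volume_eq_prod, Measure.prod_prod]
  exact ENNReal.mul_lt_top measure_Ioo_lt_top (isCompact_closedBall _ _).measure_lt_top

theorem cylinderIntegrable_of_memLp_two {f : ℝ × E3 → E3}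
    (h : ∀ S, 0 < S → MemLp f 2 (volume.restrict (slab S))) : CylinderIntegrable f := by
  intro S R
  have hfin := isFiniteMeasure_restrict_cylinder S R
  have hsub : cylinder S R ⊆ slab (max S 1) :=
    prod_mono (Ioo_subset_Ioo_right (le_max_left _ _)) (subset_univ _)
  exact ((h (max S 1) (by positivity)).mono_measure
    (Measure.restrict_mono hsub le_rfl)).integrable one_le_two

variable {m₀ : E3 → E3} {m mt : ℝ × E3 → E3} {mx : Fin 3 → ℝ × E3 → E3}

theorem IsGlobalWeakSolution.ae_norm (h : IsGlobalWeakSolution m₀ m mt mx) (S : ℝ) :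
    ∀ᵐ z ∂(volume.restrict (slab S)), ‖m z‖ = 1 :=
  ae_restrict_of_ae_restrict_of_subset (slab_subset_halfSpace S) h.norm_eq_one

theorem IsGlobalWeakSolution.ae_inner_dt_eq_zero (h : IsGlobalWeakSolution m₀ m mt mx) (S : ℝ) :
    ∀ᵐ z ∂(volume.restrict (slab S)), inner ℝ (m z) (mt z) = 0 :=
  ae_restrict_of_ae_restrict_of_subset (slab_subset_halfSpace S)
    (h.weak_dt.inner_eq_zero h.norm_eq_one)

theorem IsGlobalWeakSolution.ae_inner_dx_eq_zero (h : IsGlobalWeakSolution m₀ m mt mx) (S : ℝ) :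
    ∀ᵐ z ∂(volume.restrict (slab S)), ∀ i, inner ℝ (m z) (mx i z) = 0 :=
  ae_all_iff.2 fun i => ae_restrict_of_ae_restrict_of_subset (slab_subset_halfSpace S)
    ((h.weak_dx i).inner_eq_zero h.norm_eq_one)

theorem IsGlobalWeakSolution.aestronglyMeasurable (h : IsGlobalWeakSolution m₀ m mt mx) :
    AEStronglyMeasurable m (volume.restrict halfSpace) :=
  h.weak_dt.1.aestronglyMeasurable

theorem IsGlobalWeakSolution.cylinderIntegrable (h : IsGlobalWeakSolution m₀ m mt mx) :
    CylinderIntegrable m := by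
  intro S R
  have hfin := isFiniteMeasure_restrict_cylinder S R
  exact Integrable.of_bound (h.aestronglyMeasurable.mono_measure (Measure.restrict_mono
      ((cylinder_subset_slab S R).trans (slab_subset_halfSpace S)) le_rfl)) 1
    ((ae_restrict_of_ae_restrict_of_subset (cylinder_subset_slab S R) (h.ae_norm S)).mono
      fun z hz => hz.le)

theorem IsGlobalWeakSolution.memLp_dx (h : IsGlobalWeakSolution m₀ m mt mx) {S : ℝ} (hS : 0 < S)
    (i : Fin 3) : MemLp (mx i) 2 (volume.restrict (slab S)) := by
  have hmeas : AEStronglyMeasurable (mx i) (volume.restrict (slab S)) :=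
    (h.weak_dx i).2.1.aestronglyMeasurable.mono_measure
      (Measure.restrict_mono (slab_subset_halfSpace S) le_rfl)
  refine ⟨hmeas, ?_⟩
  rw [eLpNorm_lt_top_iff_lintegral_rpow_enorm_lt_top two_ne_zero ENNReal.ofNat_ne_top]
  obtain ⟨C, hC⟩ := h.bound_dx S hS
  rw [restrict_slab] at hmeas ⊢
  rw [lintegral_prod _ (hmeas.enorm.pow_const _)]
  simp only [ENNReal.toReal_ofNat, ENNReal.rpow_ofNat]
  calc ∫⁻ t in Ioo 0 S, ∫⁻ x, ‖mx i (t, x)‖ₑ ^ 2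
      ≤ ∫⁻ _t in Ioo (0 : ℝ) S, (C : ENNReal) := by
        refine lintegral_mono_ae ?_
        filter_upwards [hC] with t ht
        exact (lintegral_mono fun x => Finset.single_le_sum
          (f := fun i => ‖mx i (t, x)‖ₑ ^ 2) (fun _ _ => zero_le) (Finset.mem_univ i)).trans ht
    _ < ⊤ := by
        rw [setLIntegral_const]
        exact ENNReal.mul_lt_top ENNReal.coe_lt_top measure_Ioo_lt_top

theorem IsGlobalWeakSolution.isEvolution (h : IsGlobalWeakSolution m₀ m mt mx)
    (hm₀ : Continuous m₀) : IsEvolution m₀ m mt mx where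
  cylinderIntegrable := h.cylinderIntegrable
  cylinderIntegrable_dt := cylinderIntegrable_of_memLp_two h.memLp_dt
  cylinderIntegrable_dx i := cylinderIntegrable_of_memLp_two fun _ hS => h.memLp_dx hS i
  weak_dx := h.weak_dx
  integral_slice _ hG hG_supp := h.initial.integral_slice h.weak_dt hm₀ h.cylinderIntegrable
    (cylinderIntegrable_of_memLp_two h.memLp_dt) h.norm_eq_one hG hG_supp

variable {Φ : ℝ × E3 → E3}

theorem IsGlobalWeakSolution.isH1_wedge (h : IsGlobalWeakSolution m₀ m mt mx)
    (hΦ : ContDiffOn ℝ ∞ Φ closedHalfSpace) (hsupp : HasBoundedSupport Φ) :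
    IsH1 (fun z => wedge (m z) (Φ z)) (fun z => wedge (mt z) (Φ z) + wedge (m z) (∂ₜ Φ z))
      (fun i z => wedge (mx i z) (Φ z) + wedge (m z) (∂ₓ[i] Φ z)) := by
  have hm_wedge : ∀ v, MemLp (fun z => wedge (m z) (dirDeriv v Φ z)) 2
      (volume.restrict halfSpace) := fun v =>
    memLp_two_wedge_of_norm_eq_one h.aestronglyMeasurable h.norm_eq_one
      ((hsupp.dirDeriv v).memLp (contDiffOn_dirDeriv hΦ v).continuousOn 2)
  exact
    { weak_dt := h.weak_dt.wedge hΦ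
      weak_dx := fun i => (h.weak_dx i).wedge hΦ
      memLp := memLp_two_wedge_of_norm_eq_one h.aestronglyMeasurable h.norm_eq_one
        (hsupp.memLp hΦ.continuousOn 2)
      memLp_dt := (hsupp.memLp_two_wedge hΦ.continuousOn h.memLp_dt).add (hm_wedge _)
      memLp_dx := fun i =>
        (hsupp.memLp_two_wedge hΦ.continuousOn fun _ hS => h.memLp_dx hS i).add (hm_wedge _) }

/-- The integrand of the weak equation tested with `m ∧ Φ`; since `|m| = 1`, this is the equation
`∂ₜm - m ∧ ∂ₜm = 2 (Δm + |∇m|² m)`, obtained by applying `-m ∧ ·`. -/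
def geometricResidual (m mt : ℝ × E3 → E3) (mx : Fin 3 → ℝ × E3 → E3) (Φ : ℝ × E3 → E3)
    (z : ℝ × E3) : ℝ :=
  inner ℝ (mt z - wedge (m z) (mt z)) (Φ z) +
    2 * ∑ i, (inner ℝ (mx i z) (∂ₓ[i] Φ z) - ‖mx i z‖ ^ 2 * inner ℝ (m z) (Φ z))

theorem IsGlobalWeakSolution.ae_eq_geometricResidual (h : IsGlobalWeakSolution m₀ m mt mx)
    (S : ℝ) :
    (fun z => inner ℝ (mt z + wedge (m z) (mt z)) (wedge (m z) (Φ z)) + 2 * ∑ i,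
      inner ℝ (wedge (m z) (mx i z)) (wedge (mx i z) (Φ z) + wedge (m z) (∂ₓ[i] Φ z)))
      =ᵐ[volume.restrict (slab S)] geometricResidual m mt mx Φ := by
  filter_upwards [h.ae_norm S, h.ae_inner_dt_eq_zero S, h.ae_inner_dx_eq_zero S]
    with z hnorm hdt hdx
  have hself : (inner ℝ (m z) (m z) : ℝ) = 1 := by
    rw [real_inner_self_eq_norm_sq, hnorm, one_pow]
  have hdt' : (inner ℝ (mt z) (m z) : ℝ) = 0 := by rw [real_inner_comm, hdt]
  rw [geometricResidual]
  congr 1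
  · rw [inner_add_left, inner_sub_left, inner_wedge_wedge, hself, hdt',
      inner_wedge_swap (mt z) (m z)]
    ring
  · refine congrArg (2 * ·) (Finset.sum_congr rfl fun i _ => ?_)
    have hdx' : (inner ℝ (mx i z) (m z) : ℝ) = 0 := by rw [real_inner_comm, hdx i]
    rw [inner_add_right, inner_wedge_wedge, inner_wedge_wedge, hself, hdx i, hdx',
      real_inner_self_eq_norm_sq]
    ring

theorem IsGlobalWeakSolution.integral_geometricResidual (h : IsGlobalWeakSolution m₀ m mt mx)
    (hΦ : ContDiffOn ℝ ∞ Φ closedHalfSpace) (hsupp : HasBoundedSupport Φ) {S : ℝ} (hS : 0 < S) :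
    IntegrableOn (geometricResidual m mt mx Φ) (slab S) ∧
      ∫ z in slab S, geometricResidual m mt mx Φ z = 0 := by
  have hH1 := h.isH1_wedge hΦ hsupp
  have hweak := h.weak_eq _ _ _ hH1 S hS
  have hle := Measure.restrict_mono (μ := volume) (slab_subset_halfSpace S) le_rfl
  have hm_wedge : ∀ {g}, MemLp g 2 (volume.restrict (slab S)) →
      MemLp (fun z => wedge (m z) (g z)) 2 (volume.restrict (slab S)) :=
    memLp_two_wedge_of_norm_eq_one (h.aestronglyMeasurable.mono_measure hle) (h.ae_norm S)
  have hdt_int := integrable_inner_of_memLp_two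
    ((h.memLp_dt S hS).add (hm_wedge (h.memLp_dt S hS))) (hH1.memLp.mono_measure hle)
  have hdx_int := fun i => integrable_inner_of_memLp_two
    (hm_wedge (h.memLp_dx hS i)) ((hH1.memLp_dx i).mono_measure hle)
  have hsum_int := (integrable_finsetSum Finset.univ fun i _ => hdx_int i).const_mul 2
  have hae := h.ae_eq_geometricResidual (Φ := Φ) S
  refine ⟨(hdt_int.add hsum_int).congr hae, ?_⟩
  rw [← integral_congr_ae hae]
  refine (integral_add hdt_int hsum_int).trans ?_
  rw [integral_const_mul, integral_finsetSum _ fun i _ => hdx_int i]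
  exact (congrArg (· + _) hweak).trans (by ring)

end WeakSolution

/-! ### Smooth solutions and spatial cutoffs -/

theorem wedge_wedge_self (a b : E3) :
    wedge a (wedge a b) = (inner ℝ a b : ℝ) • a - (inner ℝ a a : ℝ) • b := by
  ext j
  simp only [PiLp.sub_apply, PiLp.smul_apply, smul_eq_mul, inner_eq_sum, Fin.sum_univ_three]
  fin_cases j <;> simp [wedge_apply_zero, wedge_apply_one, wedge_apply_two] <;> ring

theorem two_smul_eq_of_add_wedge_eq {a p L : E3} {q : ℝ} (ha : (inner ℝ a a : ℝ) = 1)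
    (hap : (inner ℝ a p : ℝ) = 0) (haL : (inner ℝ a L : ℝ) = -q)
    (h : p + wedge a p = (2 : ℝ) • wedge a L) :
    (2 : ℝ) • L = p - wedge a p - (2 * q) • a := by
  have hwedge := congrArg (fun b => wedgeL a b) h
  simp only [map_add, map_smul, wedgeL_apply, wedge_wedge_self, ha, hap, haL] at hwedge
  linear_combination (norm := module) hwedge

theorem inner_eq_zero_of_add_wedge_eq {a p L : E3} (h : p + wedge a p = (2 : ℝ) • wedge a L) :
    inner ℝ a p = (0 : ℝ) := by
  have hinner := congrArg (fun b => (inner ℝ a b : ℝ)) h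
  simpa [inner_add_right, real_inner_smul_right, inner_self_wedge] using hinner

theorem laplacian_space {f : ℝ × E3 → E3} (hf : ContDiffOn ℝ ∞ f closedHalfSpace) {t : ℝ}
    (ht : 0 ≤ t) (x : E3) :
    Laplacian.laplacian (fun y => f (t, y)) x = ∑ i, ∂ₓ[i] (∂ₓ[i] f) (t, x) := by
  rw [InnerProductSpace.laplacian_eq_iteratedFDeriv_orthonormalBasis _
    (EuclideanSpace.basisFun (Fin 3) ℝ)]
  refine Finset.sum_congr rfl fun i _ => ?_
  rw [iteratedFDeriv_two_apply]
  simp only [Matrix.cons_val_zero, Matrix.cons_val_one, EuclideanSpace.basisFun_apply]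
  change fderiv ℝ (fderiv ℝ fun y => f (t, y)) x (basisVec i) (basisVec i) = _
  have hfirst : (fun y => fderiv ℝ (fun y => f (t, y)) y (basisVec i)) =
      fun y => ∂ₓ[i] f (t, y) := funext fun y => fderiv_space_apply hf ht y i
  have hdiff : DifferentiableAt ℝ (fderiv ℝ fun y => f (t, y)) x :=
    ((contDiff_space hf ht).fderiv_right (m := ∞) (by simp)).differentiable (by simp) x
  rw [← fderiv_space_apply (contDiffOn_dirDeriv hf _) ht, ← hfirst,
    fderiv_clm_apply hdiff (by fun_prop)]
  simp

theorem exists_contDiffOn_eq_of_le {f : ℝ × E3 → F} {T T' : ℝ}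
    (hf : ContDiffOn ℝ ∞ f (Ico (0 : ℝ) T ×ˢ univ)) (hT' : 0 < T') (hT : T' < T) :
    ∃ u : ℝ × E3 → F, ContDiffOn ℝ ∞ u closedHalfSpace ∧
      (∃ N : ℝ, ∀ z ∈ closedHalfSpace, N < z.1 → u z = 0) ∧
      ∀ z ∈ closedHalfSpace, z.1 ≤ T' → u z = f z := by
  obtain ⟨N, hT'N, hNT⟩ := exists_between hT
  set θ : ContDiffBump (0 : ℝ) := ⟨T', N, hT', hT'N⟩ with hθ
  have hzero : ∀ t, N < t → θ t = 0 := fun t ht =>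
    θ.zero_of_le_dist (by simpa [hθ] using ht.le.trans (le_abs_self t))
  refine ⟨fun z => θ z.1 • f z, fun z hz => ?_, ⟨N, fun z _ hz => ?_⟩, fun z hz hzT => ?_⟩
  · rcases lt_or_ge z.1 T with hzT | hzT
    · have hnear : {y : ℝ × E3 | y.1 < T} ∈ 𝓝 z :=
        (isOpen_Iio.preimage continuous_fst).mem_nhds hzT
      have hf_z : ContDiffWithinAt ℝ ∞ f closedHalfSpace z := by
        refine (hf z ⟨⟨hz.1, hzT⟩, mem_univ _⟩).mono_of_mem_nhdsWithin ?_
        filter_upwards [mem_nhdsWithin_of_mem_nhds hnear, self_mem_nhdsWithin] with y hyT hy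
        exact ⟨⟨hy.1, hyT⟩, mem_univ _⟩
      exact (θ.contDiff.comp contDiff_fst).contDiffAt.contDiffWithinAt.smul hf_z
    · have hnear : {y : ℝ × E3 | N < y.1} ∈ 𝓝 z :=
        (isOpen_Ioi.preimage continuous_fst).mem_nhds (hNT.trans_le hzT)
      refine (contDiffAt_const (c := (0 : F)).congr_of_eventuallyEq ?_).contDiffWithinAt
      filter_upwards [hnear] with y hy
      rw [hzero y.1 hy, zero_smul]
  · simp only [hzero z.1 hz, zero_smul]
  · have hone : θ z.1 = 1 := θ.one_of_mem_closedBall <| by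
      simpa [hθ, abs_of_nonneg (mem_closedHalfSpace.1 hz)] using hzT
    simp only [hone, one_smul]

theorem isOpen_slab (S : ℝ) : IsOpen (slab S) := isOpen_Ioo.prod isOpen_univ

theorem dirDeriv_eq_zero_of_forall_slab {f : ℝ × E3 → F} {T : ℝ} {c : F}
    (hf : ∀ z ∈ slab T, f z = c) (v : ℝ × E3) {z : ℝ × E3} (hz : z ∈ slab T) :
    dirDeriv v f z = 0 := by
  have hconst : f =ᶠ[𝓝 z] fun _ => c := by
    filter_upwards [(isOpen_slab T).mem_nhds hz] using hf
  rw [dirDeriv_eq_fderiv (slab_subset_halfSpace T hz), hconst.fderiv_eq]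
  simp

theorem norm_timeDir : ‖timeDir‖ = 1 := by simp [timeDir, Prod.norm_def]

theorem norm_spaceDir (i : Fin 3) : ‖spaceDir i‖ = 1 := by
  simp [spaceDir, basisVec, Prod.norm_def]

section UnitLength

variable {u : ℝ × E3 → E3} {T : ℝ}

theorem norm_eq_one_of_inner_dt_eq_zero (hu : ContDiffOn ℝ ∞ u closedHalfSpace)
    (hinit : ∀ x, ‖u (0, x)‖ = 1) (horth : ∀ z ∈ slab T, inner ℝ (u z) (∂ₜ u z) = (0 : ℝ)) :
    ∀ z ∈ slab T, ‖u z‖ = 1 := by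
  rintro ⟨t, x⟩ hz
  obtain ⟨ht, htT⟩ := mem_slab.1 hz
  have hsq : ContDiffOn ℝ ∞ (fun z => (inner ℝ (u z) (u z) : ℝ)) closedHalfSpace := hu.inner ℝ hu
  have hderiv : ∀ s ∈ Ioo 0 t, HasDerivAt (fun s => (inner ℝ (u (s, x)) (u (s, x)) : ℝ)) 0 s := by
    intro s hs
    have hsT : (s, x) ∈ slab T := mem_slab.2 ⟨hs.1, hs.2.trans htT⟩
    have hd := hasDerivAt_time hsq hs.1 x
    rwa [dirDeriv_inner hu hu _ (slab_subset_closedHalfSpace T hsT),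
      real_inner_comm (u (s, x)) (∂ₜ u (s, x)), horth _ hsT, zero_add] at hd
  have hconst := intervalIntegral.integral_eq_sub_of_hasDerivAt_of_le ht.le
    ((continuousOn_time hsq.continuousOn x).mono Icc_subset_Ici_self) hderiv (by simp)
  rw [intervalIntegral.integral_zero, real_inner_self_eq_norm_sq (u (0, x)), hinit,
    real_inner_self_eq_norm_sq] at hconst
  exact (pow_eq_one_iff_of_nonneg (norm_nonneg _) two_ne_zero).1 (by linarith)

theorem inner_dirDeriv_eq_zero_of_norm_eq_one (hu : ContDiffOn ℝ ∞ u closedHalfSpace)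
    (hnorm : ∀ z ∈ slab T, ‖u z‖ = 1) (v : ℝ × E3) :
    ∀ z ∈ slab T, inner ℝ (u z) (dirDeriv v u z) = (0 : ℝ) := by
  intro z hz
  have hsq := dirDeriv_inner hu hu v (slab_subset_closedHalfSpace T hz)
  have hself : ∀ z ∈ slab T, (inner ℝ (u z) (u z) : ℝ) = 1 := fun z hz => by
    rw [real_inner_self_eq_norm_sq, hnorm z hz, one_pow]
  rw [dirDeriv_eq_zero_of_forall_slab hself v hz,
    real_inner_comm (u z) (dirDeriv v u z)] at hsq
  linarith

theorem inner_dirDeriv_dirDeriv_of_norm_eq_one (hu : ContDiffOn ℝ ∞ u closedHalfSpace)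
    (hnorm : ∀ z ∈ slab T, ‖u z‖ = 1) (v : ℝ × E3) :
    ∀ z ∈ slab T, inner ℝ (u z) (dirDeriv v (dirDeriv v u) z) = -‖dirDeriv v u z‖ ^ 2 := by
  intro z hz
  have hprod := dirDeriv_inner hu (contDiffOn_dirDeriv hu v) v (slab_subset_closedHalfSpace T hz)
  rw [dirDeriv_eq_zero_of_forall_slab (inner_dirDeriv_eq_zero_of_norm_eq_one hu hnorm v) v hz,
    real_inner_self_eq_norm_sq] at hprod
  linarith

end UnitLength

/-- A map `u`, smooth on `[0,∞) × ℝ³` and vanishing for late times, which on `(0,T) × ℝ³` is a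
unit-length solution of the Landau–Lifshitz equation, with first derivatives bounded by `M`. The
equation is written in the form solved for the Laplacian, `2Δu = ∂ₜu - u ∧ ∂ₜu - 2|∇u|² u`. -/
structure IsTruncatedSolution (T M : ℝ) (m₀ : E3 → E3) (u : ℝ × E3 → E3) : Prop where
  smooth : ContDiffOn ℝ ∞ u closedHalfSpace
  vanish : ∃ N : ℝ, ∀ z ∈ closedHalfSpace, N < z.1 → u z = 0
  initial : ∀ x, u (0, x) = m₀ x
  norm_eq_one : ∀ z ∈ slab T, ‖u z‖ = 1
  orthogonal_dt : ∀ z ∈ slab T, inner ℝ (u z) (∂ₜ u z) = (0 : ℝ)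
  equation : ∀ z ∈ slab T, (2 : ℝ) • ∑ i, ∂ₓ[i] (∂ₓ[i] u) z =
    ∂ₜ u z - wedge (u z) (∂ₜ u z) - (2 * ∑ i, ‖∂ₓ[i] u z‖ ^ 2) • u z
  bounded : ∀ z ∈ slab T, ‖∂ₜ u z‖ ≤ M ∧ ∀ i, ‖∂ₓ[i] u z‖ ≤ M

theorem IsSmoothSolution.add_wedge_eq_of_eqOn {T T' : ℝ} {m₀ : E3 → E3} {m u : ℝ × E3 → E3}
    (h : IsSmoothSolution T m₀ m) (hT : T' < T) (hu : ContDiffOn ℝ ∞ u closedHalfSpace)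
    (hum : ∀ z ∈ slab T', u z = m z) :
    ∀ z ∈ slab T', ∂ₜ u z + wedge (u z) (∂ₜ u z) =
      (2 : ℝ) • wedge (u z) (∑ i, ∂ₓ[i] (∂ₓ[i] u) z) := by
  rintro ⟨t, x⟩ hz
  obtain ⟨ht, htT⟩ := mem_slab.1 hz
  have htime : deriv (fun s => m (s, x)) t = ∂ₜ u (t, x) := by
    refine ((hasDerivAt_time hu ht x).congr_of_eventuallyEq ?_).deriv
    filter_upwards [Ioo_mem_nhds ht htT] with s hs using (hum (s, x) (mem_slab.2 hs)).symm
  have hspace : (fun y => m (t, y)) = fun y => u (t, y) :=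
    funext fun y => (hum (t, y) (mem_slab.2 ⟨ht, htT⟩)).symm
  have hpoint := h.equation t ⟨ht, htT.trans hT⟩ x
  rwa [htime, hspace, laplacian_space hu ht.le, ← hum _ hz] at hpoint

theorem IsSmoothSolution.exists_bound_of_eqOn {T T' : ℝ} {m₀ : E3 → E3} {m u : ℝ × E3 → E3}
    (h : IsSmoothSolution T m₀ m) (hT : T' < T) (hum : ∀ z ∈ slab T', u z = m z) :
    ∃ M : ℝ, ∀ z ∈ slab T', ∀ v : ℝ × E3, ‖v‖ = 1 → ‖dirDeriv v u z‖ ≤ M := by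
  obtain ⟨M, hM⟩ := h.bounded T' hT 1 (by simp)
  refine ⟨M, fun z hz v hv => ?_⟩
  have heq : u =ᶠ[𝓝 z] m := by filter_upwards [(isOpen_slab T').mem_nhds hz] using hum
  have hMz := hM z hz
  rw [norm_iteratedFDeriv_one] at hMz
  rw [dirDeriv_eq_fderiv (slab_subset_halfSpace _ hz), heq.fderiv_eq]
  exact (fderiv ℝ m z).le_of_opNorm_le_of_le hMz hv.le |>.trans (mul_one M).le

theorem IsSmoothSolution.exists_truncation {T : ℝ} {m₀ : E3 → E3} {m : ℝ × E3 → E3}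
    (h : IsSmoothSolution T m₀ m) (hm₀ : ∀ x, ‖m₀ x‖ = 1) {T' : ℝ} (hT' : 0 < T') (hT : T' < T) :
    ∃ M u, IsTruncatedSolution T' M m₀ u ∧ ∀ z ∈ slab T', u z = m z := by
  obtain ⟨u, hu, hvanish, hum_le⟩ := exists_contDiffOn_eq_of_le h.smooth hT' hT
  have hum : ∀ z ∈ slab T', u z = m z := fun z hz =>
    hum_le z (slab_subset_closedHalfSpace T' hz) hz.1.2.le
  have hinit : ∀ x, u (0, x) = m₀ x := fun x =>
    (hum_le (0, x) (mem_closedHalfSpace.2 le_rfl) hT'.le).trans (h.initial x)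
  have heq := h.add_wedge_eq_of_eqOn hT hu hum
  have horth : ∀ z ∈ slab T', inner ℝ (u z) (∂ₜ u z) = (0 : ℝ) := fun z hz =>
    inner_eq_zero_of_add_wedge_eq (heq z hz)
  have hnorm := norm_eq_one_of_inner_dt_eq_zero hu (fun x => by rw [hinit, hm₀]) horth
  obtain ⟨M, hM⟩ := h.exists_bound_of_eqOn hT hum
  refine ⟨M, u, ⟨hu, hvanish, hinit, hnorm, horth, fun z hz => ?_, fun z hz =>
    ⟨hM z hz _ norm_timeDir, fun i => hM z hz _ (norm_spaceDir i)⟩⟩, hum⟩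
  refine two_smul_eq_of_add_wedge_eq ?_ (horth z hz) ?_ (heq z hz)
  · rw [real_inner_self_eq_norm_sq, hnorm z hz, one_pow]
  · rw [inner_sum, ← Finset.sum_neg_distrib]
    exact Finset.sum_congr rfl fun i _ =>
      inner_dirDeriv_dirDeriv_of_norm_eq_one hu hnorm (spaceDir i) z hz

/-- A smooth cutoff function at scale `R`, between the balls of radii `R` and `2R`. The bound
`|∂ᵢχ|² ≤ (L/R)² χ`, with `L` independent of `R`, lets the terms containing `∂ᵢχ` be absorbed. -/
structure IsCutoff (L R : ℝ) (χ : E3 → ℝ) : Prop where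
  smooth : ContDiff ℝ ∞ χ
  nonneg : ∀ x, 0 ≤ χ x
  le_one : ∀ x, χ x ≤ 1
  eq_one : ∀ x, ‖x‖ ≤ R → χ x = 1
  eq_zero : ∀ x, 2 * R ≤ ‖x‖ → χ x = 0
  sq_fderiv_le : ∀ i x, (fderiv ℝ χ x (basisVec i)) ^ 2 ≤ (L / R) ^ 2 * χ x

theorem sq_fderiv_sq_apply_le {E : Type*} [NormedAddCommGroup E] [NormedSpace ℝ E] {f : E → ℝ}
    {x v : E} {C : ℝ} (hf : DifferentiableAt ℝ f x) (hC : ‖fderiv ℝ f x‖ ≤ C) (hv : ‖v‖ ≤ 1) :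
    (fderiv ℝ (fun y => f y ^ 2) x v) ^ 2 ≤ (2 * C) ^ 2 * f x ^ 2 := by
  have hbound : ‖fderiv ℝ f x v‖ ≤ C :=
    ((fderiv ℝ f x).le_of_opNorm_le_of_le hC hv).trans (mul_one C).le
  have hpow : HasFDerivAt (fun y => f y ^ 2) _ x := hf.hasFDerivAt.pow 2
  rw [hpow.fderiv]
  calc _ = (2 * fderiv ℝ f x v) ^ 2 * f x ^ 2 := by simp; ring
    _ ≤ (2 * C) ^ 2 * f x ^ 2 := by
        refine mul_le_mul_of_nonneg_right (sq_le_sq.2 ?_) (sq_nonneg _)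
        rw [abs_mul, abs_mul]
        exact mul_le_mul_of_nonneg_left (hbound.trans (le_abs_self C)) (abs_nonneg _)

theorem exists_isCutoff : ∃ L : ℝ, 0 ≤ L ∧ ∀ R : ℝ, 0 < R → ∃ χ, IsCutoff L R χ := by
  set η : ContDiffBump (0 : E3) := ⟨1, 2, one_pos, one_lt_two⟩
  have hη : ContDiff ℝ ∞ η := η.contDiff
  obtain ⟨C, hC⟩ := (η.hasCompactSupport.fderiv (𝕜 := ℝ)).exists_bound_of_continuous
    (hη.continuous_fderiv (by simp))
  have hC_nonneg : 0 ≤ C := (norm_nonneg _).trans (hC 0)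
  refine ⟨2 * C, by positivity, fun R hR => ⟨fun x => η (R⁻¹ • x) ^ 2, ?_⟩⟩
  have hscale : ContDiff ℝ ∞ fun x : E3 => η (R⁻¹ • x) := hη.comp (contDiff_const_smul _)
  have hnorm : ∀ x : E3, ‖R⁻¹ • x‖ = ‖x‖ / R := fun x => by
    rw [norm_smul, norm_inv, Real.norm_of_nonneg hR.le, inv_mul_eq_div]
  refine ⟨hscale.pow 2, fun x => sq_nonneg _, fun x => pow_le_one₀ η.nonneg η.le_one,
    fun x hx => ?_, fun x hx => ?_, fun i x => ?_⟩
  · rw [η.one_of_mem_closedBall, one_pow]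
    rw [mem_closedBall_zero_iff, hnorm]
    exact (div_le_one hR).2 hx
  · rw [η.zero_of_le_dist, zero_pow two_ne_zero]
    rw [dist_zero_right, hnorm]
    exact (le_div_iff₀ hR).2 hx
  · have hgrad : ‖fderiv ℝ (fun x : E3 => η (R⁻¹ • x)) x‖ ≤ C / R := by
      rw [fderiv_comp_smul, norm_smul, norm_inv, Real.norm_of_nonneg hR.le, inv_mul_eq_div]
      exact div_le_div_of_nonneg_right (hC _) hR.le
    rw [mul_div_assoc]
    exact sq_fderiv_sq_apply_le (hscale.differentiable (by simp) x) hgrad (by simp [basisVec])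

/-! ### Localized energies -/

section SpatialCutoff

variable {χ : E3 → ℝ}

theorem hasBoundedSpatialSupport_cutoff_smul (hχ : HasCompactSupport χ) (f : ℝ × E3 → F) :
    HasBoundedSpatialSupport fun z => χ z.2 • f z := by
  obtain ⟨R, hR⟩ := hasBoundedSpatialSupport_spatial hχ
  exact ⟨R, fun z hz hzR => by simp only [hR z hz hzR, zero_smul]⟩

theorem contDiffOn_cutoff_smul (hχ : ContDiff ℝ ∞ χ) {f : ℝ × E3 → F}
    (hf : ContDiffOn ℝ ∞ f closedHalfSpace) :
    ContDiffOn ℝ ∞ (fun z => χ z.2 • f z) closedHalfSpace :=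
  (contDiffOn_spatial hχ).smul hf

theorem dirDeriv_timeDir_cutoff_smul (hχ : ContDiff ℝ ∞ χ) {f : ℝ × E3 → F}
    (hf : ContDiffOn ℝ ∞ f closedHalfSpace) {z : ℝ × E3} (hz : z ∈ closedHalfSpace) :
    ∂ₜ (fun z => χ z.2 • f z) z = χ z.2 • ∂ₜ f z := by
  rw [dirDeriv_smul (contDiffOn_spatial hχ) hf _ hz, dirDeriv_spatial hχ _ hz]
  simp [timeDir]

theorem dirDeriv_spaceDir_cutoff_smul (hχ : ContDiff ℝ ∞ χ) {f : ℝ × E3 → F}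
    (hf : ContDiffOn ℝ ∞ f closedHalfSpace) (i : Fin 3) {z : ℝ × E3} (hz : z ∈ closedHalfSpace) :
    ∂ₓ[i] (fun z => χ z.2 • f z) z = χ z.2 • ∂ₓ[i] f z + fderiv ℝ χ z.2 (basisVec i) • f z := by
  rw [dirDeriv_smul (contDiffOn_spatial hχ) hf _ hz, dirDeriv_spatial hχ _ hz]
  rfl

end SpatialCutoff

section IsCutoff

variable {L R : ℝ} {χ : E3 → ℝ}

theorem IsCutoff.norm_le_of_ne_zero (hχ : IsCutoff L R χ) {x : E3} (hx : χ x ≠ 0) :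
    ‖x‖ ≤ 2 * R :=
  le_of_not_gt fun h => hx (hχ.eq_zero x h.le)

theorem IsCutoff.hasCompactSupport (hχ : IsCutoff L R χ) : HasCompactSupport χ :=
  HasCompactSupport.intro (isCompact_closedBall (0 : E3) (2 * R)) fun x hx =>
    hχ.eq_zero x (by simpa using hx : 2 * R < ‖x‖).le

theorem IsCutoff.fderiv_eq_zero (hχ : IsCutoff L R χ) {x : E3} (hx : χ x = 0) (i : Fin 3) :
    fderiv ℝ χ x (basisVec i) = 0 := by
  have hle := hχ.sq_fderiv_le i x
  rw [hx, mul_zero] at hle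
  exact pow_eq_zero_iff two_ne_zero |>.1 (le_antisymm hle (sq_nonneg _))

end IsCutoff

/-- Square integrability on every cylinder `(0,S) × {|x| ≤ R}`. -/
def CylinderSqIntegrable (f : ℝ × E3 → E3) : Prop :=
  ∀ S R : ℝ, MemLp f 2 (volume.restrict (cylinder S R))

theorem CylinderSqIntegrable.sub {f g : ℝ × E3 → E3} (hf : CylinderSqIntegrable f)
    (hg : CylinderSqIntegrable g) : CylinderSqIntegrable fun z => f z - g z :=
  fun S R => (hf S R).sub (hg S R)

theorem cylinderSqIntegrable_of_continuousOn {f : ℝ × E3 → E3}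
    (hf : ContinuousOn f closedHalfSpace) : CylinderSqIntegrable f := fun S R =>
  (memLp_two_iff_integrable_sq_norm ((aestronglyMeasurable_slab_of_continuousOn hf S).mono_measure
    (Measure.restrict_mono (cylinder_subset_slab S R) le_rfl))).2
      (cylinderIntegrable_of_continuousOn (hf.norm.pow 2) S R)

theorem CylinderSqIntegrable.cylinderIntegrable_sq {f : ℝ × E3 → E3}
    (hf : CylinderSqIntegrable f) : CylinderIntegrable fun z => ‖f z‖ ^ 2 :=
  fun S R => (memLp_two_iff_integrable_sq_norm (hf S R).1).1 (hf S R)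

theorem CylinderIntegrable.integrableOn_cutoff_mul {f : ℝ × E3 → ℝ} (hf : CylinderIntegrable f)
    {χ : E3 → ℝ} (hχ : Continuous χ) (hχc : HasCompactSupport χ) (S : ℝ) :
    IntegrableOn (fun z => χ z.2 * f z) (slab S) :=
  hf.integrableOn_slab_of_norm_le (hasBoundedSpatialSupport_spatial hχc)
    (hχ.comp continuous_snd).continuousOn
    ((hχ.comp continuous_snd).aestronglyMeasurable.mul (hf.aestronglyMeasurable S))
    fun _ => norm_mul_le _ _

/-- The energy `∫ χ |∇m₀|²` of `m₀`, localized by `χ`. -/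
def initialEnergy (χ : E3 → ℝ) (m₀ : E3 → E3) : ℝ :=
  ∑ i, ∫ x, χ x * ‖fderiv ℝ m₀ x (basisVec i)‖ ^ 2

/-- The energy `∫ χ(x) |V(S, x)|² dx`, localized by `χ`, of the time slice at time `S` of a
gradient field `V = (V₁, V₂, V₃)`. -/
def sliceEnergy (χ : E3 → ℝ) (V : Fin 3 → ℝ × E3 → E3) (S : ℝ) : ℝ :=
  ∑ i, ∫ x, χ x * ‖V i (S, x)‖ ^ 2

/-- The space-time density of the variation of `∫ χ ∇u · ∇V`, for a smooth `u` and for `V` with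
weak derivatives `Vt` and `Vx`. -/
def crossDensity (χ : E3 → ℝ) (u Vt : ℝ × E3 → E3) (Vx : Fin 3 → ℝ × E3 → E3) (z : ℝ × E3) : ℝ :=
  ∑ i, (χ z.2 * inner ℝ (∂ₓ[i] (∂ₜ u) z) (Vx i z) - (χ z.2 * inner ℝ (∂ₓ[i] (∂ₓ[i] u) z) (Vt z) +
    fderiv ℝ χ z.2 (basisVec i) * inner ℝ (∂ₓ[i] u z) (Vt z)))

/-- The space-time density of the variation of `∫ χ |∇u|²` along a smooth solution `u`. -/
def energyFlux (χ : E3 → ℝ) (u : ℝ × E3 → E3) (z : ℝ × E3) : ℝ :=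
  -(χ z.2 * ‖∂ₜ u z‖ ^ 2) - 2 * ∑ i, fderiv ℝ χ z.2 (basisVec i) * inner ℝ (∂ₓ[i] u z) (∂ₜ u z)

theorem slab_subset_slab {S T : ℝ} (h : S ≤ T) : slab S ⊆ slab T :=
  prod_mono (Ioo_subset_Ioo_right h) subset_rfl

section EnergyVariation

variable {T M : ℝ} {χ : E3 → ℝ} {m₀ : E3 → E3} {u V Vt : ℝ × E3 → E3} {Vx : Fin 3 → ℝ × E3 → E3}

theorem dirDeriv_spaceDir_initial (hu : ContDiffOn ℝ ∞ u closedHalfSpace)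
    (hinit : ∀ x, u (0, x) = m₀ x) (i : Fin 3) (x : E3) :
    ∂ₓ[i] u (0, x) = fderiv ℝ m₀ x (basisVec i) := by
  rw [← fderiv_space_apply hu le_rfl]
  simp_rw [hinit]

theorem crossDensity_eq (hχ : ContDiff ℝ ∞ χ) (hu : ContDiffOn ℝ ∞ u closedHalfSpace) {S : ℝ}
    {z : ℝ × E3} (hz : z ∈ slab S) :
    crossDensity χ u Vt Vx z = ∑ i, (inner ℝ (∂ₜ (fun z => χ z.2 • ∂ₓ[i] u z) z) (Vx i z) -
      inner ℝ (∂ₓ[i] (fun z => χ z.2 • ∂ₓ[i] u z) z) (Vt z)) := by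
  have hzc := slab_subset_closedHalfSpace S hz
  refine Finset.sum_congr rfl fun i _ => ?_
  have hux := contDiffOn_dirDeriv hu (spaceDir i)
  rw [dirDeriv_timeDir_cutoff_smul hχ hux hzc, dirDeriv_spaceDir_cutoff_smul hχ hux i hzc,
    dirDeriv_comm hu timeDir (spaceDir i) (slab_subset_halfSpace S hz)]
  simp only [inner_add_left, real_inner_smul_left]

theorem integrableOn_inner_dirDeriv_cutoff (hχ : ContDiff ℝ ∞ χ) (hχc : HasCompactSupport χ)
    {f V : ℝ × E3 → E3} (hf : ContDiffOn ℝ ∞ f closedHalfSpace) (hV : CylinderIntegrable V)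
    (v : ℝ × E3) (S : ℝ) :
    IntegrableOn (fun z => (inner ℝ (dirDeriv v (fun z => χ z.2 • f z) z) (V z) : ℝ)) (slab S) :=
  hV.integrableOn_inner ((hasBoundedSpatialSupport_cutoff_smul hχc f).dirDeriv v)
    (contDiffOn_dirDeriv (contDiffOn_cutoff_smul hχ hf) v).continuousOn S

theorem integrableOn_crossDensity_summand (hχ : ContDiff ℝ ∞ χ) (hχc : HasCompactSupport χ)
    (hu : ContDiffOn ℝ ∞ u closedHalfSpace) (hVt : CylinderIntegrable Vt)
    (hVx : ∀ i, CylinderIntegrable (Vx i)) (S : ℝ) (i : Fin 3) :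
    IntegrableOn (fun z => inner ℝ (∂ₜ (fun z => χ z.2 • ∂ₓ[i] u z) z) (Vx i z) -
      inner ℝ (∂ₓ[i] (fun z => χ z.2 • ∂ₓ[i] u z) z) (Vt z)) (slab S) :=
  have hux := contDiffOn_dirDeriv hu (spaceDir i)
  (integrableOn_inner_dirDeriv_cutoff hχ hχc hux (hVx i) timeDir S).sub
    (integrableOn_inner_dirDeriv_cutoff hχ hχc hux hVt (spaceDir i) S)

theorem integrableOn_crossDensity (hχ : ContDiff ℝ ∞ χ) (hχc : HasCompactSupport χ)
    (hu : ContDiffOn ℝ ∞ u closedHalfSpace) (hVt : CylinderIntegrable Vt)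
    (hVx : ∀ i, CylinderIntegrable (Vx i)) (S : ℝ) :
    IntegrableOn (crossDensity χ u Vt Vx) (slab S) :=
  IntegrableOn.congr_fun (integrable_finsetSum _ fun i _ =>
    integrableOn_crossDensity_summand hχ hχc hu hVt hVx S i)
    (fun _ hz => (crossDensity_eq hχ hu hz).symm) (measurableSet_slab S)

theorem IsEvolution.cross_energy_identity (h : IsEvolution m₀ V Vt Vx) (hm₀ : ContDiff ℝ ∞ m₀)
    (hχ : ContDiff ℝ ∞ χ) (hχc : HasCompactSupport χ) (hu : ContDiffOn ℝ ∞ u closedHalfSpace)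
    (hinit : ∀ x, u (0, x) = m₀ x) :
    ∀ᵐ S ∂(volume.restrict (Ioi (0 : ℝ))),
      ∑ i, ∫ x, χ x * inner ℝ (∂ₓ[i] u (S, x)) (Vx i (S, x)) =
        initialEnergy χ m₀ + ∫ z in slab S, crossDensity χ u Vt Vx z := by
  have hux := fun i => contDiffOn_dirDeriv hu (spaceDir i)
  filter_upwards [ae_all_iff.2 fun i => h.integral_slice_dx hm₀ i
    (contDiffOn_cutoff_smul hχ (hux i)) (hasBoundedSpatialSupport_cutoff_smul hχc (∂ₓ[i] u))]
    with S hS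
  rw [setIntegral_congr_fun (measurableSet_slab S) fun z hz => crossDensity_eq hχ hu hz,
    integral_finsetSum _ fun i _ => integrableOn_crossDensity_summand hχ hχc hu
      h.cylinderIntegrable_dt h.cylinderIntegrable_dx S i, initialEnergy,
    ← Finset.sum_add_distrib]
  refine Finset.sum_congr rfl fun i _ => ?_
  have hSi := hS i
  simp only [real_inner_smul_left, dirDeriv_spaceDir_initial hu hinit,
    real_inner_self_eq_norm_sq] at hSi
  exact hSi

theorem integral_slice_cutoff_mul_sq_dx (hχ : ContDiff ℝ ∞ χ) (hχc : HasCompactSupport χ)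
    (hu : ContDiffOn ℝ ∞ u closedHalfSpace) (i : Fin 3) {S : ℝ} (hS : 0 ≤ S) :
    ∫ x, χ x * ‖∂ₓ[i] u (S, x)‖ ^ 2 = (∫ x, χ x * ‖∂ₓ[i] u (0, x)‖ ^ 2) -
      2 * ∫ z in slab S, inner ℝ (∂ₓ[i] (fun z => χ z.2 • ∂ₓ[i] u z) z) (∂ₜ u z) := by
  have hut := contDiffOn_dirDeriv hu timeDir
  have hux := contDiffOn_dirDeriv hu (spaceDir i)
  have hG := contDiffOn_cutoff_smul hχ hux
  have hG_supp := hasBoundedSpatialSupport_cutoff_smul hχc (∂ₓ[i] u)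
  have hparts := (isWeakDeriv_dirDeriv hut (spaceDir i)).integral_slab_space
    (cylinderIntegrable_of_continuousOn hut.continuousOn) (cylinderIntegrable_of_continuousOn
      (contDiffOn_dirDeriv hut (spaceDir i)).continuousOn) hG hG_supp S
  have hslice := integral_slice_eq_add_integral_slab (hG.inner ℝ hux) (hG_supp.inner (∂ₓ[i] u)) hS
  simp only [real_inner_smul_left, real_inner_self_eq_norm_sq] at hslice
  rw [hslice, hparts, mul_neg, sub_neg_eq_add, ← integral_const_mul]
  refine congrArg _ (setIntegral_congr_fun (measurableSet_slab S) fun z hz => ?_)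
  have hzc := slab_subset_closedHalfSpace S hz
  have hdt : ∂ₜ (fun z => (inner ℝ (χ z.2 • ∂ₓ[i] u z) (∂ₓ[i] u z) : ℝ)) z = _ :=
    dirDeriv_inner hG hux timeDir hzc
  simp only [real_inner_smul_left, real_inner_self_eq_norm_sq] at hdt ⊢
  rw [hdt, dirDeriv_timeDir_cutoff_smul hχ hux hzc,
    dirDeriv_comm hu timeDir (spaceDir i) (slab_subset_halfSpace S hz), real_inner_smul_left,
    real_inner_comm (∂ₓ[i] u z)]
  ring

theorem IsTruncatedSolution.energyFlux_eq (hu : IsTruncatedSolution T M m₀ u)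
    (hχ : ContDiff ℝ ∞ χ) {z : ℝ × E3} (hz : z ∈ slab T) :
    energyFlux χ u z =
      ∑ i, -2 * inner ℝ (∂ₓ[i] (fun z => χ z.2 • ∂ₓ[i] u z) z) (∂ₜ u z) := by
  have hpair : 2 * ∑ i, inner ℝ (∂ₓ[i] (∂ₓ[i] u) z) (∂ₜ u z) = ‖∂ₜ u z‖ ^ 2 := by
    have heq := congrArg (fun b => (inner ℝ b (∂ₜ u z) : ℝ)) (hu.equation z hz)
    simpa only [inner_sub_left, real_inner_smul_left, hu.orthogonal_dt z hz, sum_inner,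
      real_inner_self_eq_norm_sq, inner_wedge_self, mul_zero, sub_zero] using heq
  simp only [dirDeriv_spaceDir_cutoff_smul hχ (contDiffOn_dirDeriv hu.smooth (spaceDir _)) _
    (slab_subset_closedHalfSpace T hz), inner_add_left, real_inner_smul_left, mul_add,
    Finset.sum_add_distrib, ← Finset.mul_sum, energyFlux]
  linear_combination χ z.2 * hpair

theorem IsTruncatedSolution.integrableOn_energyFlux (hu : IsTruncatedSolution T M m₀ u)
    (hχ : ContDiff ℝ ∞ χ) (hχc : HasCompactSupport χ) :
    IntegrableOn (energyFlux χ u) (slab T) := by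
  refine IntegrableOn.congr_fun (integrable_finsetSum _ fun i _ => ?_)
    (fun z hz => (hu.energyFlux_eq hχ hz).symm) (measurableSet_slab T)
  exact (integrableOn_inner_dirDeriv_cutoff hχ hχc (contDiffOn_dirDeriv hu.smooth (spaceDir i))
    (cylinderIntegrable_of_continuousOn (contDiffOn_dirDeriv hu.smooth timeDir).continuousOn)
    (spaceDir i) T).const_mul (-2)

theorem IsTruncatedSolution.mono (hu : IsTruncatedSolution T M m₀ u) {S : ℝ} (hS : S ≤ T) :
    IsTruncatedSolution S M m₀ u where
  smooth := hu.smooth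
  vanish := hu.vanish
  initial := hu.initial
  norm_eq_one z hz := hu.norm_eq_one z (slab_subset_slab hS hz)
  orthogonal_dt z hz := hu.orthogonal_dt z (slab_subset_slab hS hz)
  equation z hz := hu.equation z (slab_subset_slab hS hz)
  bounded z hz := hu.bounded z (slab_subset_slab hS hz)

theorem IsTruncatedSolution.energy_identity (hu : IsTruncatedSolution T M m₀ u)
    (hχ : ContDiff ℝ ∞ χ) (hχc : HasCompactSupport χ) (hT : 0 ≤ T) :
    sliceEnergy χ (fun i => ∂ₓ[i] u) T =
      initialEnergy χ m₀ + ∫ z in slab T, energyFlux χ u z := by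
  have hux := fun i => contDiffOn_dirDeriv hu.smooth (spaceDir i)
  rw [setIntegral_congr_fun (measurableSet_slab T) fun z hz => hu.energyFlux_eq hχ hz,
    integral_finsetSum _ fun i _ => (integrableOn_inner_dirDeriv_cutoff hχ hχc (hux i)
      (cylinderIntegrable_of_continuousOn (contDiffOn_dirDeriv hu.smooth timeDir).continuousOn)
      (spaceDir i) T).const_mul (-2), initialEnergy, sliceEnergy, ← Finset.sum_add_distrib]
  refine Finset.sum_congr rfl fun i _ => ?_
  rw [integral_slice_cutoff_mul_sq_dx hχ hχc hu.smooth i hT, integral_const_mul]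
  simp only [dirDeriv_spaceDir_initial hu.smooth hu.initial]
  ring

end EnergyVariation

/-- The energy `∫ |∇m₀|²`. -/
def totalEnergy (m₀ : E3 → E3) : ℝ := ∑ i, ∫ x, ‖fderiv ℝ m₀ x (basisVec i)‖ ^ 2

/-- The squared norm `|Vt|² + |Vx|²` of a space-time gradient `(Vt, Vx)`. -/
def gradSq (Vt : ℝ × E3 → E3) (Vx : Fin 3 → ℝ × E3 → E3) (z : ℝ × E3) : ℝ :=
  ‖Vt z‖ ^ 2 + ∑ i, ‖Vx i z‖ ^ 2

theorem sum_sq_norm_nonneg (w : Fin 3 → E3) : 0 ≤ ∑ i, ‖w i‖ ^ 2 :=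
  Finset.sum_nonneg fun _ _ => sq_nonneg _

theorem sum_sq_norm_le {M : ℝ} {w : Fin 3 → E3} (hw : ∀ i, ‖w i‖ ≤ M) :
    ∑ i, ‖w i‖ ^ 2 ≤ 3 * M ^ 2 := by
  simpa using Finset.sum_le_card_nsmul Finset.univ (fun i => ‖w i‖ ^ 2) (M ^ 2)
    fun i _ => pow_le_pow_left₀ (norm_nonneg _) (hw i) 2

theorem gradSq_nonneg (Vt : ℝ × E3 → E3) (Vx : Fin 3 → ℝ × E3 → E3) (z : ℝ × E3) :
    0 ≤ gradSq Vt Vx z :=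
  add_nonneg (sq_nonneg _) (sum_sq_norm_nonneg fun i => Vx i z)

theorem cylinder_mono {S S' R R' : ℝ} (hS : S ≤ S') (hR : R ≤ R') :
    cylinder S R ⊆ cylinder S' R' :=
  prod_mono (Ioo_subset_Ioo_right hS) (Metric.closedBall_subset_closedBall hR)

theorem measureReal_cylinder {S R : ℝ} (hS : 0 ≤ S) (hR : 0 ≤ R) :
    volume.real (cylinder S R) = S * volume.real (Metric.ball (0 : E3) 1) * R ^ 3 := by
  rw [cylinder, Measure.volume_eq_prod, measureReal_prod_prod, Real.volume_real_Ioo_of_le hS,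
    Measure.addHaar_real_closedBall _ _ hR, finrank_euclideanSpace_fin]
  ring

section CutoffIntegrals

variable {L R S : ℝ} {χ : E3 → ℝ} {m₀ : E3 → E3} {f g k : ℝ × E3 → ℝ}

theorem sliceEnergy_nonneg (hχ : ∀ x, 0 ≤ χ x) (V : Fin 3 → ℝ × E3 → E3) (S : ℝ) :
    0 ≤ sliceEnergy χ V S :=
  Finset.sum_nonneg fun _ _ => integral_nonneg fun x => mul_nonneg (hχ x) (sq_nonneg _)

theorem totalEnergy_nonneg (m₀ : E3 → E3) : 0 ≤ totalEnergy m₀ :=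
  Finset.sum_nonneg fun _ _ => integral_nonneg fun _ => sq_nonneg _

theorem IsCutoff.initialEnergy_le (hχ : IsCutoff L R χ)
    (hm₀ : ∀ i, MemLp (fun x => fderiv ℝ m₀ x (basisVec i)) 2 volume) :
    initialEnergy χ m₀ ≤ totalEnergy m₀ :=
  Finset.sum_le_sum fun i _ => integral_mono_of_nonneg
    (Eventually.of_forall fun x => mul_nonneg (hχ.nonneg x) (sq_nonneg _))
    ((memLp_two_iff_integrable_sq_norm (hm₀ i).1).1 (hm₀ i))
    (Eventually.of_forall fun x => mul_le_of_le_one_left (sq_nonneg _) (hχ.le_one x))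

theorem IsCutoff.integrableOn_mul (hχ : IsCutoff L R χ) (hf : CylinderIntegrable f) (S : ℝ) :
    IntegrableOn (fun z => χ z.2 * f z) (slab S) :=
  hf.integrableOn_cutoff_mul hχ.smooth.continuous hχ.hasCompactSupport S

theorem IsCutoff.integral_cylinder_le (hχ : IsCutoff L R χ) (hf : CylinderIntegrable f)
    (hf_nonneg : ∀ z, 0 ≤ f z) (S : ℝ) :
    ∫ z in cylinder S R, f z ≤ ∫ z in slab S, χ z.2 * f z :=
  calc ∫ z in cylinder S R, f z
      = ∫ z in cylinder S R, χ z.2 * f z := setIntegral_congr_fun (measurableSet_cylinder S R)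
        fun z hz => by simp only [hχ.eq_one z.2 (mem_closedBall_zero_iff.1 hz.2), one_mul]
    _ ≤ ∫ z in slab S, χ z.2 * f z := setIntegral_mono_set (hχ.integrableOn_mul hf S)
        (Eventually.of_forall fun z => mul_nonneg (hχ.nonneg z.2) (hf_nonneg z))
        (cylinder_subset_slab S R).eventuallyLE

theorem IsCutoff.integral_le_add_integral_cylinder (hχ : IsCutoff L R χ)
    (hf : IntegrableOn f (slab S)) (hg : IntegrableOn g (slab S)) (hk : CylinderIntegrable k)
    (hk_nonneg : ∀ z, 0 ≤ k z) (hle_of_zero : ∀ z ∈ slab S, χ z.2 = 0 → f z ≤ g z)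
    (hle : ∀ᵐ z ∂(volume.restrict (slab S)), f z ≤ g z + k z) :
    ∫ z in slab S, f z ≤ (∫ z in slab S, g z) + ∫ z in cylinder S (2 * R), k z := by
  have hk_int : IntegrableOn ((cylinder S (2 * R)).indicator k) (slab S) :=
    ((hk S (2 * R)).integrable_indicator (measurableSet_cylinder S _)).integrableOn
  calc ∫ z in slab S, f z ≤ ∫ z in slab S, (g z + (cylinder S (2 * R)).indicator k z) := by
        refine integral_mono_ae hf (hg.add hk_int) ?_
        filter_upwards [hle, ae_restrict_mem (measurableSet_slab S)] with z hz hzS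
        by_cases hχz : χ z.2 = 0
        · exact le_add_of_le_of_nonneg (hle_of_zero z hzS hχz)
            (indicator_nonneg (fun z _ => hk_nonneg z) z)
        · have hz_mem : z ∈ cylinder S (2 * R) :=
            mem_cylinder.2 ⟨hzS, hχ.norm_le_of_ne_zero hχz⟩
          rwa [indicator_of_mem hz_mem]
    _ = _ := by
        rw [integral_add hg hk_int, setIntegral_indicator (measurableSet_cylinder S _),
          inter_eq_right.2 (cylinder_subset_slab S _)]

end CutoffIntegrals

theorem two_mul_abs_mul_le {a c l x y p : ℝ} (hc : 0 ≤ c) (ha : a ^ 2 ≤ l ^ 2 * c)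
    (hp : |p| ≤ x * y) : 2 * |a * p| ≤ c * y ^ 2 / 6 + 6 * l ^ 2 * x ^ 2 := by
  have hp_sq : p ^ 2 ≤ (x * y) ^ 2 := sq_le_sq' (abs_le.1 hp).1 (abs_le.1 hp).2
  have hap_sq : a ^ 2 * p ^ 2 ≤ (l ^ 2 * c) * (x * y) ^ 2 := by gcongr
  refine le_of_sq_le_sq ?_ (by positivity)
  rw [mul_pow, sq_abs]
  linarith [sq_nonneg (c * y ^ 2 / 6 - 6 * l ^ 2 * x ^ 2)]

theorem IsCutoff.energyFlux_le {L R : ℝ} {χ : E3 → ℝ} (hχ : IsCutoff L R χ) (u : ℝ × E3 → E3)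
    (z : ℝ × E3) :
    energyFlux χ u z ≤
      -(1 / 2) * (χ z.2 * ‖∂ₜ u z‖ ^ 2) + 6 * (L / R) ^ 2 * ∑ i, ‖∂ₓ[i] u z‖ ^ 2 := by
  have hcross := Finset.sum_le_sum fun i (_ : i ∈ Finset.univ) =>
    (mul_le_mul_of_nonneg_left (neg_le_abs _) zero_le_two).trans
      (two_mul_abs_mul_le (hχ.nonneg z.2) (hχ.sq_fderiv_le i z.2)
        (abs_real_inner_le_norm (∂ₓ[i] u z) (∂ₜ u z)))
  rw [← Finset.mul_sum, Finset.sum_neg_distrib, Finset.sum_add_distrib, Finset.sum_const,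
    Finset.card_univ, Fintype.card_fin, nsmul_eq_mul, ← Finset.mul_sum] at hcross
  rw [energyFlux]
  push_cast at hcross
  linarith

theorem exists_bound_of_le_add_div_sq_mul {f : ℝ → ℝ} {a b c : ℝ} (ha : 0 ≤ a) (hb : 0 ≤ b)
    (hc : 0 ≤ c) (hgrowth : ∀ R, 0 ≤ R → f R ≤ c * R ^ 3)
    (hstep : ∀ R, 0 < R → f R ≤ a + b / R ^ 2 * f (2 * R)) :
    ∃ C, ∀ R, 1 ≤ R → f R ≤ C := by
  have hlinear : ∀ R, 1 ≤ R → f R ≤ (a + 8 * b * c) * R := fun R hR => by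
    have hR0 : 0 < R := one_pos.trans_le hR
    calc f R ≤ a + b / R ^ 2 * f (2 * R) := hstep R hR0
      _ ≤ a + b / R ^ 2 * (c * (2 * R) ^ 3) := by gcongr; exact hgrowth _ (by positivity)
      _ = a + 8 * b * c * R := by field_simp; ring
      _ ≤ a * R + 8 * b * c * R := by gcongr; exact le_mul_of_one_le_right ha hR
      _ = (a + 8 * b * c) * R := by ring
  refine ⟨a + 2 * b * (a + 8 * b * c), fun R hR => ?_⟩
  have hR0 : 0 < R := one_pos.trans_le hR
  calc f R ≤ a + b / R ^ 2 * f (2 * R) := hstep R hR0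
    _ ≤ a + b / R ^ 2 * ((a + 8 * b * c) * (2 * R)) := by
        gcongr; exact hlinear _ (by linarith)
    _ = a + 2 * b * (a + 8 * b * c) / R := by field_simp
    _ ≤ a + 2 * b * (a + 8 * b * c) := by gcongr; exact div_le_self (by positivity) hR

section EnergyBound

variable {L R S T M : ℝ} {χ : E3 → ℝ} {m₀ : E3 → E3} {u : ℝ × E3 → E3}

theorem IsTruncatedSolution.cylinderIntegrable_sq_dirDeriv (hu : IsTruncatedSolution T M m₀ u)
    (v : ℝ × E3) : CylinderIntegrable fun z => ‖dirDeriv v u z‖ ^ 2 :=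
  cylinderIntegrable_of_continuousOn ((contDiffOn_dirDeriv hu.smooth v).continuousOn.norm.pow 2)

theorem IsTruncatedSolution.cylinderIntegrable_sum_sq_dx (hu : IsTruncatedSolution T M m₀ u) :
    CylinderIntegrable fun z => ∑ i, ‖∂ₓ[i] u z‖ ^ 2 := fun S R =>
  integrable_finsetSum _ fun i _ => hu.cylinderIntegrable_sq_dirDeriv (spaceDir i) S R

theorem IsTruncatedSolution.energy_le (hu : IsTruncatedSolution T M m₀ u) (hT : 0 ≤ T)
    (hm₀ : ∀ i, MemLp (fun x => fderiv ℝ m₀ x (basisVec i)) 2 volume) (hχ : IsCutoff L R χ) :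
    sliceEnergy χ (fun i => ∂ₓ[i] u) T + 1 / 2 * ∫ z in slab T, χ z.2 * ‖∂ₜ u z‖ ^ 2 ≤
      totalEnergy m₀ + 6 * (L / R) ^ 2 * ∫ z in cylinder T (2 * R), ∑ i, ‖∂ₓ[i] u z‖ ^ 2 := by
  have hflux := hχ.integral_le_add_integral_cylinder
    (hu.integrableOn_energyFlux hχ.smooth hχ.hasCompactSupport)
    ((hχ.integrableOn_mul (hu.cylinderIntegrable_sq_dirDeriv timeDir) T).const_mul (-(1 / 2)))
    (fun S R' => (hu.cylinderIntegrable_sum_sq_dx S R').const_mul (6 * (L / R) ^ 2))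
    (fun z => mul_nonneg (by positivity) (sum_sq_norm_nonneg fun i => ∂ₓ[i] u z))
    (fun z _ hz => by simp [energyFlux, hz, hχ.fderiv_eq_zero hz])
    (Eventually.of_forall (hχ.energyFlux_le u))
  rw [integral_const_mul, integral_const_mul] at hflux
  rw [hu.energy_identity hχ.smooth hχ.hasCompactSupport hT]
  linarith [hχ.initialEnergy_le hm₀]

theorem IsTruncatedSolution.integral_cylinder_dx_mono (hu : IsTruncatedSolution T M m₀ u)
    (hS : S ≤ T) (R : ℝ) :
    ∫ z in cylinder S R, ∑ i, ‖∂ₓ[i] u z‖ ^ 2 ≤ ∫ z in cylinder T R, ∑ i, ‖∂ₓ[i] u z‖ ^ 2 :=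
  setIntegral_mono_set (hu.cylinderIntegrable_sum_sq_dx T R)
    (Eventually.of_forall fun z => sum_sq_norm_nonneg fun i => ∂ₓ[i] u z)
    (cylinder_mono hS le_rfl).eventuallyLE

theorem IsTruncatedSolution.integral_cutoff_eq_integral_sliceEnergy
    (hu : IsTruncatedSolution T M m₀ u) (hχ : IsCutoff L R χ) :
    IntegrableOn (sliceEnergy χ fun i => ∂ₓ[i] u) (Ioo 0 T) ∧
      ∫ z in slab T, χ z.2 * ∑ i, ‖∂ₓ[i] u z‖ ^ 2 =
        ∫ S in Ioo 0 T, sliceEnergy χ (fun i => ∂ₓ[i] u) S := by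
  have hint := fun i => hχ.integrableOn_mul (hu.cylinderIntegrable_sq_dirDeriv (spaceDir i)) T
  simp only [Finset.mul_sum]
  refine ⟨integrable_finsetSum _ fun i _ => integrableOn_integral_slab (hint i), ?_⟩
  rw [integral_finsetSum _ fun i _ => hint i]
  simp only [sliceEnergy]
  rw [integral_finsetSum _ fun i _ => integrableOn_integral_slab (hint i)]
  exact Finset.sum_congr rfl fun i _ => integral_slab (hint i)

theorem IsTruncatedSolution.integral_cylinder_dx_le (hu : IsTruncatedSolution T M m₀ u) (hT : 0 ≤ T)
    (hm₀ : ∀ i, MemLp (fun x => fderiv ℝ m₀ x (basisVec i)) 2 volume) (hχ : IsCutoff L R χ) :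
    ∫ z in cylinder T R, ∑ i, ‖∂ₓ[i] u z‖ ^ 2 ≤ T * (totalEnergy m₀ +
      6 * (L / R) ^ 2 * ∫ z in cylinder T (2 * R), ∑ i, ‖∂ₓ[i] u z‖ ^ 2) := by
  obtain ⟨hint, hslice⟩ := hu.integral_cutoff_eq_integral_sliceEnergy hχ
  calc ∫ z in cylinder T R, ∑ i, ‖∂ₓ[i] u z‖ ^ 2
      ≤ ∫ z in slab T, χ z.2 * ∑ i, ‖∂ₓ[i] u z‖ ^ 2 :=
        hχ.integral_cylinder_le hu.cylinderIntegrable_sum_sq_dx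
          (fun z => sum_sq_norm_nonneg fun i => ∂ₓ[i] u z) T
    _ = ∫ S in Ioo 0 T, sliceEnergy χ (fun i => ∂ₓ[i] u) S := hslice
    _ ≤ ∫ _S in Ioo 0 T, (totalEnergy m₀ +
          6 * (L / R) ^ 2 * ∫ z in cylinder T (2 * R), ∑ i, ‖∂ₓ[i] u z‖ ^ 2) := by
        refine setIntegral_mono_on hint (integrable_const _) measurableSet_Ioo fun S hS => ?_
        have henergy := (hu.mono hS.2.le).energy_le hS.1.le hm₀ hχ
        have hdissipation : 0 ≤ ∫ z in slab S, χ z.2 * ‖∂ₜ u z‖ ^ 2 :=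
          integral_nonneg fun z => mul_nonneg (hχ.nonneg _) (sq_nonneg _)
        have hmono := mul_le_mul_of_nonneg_left (hu.integral_cylinder_dx_mono hS.2.le (2 * R))
          (show 0 ≤ 6 * (L / R) ^ 2 by positivity)
        linarith
    _ = _ := by
        rw [setIntegral_const, smul_eq_mul, Real.volume_real_Ioo_of_le hT, sub_zero]

theorem IsTruncatedSolution.integral_cylinder_dx_le_mul_pow (hu : IsTruncatedSolution T M m₀ u)
    (hT : 0 ≤ T) (hR : 0 ≤ R) :
    ∫ z in cylinder T R, ∑ i, ‖∂ₓ[i] u z‖ ^ 2 ≤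
      3 * M ^ 2 * (T * volume.real (Metric.ball (0 : E3) 1)) * R ^ 3 := by
  have := isFiniteMeasure_restrict_cylinder T R
  calc ∫ z in cylinder T R, ∑ i, ‖∂ₓ[i] u z‖ ^ 2
      ≤ ∫ _z in cylinder T R, 3 * M ^ 2 := by
        refine setIntegral_mono_on (hu.cylinderIntegrable_sum_sq_dx T R) (integrable_const _)
          (measurableSet_cylinder T R) fun z hz => ?_
        exact sum_sq_norm_le (hu.bounded z (cylinder_subset_slab T R hz)).2
    _ = _ := by rw [setIntegral_const, smul_eq_mul, measureReal_cylinder hT hR]; ring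

theorem IsTruncatedSolution.exists_integral_cylinder_dx_le (hu : IsTruncatedSolution T M m₀ u)
    (hT : 0 ≤ T) (hm₀ : ∀ i, MemLp (fun x => fderiv ℝ m₀ x (basisVec i)) 2 volume) :
    ∃ C, ∀ R, 1 ≤ R → ∫ z in cylinder T R, ∑ i, ‖∂ₓ[i] u z‖ ^ 2 ≤ C := by
  obtain ⟨L, -, hL⟩ := exists_isCutoff
  refine exists_bound_of_le_add_div_sq_mul (mul_nonneg hT (totalEnergy_nonneg m₀))
    (show 0 ≤ T * (6 * L ^ 2) by positivity)
    (show 0 ≤ 3 * M ^ 2 * (T * volume.real (Metric.ball (0 : E3) 1)) by positivity)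
    (fun R hR => hu.integral_cylinder_dx_le_mul_pow hT hR) fun R hR => ?_
  obtain ⟨χ, hχ⟩ := hL R hR
  exact (hu.integral_cylinder_dx_le hT hm₀ hχ).trans_eq (by rw [div_pow]; ring)

theorem IsTruncatedSolution.exists_integral_cylinder_gradSq_le (hu : IsTruncatedSolution T M m₀ u)
    (hT : 0 ≤ T) (hm₀ : ∀ i, MemLp (fun x => fderiv ℝ m₀ x (basisVec i)) 2 volume) :
    ∃ B, ∀ R, 1 ≤ R → ∫ z in cylinder T R, gradSq (∂ₜ u) (fun i => ∂ₓ[i] u) z ≤ B := by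
  obtain ⟨L, hL_nonneg, hL⟩ := exists_isCutoff
  obtain ⟨C, hC⟩ := hu.exists_integral_cylinder_dx_le hT hm₀
  refine ⟨2 * (totalEnergy m₀ + 6 * L ^ 2 * C) + C, fun R hR => ?_⟩
  obtain ⟨χ, hχ⟩ := hL R (one_pos.trans_le hR)
  have hdt := hχ.integral_cylinder_le (hu.cylinderIntegrable_sq_dirDeriv timeDir)
    (fun _ => sq_nonneg _) T
  have herror : 6 * (L / R) ^ 2 * ∫ z in cylinder T (2 * R), ∑ i, ‖∂ₓ[i] u z‖ ^ 2 ≤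
      6 * L ^ 2 * C := by
    have hLR : L / R ≤ L := div_le_self hL_nonneg hR
    exact mul_le_mul (by gcongr) (hC (2 * R) (by linarith))
      (integral_nonneg fun z => sum_sq_norm_nonneg fun i => ∂ₓ[i] u z) (by positivity)
  simp only [gradSq]
  rw [integral_add (hu.cylinderIntegrable_sq_dirDeriv timeDir T R)
    (hu.cylinderIntegrable_sum_sq_dx T R)]
  linarith [hu.energy_le hT hm₀ hχ, hC R hR, sliceEnergy_nonneg hχ.nonneg (fun i => ∂ₓ[i] u) T]

end EnergyBound

/-! ### The relative energy estimate -/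

theorem cylinderSqIntegrable_of_memLp_slab {f : ℝ × E3 → E3}
    (hf : ∀ S, 0 < S → MemLp f 2 (volume.restrict (slab S))) : CylinderSqIntegrable f :=
  fun S R => (hf (max S 1) (by positivity)).mono_measure (Measure.restrict_mono
    ((cylinder_mono (le_max_left _ _) le_rfl).trans (cylinder_subset_slab _ R)) le_rfl)

theorem IsCutoff.enorm_mul_sq_le {L R : ℝ} {χ : E3 → ℝ} (hχ : IsCutoff L R χ) (x a : E3) :
    ‖χ x * ‖a‖ ^ 2‖ₑ ≤ ‖a‖ₑ ^ 2 := by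
  rw [Real.enorm_of_nonneg (mul_nonneg (hχ.nonneg x) (sq_nonneg _)), ← ofReal_norm a,
    ← ENNReal.ofReal_pow (norm_nonneg _)]
  exact ENNReal.ofReal_le_ofReal (mul_le_of_le_one_left (sq_nonneg _) (hχ.le_one x))

section WeakSolution

variable {L R T : ℝ} {χ : E3 → ℝ} {m₀ : E3 → E3} {v vt : ℝ × E3 → E3} {vx : Fin 3 → ℝ × E3 → E3}

theorem IsGlobalWeakSolution.cylinderSqIntegrable (hv : IsGlobalWeakSolution m₀ v vt vx) :
    CylinderSqIntegrable v := by
  intro S R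
  have hint := hv.cylinderIntegrable S R
  refine (memLp_two_iff_integrable_sq_norm hint.1).2 (hint.norm.congr ?_)
  filter_upwards [ae_restrict_of_ae_restrict_of_subset (cylinder_subset_slab S R) (hv.ae_norm S)]
    with z hz
  rw [hz, one_pow]

theorem IsGlobalWeakSolution.cylinderSqIntegrable_dt (hv : IsGlobalWeakSolution m₀ v vt vx) :
    CylinderSqIntegrable vt :=
  cylinderSqIntegrable_of_memLp_slab hv.memLp_dt

theorem IsGlobalWeakSolution.cylinderSqIntegrable_dx (hv : IsGlobalWeakSolution m₀ v vt vx)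
    (i : Fin 3) : CylinderSqIntegrable (vx i) :=
  cylinderSqIntegrable_of_memLp_slab fun _ hS => hv.memLp_dx hS i

theorem ofReal_totalEnergy (hm₀ : ∀ i, MemLp (fun x => fderiv ℝ m₀ x (basisVec i)) 2 volume) :
    ENNReal.ofReal (totalEnergy m₀) =
      ∫⁻ x : E3, ∑ i, ‖fderiv ℝ m₀ x (basisVec i)‖ₑ ^ 2 := by
  have hint := fun i => (memLp_two_iff_integrable_sq_norm (hm₀ i).1).1 (hm₀ i)
  rw [totalEnergy, ← integral_finsetSum _ fun i _ => hint i,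
    ofReal_integral_eq_lintegral_ofReal (integrable_finsetSum _ fun i _ => hint i)
      (Eventually.of_forall fun x => sum_sq_norm_nonneg _)]
  refine lintegral_congr fun x => ?_
  rw [ENNReal.ofReal_sum_of_nonneg fun i _ => sq_nonneg _]
  simp only [ENNReal.ofReal_pow (norm_nonneg _), ofReal_norm]

theorem EnergyInequality.sliceEnergy_add_le (h : EnergyInequality m₀ vt vx)
    (hm₀ : ∀ i, MemLp (fun x => fderiv ℝ m₀ x (basisVec i)) 2 volume)
    (hvt : CylinderSqIntegrable vt) (hvx : ∀ i, CylinderSqIntegrable (vx i))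
    (hχ : IsCutoff L R χ) :
    ∀ᵐ S ∂(volume.restrict (Ioo 0 T)),
      sliceEnergy χ vx S + ∫ z in slab S, χ z.2 * ‖vt z‖ ^ 2 ≤ totalEnergy m₀ := by
  filter_upwards [ae_restrict_of_ae_restrict_of_subset
      (Ioo_subset_Ioi_self.trans Ioi_subset_Ici_self) h, ae_all_iff.2 fun i =>
        ae_integrable_slice (hχ.integrableOn_mul (hvx i).cylinderIntegrable_sq T)]
    with S hS hslice
  have hdissipation_nonneg : 0 ≤ ∫ z in slab S, χ z.2 * ‖vt z‖ ^ 2 :=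
    integral_nonneg fun z => mul_nonneg (hχ.nonneg _) (sq_nonneg _)
  rw [← ofReal_totalEnergy hm₀] at hS
  rw [← ENNReal.ofReal_le_ofReal_iff (totalEnergy_nonneg m₀),
    ENNReal.ofReal_add (sliceEnergy_nonneg hχ.nonneg vx S) hdissipation_nonneg]
  refine le_trans (add_le_add ?_ ?_) hS
  · rw [← Real.enorm_of_nonneg (sliceEnergy_nonneg hχ.nonneg vx S), sliceEnergy,
      ← integral_finsetSum _ fun i _ => hslice i]
    refine (enorm_integral_le_lintegral_enorm _).trans (lintegral_mono fun x => ?_)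
    exact (enorm_sum_le _ _).trans (Finset.sum_le_sum fun i _ => hχ.enorm_mul_sq_le _ _)
  · rw [← Real.enorm_of_nonneg hdissipation_nonneg,
      integral_slab (hχ.integrableOn_mul hvt.cylinderIntegrable_sq S)]
    refine (enorm_integral_le_lintegral_enorm _).trans (lintegral_mono fun t => ?_)
    exact (enorm_integral_le_lintegral_enorm _).trans
      (lintegral_mono fun x => hχ.enorm_mul_sq_le _ _)

end WeakSolution

section PointwiseEstimates

theorem inner_wedge_sub (a b p q : E3) :
    -inner ℝ (wedge a p) q - inner ℝ (wedge b q) p =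
      -(inner ℝ (wedge (b - a) (q - p)) p : ℝ) := by
  simp only [inner_eq_sum, Fin.sum_univ_three, wedge_apply_zero, wedge_apply_one, wedge_apply_two,
    PiLp.sub_apply]
  ring

theorem sum_sq_norm_eq_add (a b : Fin 3 → E3) :
    ∑ i, ‖b i‖ ^ 2 =
      (∑ i, ‖a i‖ ^ 2) + ∑ i, (‖b i - a i‖ ^ 2 + 2 * inner ℝ (b i - a i) (a i)) := by
  rw [← Finset.sum_add_distrib]
  refine Finset.sum_congr rfl fun i _ => ?_
  conv_lhs => rw [← sub_add_cancel (b i) (a i), norm_add_sq_real]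
  ring

theorem two_mul_abs_inner_le (x y : E3) : 2 * |(inner ℝ x y : ℝ)| ≤ ‖x‖ ^ 2 + ‖y‖ ^ 2 := by
  linarith [abs_real_inner_le_norm x y, two_mul_le_add_sq ‖x‖ ‖y‖]

theorem neg_two_mul_mul_inner_le {w p d a : E3} {M : ℝ} (hw : ‖w‖ ≤ 2) (hp : ‖p‖ ≤ M)
    (ha : ‖a‖ ≤ M) :
    -2 * ((‖d‖ ^ 2 + 2 * inner ℝ d a) * inner ℝ w p) ≤
      (4 * M + 2 * M ^ 2) * ‖d‖ ^ 2 + 2 * M ^ 2 * ‖w‖ ^ 2 := by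
  have hM : 0 ≤ M := (norm_nonneg _).trans hp
  have hwp : |(inner ℝ w p : ℝ)| ≤ ‖w‖ * M := (abs_real_inner_le_norm _ _).trans (by gcongr)
  have hda : |(inner ℝ d a : ℝ)| ≤ ‖d‖ * M := (abs_real_inner_le_norm _ _).trans (by gcongr)
  calc -2 * ((‖d‖ ^ 2 + 2 * inner ℝ d a) * inner ℝ w p)
      ≤ 2 * (|‖d‖ ^ 2 + 2 * inner ℝ d a| * |inner ℝ w p|) := by
        rw [← abs_mul]
        linarith [neg_abs_le ((‖d‖ ^ 2 + 2 * inner ℝ d a) * (inner ℝ w p : ℝ))]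
    _ ≤ 2 * ((‖d‖ ^ 2 + 2 * (‖d‖ * M)) * (‖w‖ * M)) := by
        gcongr
        refine (abs_add_le _ _).trans ?_
        rw [abs_of_nonneg (sq_nonneg _), abs_mul, abs_two]
        gcongr
    _ = 2 * M * ‖d‖ ^ 2 * ‖w‖ + 2 * M ^ 2 * (2 * ‖d‖ * ‖w‖) := by ring
    _ ≤ 2 * M * ‖d‖ ^ 2 * 2 + 2 * M ^ 2 * (‖d‖ ^ 2 + ‖w‖ ^ 2) := by
        gcongr
        exact two_mul_le_add_sq _ _
    _ = _ := by ring

variable {a b p q D : E3} {ax bx : Fin 3 → E3} {M : ℝ}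

theorem neg_two_mul_sum_mul_inner_le {w : E3} {dx : Fin 3 → E3} (hw : ‖w‖ ≤ 2) (hp : ‖p‖ ≤ M)
    (hax : ∀ i, ‖ax i‖ ≤ M) :
    -2 * ((∑ i, (‖dx i‖ ^ 2 + 2 * inner ℝ (dx i) (ax i))) * inner ℝ w p) ≤
      (4 * M + 2 * M ^ 2) * (∑ i, ‖dx i‖ ^ 2) + 6 * M ^ 2 * ‖w‖ ^ 2 := by
  rw [Finset.sum_mul, Finset.mul_sum]
  refine (Finset.sum_le_sum fun i _ => neg_two_mul_mul_inner_le hw hp (hax i)).trans_eq ?_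
  rw [Finset.sum_add_distrib, ← Finset.mul_sum, Finset.sum_const, Finset.card_univ,
    Fintype.card_fin, nsmul_eq_mul]
  push_cast
  ring

-- The constraints `a · p = 0` and `b · q = 0` make every term at least quadratic in the
-- differences `b - a`, `q - p`, `bx - ax`.
theorem stability_identity (hap : inner ℝ a p = (0 : ℝ)) (hbq : inner ℝ b q = (0 : ℝ))
    (hD : (2 : ℝ) • D = p - wedge a p - (2 * ∑ i, ‖ax i‖ ^ 2) • a) :
    -‖p‖ ^ 2 - ‖q‖ ^ 2 + 2 * inner ℝ D q + inner ℝ (q - wedge b q) p -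
        2 * ((∑ i, ‖bx i‖ ^ 2) * inner ℝ b p) =
      -‖q - p‖ ^ 2 - inner ℝ (wedge (b - a) (q - p)) p +
        2 * ((∑ i, ‖ax i‖ ^ 2) * inner ℝ (b - a) (q - p)) -
        2 * ((∑ i, (‖bx i - ax i‖ ^ 2 + 2 * inner ℝ (bx i - ax i) (ax i))) *
          inner ℝ (b - a) p) := by
  have hDq : 2 * (inner ℝ D q : ℝ) =
      inner ℝ p q - inner ℝ (wedge a p) q - 2 * ((∑ i, ‖ax i‖ ^ 2) * inner ℝ a q) := by
    have h := congrArg (fun y => (inner ℝ y q : ℝ)) hD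
    simp only [inner_sub_left, real_inner_smul_left] at h
    linarith
  have haq : (inner ℝ a q : ℝ) = -inner ℝ (b - a) (q - p) - inner ℝ (b - a) p := by
    simp only [inner_sub_left, inner_sub_right, hap, hbq]
    ring
  have hbp : (inner ℝ b p : ℝ) = inner ℝ (b - a) p := by rw [inner_sub_left, hap, sub_zero]
  have hqp : ‖q - p‖ ^ 2 = ‖q‖ ^ 2 - 2 * inner ℝ p q + ‖p‖ ^ 2 := by
    rw [norm_sub_sq_real, real_inner_comm]
  rw [hDq, haq, hbp, hqp, sum_sq_norm_eq_add ax bx, inner_sub_left q, real_inner_comm p q]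
  linear_combination inner_wedge_sub a b p q

/-- The constant of the stability estimate for a smooth solution whose first derivatives are
bounded by `M`. -/
def stabilityConst (M : ℝ) : ℝ := 1 / 2 * (M + 6 * M ^ 2) ^ 2 + 8 * M ^ 2 + 4 * M

theorem stability_le (ha : ‖a‖ = 1) (hb : ‖b‖ = 1) (hap : inner ℝ a p = (0 : ℝ))
    (hbq : inner ℝ b q = (0 : ℝ)) (hp : ‖p‖ ≤ M) (hax : ∀ i, ‖ax i‖ ≤ M)
    (hD : (2 : ℝ) • D = p - wedge a p - (2 * ∑ i, ‖ax i‖ ^ 2) • a) :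
    -‖p‖ ^ 2 - ‖q‖ ^ 2 + 2 * inner ℝ D q + inner ℝ (q - wedge b q) p -
        2 * ((∑ i, ‖bx i‖ ^ 2) * inner ℝ b p) ≤
      -(1 / 2) * ‖q - p‖ ^ 2 +
        stabilityConst M * (‖b - a‖ ^ 2 + ∑ i, ‖bx i - ax i‖ ^ 2) := by
  have hM : 0 ≤ M := (norm_nonneg _).trans hp
  rw [stability_identity hap hbq hD]
  have hw : ‖b - a‖ ≤ 2 := (norm_sub_le _ _).trans (by rw [ha, hb]; norm_num)
  have hwedge : -(inner ℝ (wedge (b - a) (q - p)) p : ℝ) ≤ ‖b - a‖ * ‖q - p‖ * M :=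
    (neg_le_abs _).trans ((abs_real_inner_le_norm _ _).trans
      (mul_le_mul (norm_wedge_le _ _) hp (norm_nonneg _) (by positivity)))
  have hinner : (∑ i, ‖ax i‖ ^ 2) * (inner ℝ (b - a) (q - p) : ℝ) ≤
      3 * M ^ 2 * (‖b - a‖ * ‖q - p‖) :=
    (mul_le_mul_of_nonneg_left (real_inner_le_norm _ _) (sum_sq_norm_nonneg ax)).trans
      (mul_le_mul_of_nonneg_right (sum_sq_norm_le hax) (by positivity))
  have hgrad := neg_two_mul_sum_mul_inner_le (dx := fun i => bx i - ax i) hw hp hax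
  have hyoung := two_mul_le_add_sq ((M + 6 * M ^ 2) * ‖b - a‖) ‖q - p‖
  have hslack : 0 ≤ (1 / 2 * (M + 6 * M ^ 2) ^ 2 + 6 * M ^ 2) * (∑ i, ‖bx i - ax i‖ ^ 2) +
      (2 * M ^ 2 + 4 * M) * ‖b - a‖ ^ 2 :=
    add_nonneg (mul_nonneg (by positivity) (sum_sq_norm_nonneg fun i => bx i - ax i))
      (by positivity)
  rw [stabilityConst]
  linarith

theorem boundary_term_le {c l : ℝ} (hc : |c| ≤ l) (x y p q : E3) :
    c * (-2 * inner ℝ x p + 2 * inner ℝ x q + 2 * inner ℝ y p) ≤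
      l * (2 * ‖x‖ ^ 2 + 2 * ‖p‖ ^ 2 + ‖q‖ ^ 2 + ‖y‖ ^ 2) := by
  have hbracket : |-2 * (inner ℝ x p : ℝ) + 2 * inner ℝ x q + 2 * inner ℝ y p| ≤
      2 * ‖x‖ ^ 2 + 2 * ‖p‖ ^ 2 + ‖q‖ ^ 2 + ‖y‖ ^ 2 := by
    refine (abs_add_three _ _ _).trans ?_
    rw [abs_mul, abs_mul, abs_mul, abs_neg, abs_two]
    linarith [two_mul_abs_inner_le x p, two_mul_abs_inner_le x q, two_mul_abs_inner_le y p]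
  exact (le_abs_self _).trans (abs_mul c _ ▸
    mul_le_mul hc hbracket (abs_nonneg _) ((abs_nonneg _).trans hc))

theorem sum_boundary_term_le {c : Fin 3 → ℝ} {l : ℝ} (hc : ∀ i, |c i| ≤ l)
    (ax bx : Fin 3 → E3) (p q : E3) :
    ∑ i, c i * (-2 * inner ℝ (ax i) p + 2 * inner ℝ (ax i) q + 2 * inner ℝ (bx i) p) ≤
      6 * l * (‖p‖ ^ 2 + (∑ i, ‖ax i‖ ^ 2) + (‖q‖ ^ 2 + ∑ i, ‖bx i‖ ^ 2)) := by
  have hl : 0 ≤ l := (abs_nonneg _).trans (hc 0)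
  refine (Finset.sum_le_sum fun i _ => boundary_term_le (hc i) (ax i) (bx i) p q).trans ?_
  simp only [Fin.sum_univ_three]
  have hslack : 0 ≤ l * (4 * (‖ax 0‖ ^ 2 + ‖ax 1‖ ^ 2 + ‖ax 2‖ ^ 2) +
    5 * (‖bx 0‖ ^ 2 + ‖bx 1‖ ^ 2 + ‖bx 2‖ ^ 2) + 3 * ‖q‖ ^ 2) := by positivity
  linarith

end PointwiseEstimates

section Stability

variable {L R T M : ℝ} {χ : E3 → ℝ} {m₀ : E3 → E3} {u v vt : ℝ × E3 → E3}
  {vx : Fin 3 → ℝ × E3 → E3}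

theorem IsCutoff.abs_fderiv_le (hχ : IsCutoff L R χ) (hLR : 0 ≤ L / R) (i : Fin 3) (x : E3) :
    |fderiv ℝ χ x (basisVec i)| ≤ L / R :=
  abs_le_of_sq_le_sq ((hχ.sq_fderiv_le i x).trans
    (mul_le_of_le_one_right (sq_nonneg _) (hχ.le_one x))) hLR

/-- The space-time density of the variation of the localized energy of `v - u`, for a smooth
solution `u` and a weak solution `v`. It combines the dissipation of `u` and `v`, the variation of
the cross term `∫ χ ∇u · ∇v`, and the weak equation of `v` tested with `χ ∂ₜu`. -/
def stabilityDensity (χ : E3 → ℝ) (u v vt : ℝ × E3 → E3) (vx : Fin 3 → ℝ × E3 → E3)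
    (z : ℝ × E3) : ℝ :=
  energyFlux χ u z - 2 * crossDensity χ u vt vx z - χ z.2 * ‖vt z‖ ^ 2 +
    geometricResidual v vt vx (fun z => χ z.2 • ∂ₜ u z) z

theorem stabilityDensity_eq (hχ : ContDiff ℝ ∞ χ) (hu : ContDiffOn ℝ ∞ u closedHalfSpace)
    {z : ℝ × E3} (hz : z ∈ closedHalfSpace) :
    stabilityDensity χ u v vt vx z =
      χ z.2 * (-‖∂ₜ u z‖ ^ 2 - ‖vt z‖ ^ 2 + 2 * inner ℝ (∑ i, ∂ₓ[i] (∂ₓ[i] u) z) (vt z) +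
        inner ℝ (vt z - wedge (v z) (vt z)) (∂ₜ u z) -
        2 * ((∑ i, ‖vx i z‖ ^ 2) * inner ℝ (v z) (∂ₜ u z))) +
      ∑ i, fderiv ℝ χ z.2 (basisVec i) * (-2 * inner ℝ (∂ₓ[i] u z) (∂ₜ u z) +
        2 * inner ℝ (∂ₓ[i] u z) (vt z) + 2 * inner ℝ (vx i z) (∂ₜ u z)) := by
  simp only [stabilityDensity, energyFlux, crossDensity, geometricResidual,
    dirDeriv_spaceDir_cutoff_smul hχ (contDiffOn_dirDeriv hu timeDir) _ hz,
    inner_add_left, inner_add_right, real_inner_smul_right, Fin.sum_univ_three]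
  rw [real_inner_comm (vx 0 z), real_inner_comm (vx 1 z), real_inner_comm (vx 2 z)]
  ring

/-- The squared distance `|v - u|² + |∇v - ∇u|²`, where `vx` is the gradient of `v`. -/
def relativeDensity (u v : ℝ × E3 → E3) (vx : Fin 3 → ℝ × E3 → E3) (z : ℝ × E3) : ℝ :=
  ‖v z - u z‖ ^ 2 + ∑ i, ‖vx i z - ∂ₓ[i] u z‖ ^ 2

theorem IsTruncatedSolution.stabilityDensity_le (hu : IsTruncatedSolution T M m₀ u)
    (hχ : IsCutoff L R χ) (hLR : 0 ≤ L / R) {z : ℝ × E3} (hz : z ∈ slab T) (hvz : ‖v z‖ = 1)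
    (hvt : inner ℝ (v z) (vt z) = (0 : ℝ)) :
    stabilityDensity χ u v vt vx z ≤
      -(1 / 2) * (χ z.2 * ‖vt z - ∂ₜ u z‖ ^ 2) +
        stabilityConst M * (χ z.2 * relativeDensity u v vx z) +
        6 * (L / R) * (gradSq (∂ₜ u) (fun i => ∂ₓ[i] u) z + gradSq vt vx z) := by
  have hinterior := mul_le_mul_of_nonneg_left (stability_le (bx := fun i => vx i z)
    (hu.norm_eq_one z hz) hvz (hu.orthogonal_dt z hz) hvt (hu.bounded z hz).1 (hu.bounded z hz).2
    (hu.equation z hz)) (hχ.nonneg z.2)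
  have hboundary := sum_boundary_term_le (fun i => hχ.abs_fderiv_le hLR i z.2)
    (fun i => ∂ₓ[i] u z) (fun i => vx i z) (∂ₜ u z) (vt z)
  rw [stabilityDensity_eq hχ.smooth hu.smooth (slab_subset_closedHalfSpace T hz)]
  refine (add_le_add hinterior hboundary).trans_eq ?_
  rw [relativeDensity, gradSq, gradSq]
  ring

theorem IsCutoff.stabilityDensity_eq_zero (hχ : IsCutoff L R χ)
    (hu : ContDiffOn ℝ ∞ u closedHalfSpace) {z : ℝ × E3} (hz : z ∈ closedHalfSpace)
    (hχz : χ z.2 = 0) : stabilityDensity χ u v vt vx z = 0 := by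
  simp only [stabilityDensity_eq hχ.smooth hu hz, hχz, hχ.fderiv_eq_zero hχz, zero_mul,
    Finset.sum_const_zero, add_zero]

theorem integral_mul_sq_norm_sub {μ : Measure E3} {c : E3 → ℝ} {a b : E3 → E3}
    (ha : Integrable (fun x => c x * ‖a x‖ ^ 2) μ) (hb : Integrable (fun x => c x * ‖b x‖ ^ 2) μ)
    (hab : Integrable (fun x => c x * ‖b x - a x‖ ^ 2) μ) :
    ∫ x, c x * ‖b x - a x‖ ^ 2 ∂μ = (∫ x, c x * ‖b x‖ ^ 2 ∂μ) + (∫ x, c x * ‖a x‖ ^ 2 ∂μ) -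
      2 * ∫ x, c x * inner ℝ (a x) (b x) ∂μ := by
  have hba : Integrable (fun x => c x * ‖b x‖ ^ 2 + c x * ‖a x‖ ^ 2) μ := hb.add ha
  have hpolar : ∀ x, c x * (inner ℝ (a x) (b x) : ℝ) =
      1 / 2 * ((c x * ‖b x‖ ^ 2 + c x * ‖a x‖ ^ 2) - c x * ‖b x - a x‖ ^ 2) := fun x => by
    rw [norm_sub_sq_real, real_inner_comm]
    ring
  simp_rw [hpolar]
  rw [integral_const_mul, integral_sub hba hab, integral_add hb ha]
  ring

theorem CylinderSqIntegrable.ae_integral_slice_sub {V W : ℝ × E3 → E3}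
    (hV : CylinderSqIntegrable V) (hW : CylinderSqIntegrable W) (hχ : IsCutoff L R χ) :
    ∀ᵐ S ∂(volume.restrict (Ioo 0 T)), ∫ x, χ x * ‖V (S, x) - W (S, x)‖ ^ 2 =
      (∫ x, χ x * ‖V (S, x)‖ ^ 2) + (∫ x, χ x * ‖W (S, x)‖ ^ 2) -
        2 * ∫ x, χ x * inner ℝ (W (S, x)) (V (S, x)) := by
  filter_upwards [ae_integrable_slice (hχ.integrableOn_mul hW.cylinderIntegrable_sq T),
    ae_integrable_slice (hχ.integrableOn_mul hV.cylinderIntegrable_sq T),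
    ae_integrable_slice (hχ.integrableOn_mul (hV.sub hW).cylinderIntegrable_sq T)]
    with S hWS hVS hVWS using integral_mul_sq_norm_sub hWS hVS hVWS

theorem ae_sliceEnergy_sub {V W : Fin 3 → ℝ × E3 → E3} (hV : ∀ i, CylinderSqIntegrable (V i))
    (hW : ∀ i, CylinderSqIntegrable (W i)) (hχ : IsCutoff L R χ) :
    ∀ᵐ S ∂(volume.restrict (Ioo 0 T)), sliceEnergy χ (fun i z => V i z - W i z) S =
      sliceEnergy χ V S + sliceEnergy χ W S -
        2 * ∑ i, ∫ x, χ x * inner ℝ (W i (S, x)) (V i (S, x)) := by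
  filter_upwards [ae_all_iff.2 fun i => (hV i).ae_integral_slice_sub (hW i) hχ] with S hS
  simp only [sliceEnergy]
  rw [Finset.sum_congr rfl fun i _ => hS i, Finset.sum_sub_distrib, Finset.sum_add_distrib,
    ← Finset.mul_sum]

theorem IsTruncatedSolution.hasBoundedSupport_cutoff_smul_dt (hu : IsTruncatedSolution T M m₀ u)
    (hχ : IsCutoff L R χ) : HasBoundedSupport fun z => χ z.2 • ∂ₜ u z := by
  obtain ⟨N, hN⟩ := hu.vanish
  refine ⟨max N (2 * R), fun z hz hzR => ?_⟩
  rcases lt_or_ge N z.1 with hzN | hzN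
  · change χ z.2 • ∂ₜ u z = 0
    rw [dirDeriv_eq_zero_of_isOpen (isOpen_Ioi.preimage continuous_fst) hN timeDir hz hzN,
      smul_zero]
  · have htime : ‖z.1‖ ≤ max N (2 * R) := by
      rw [Real.norm_of_nonneg (mem_closedHalfSpace.1 hz)]
      exact hzN.trans (le_max_left _ _)
    have hspace : 2 * R < ‖z.2‖ := (le_max_right N _).trans_lt
      ((lt_max_iff.1 (Prod.norm_def z ▸ hzR)).resolve_left htime.not_gt)
    change χ z.2 • ∂ₜ u z = 0
    rw [hχ.eq_zero z.2 hspace.le, zero_smul]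

theorem IsTruncatedSolution.integral_stabilityDensity (hu : IsTruncatedSolution T M m₀ u)
    (hv : IsGlobalWeakSolution m₀ v vt vx) (hχ : IsCutoff L R χ) (hT : 0 < T) :
    IntegrableOn (stabilityDensity χ u v vt vx) (slab T) ∧
      ∫ z in slab T, stabilityDensity χ u v vt vx z = (∫ z in slab T, energyFlux χ u z) -
        2 * (∫ z in slab T, crossDensity χ u vt vx z) - ∫ z in slab T, χ z.2 * ‖vt z‖ ^ 2 := by
  have hflux := hu.integrableOn_energyFlux hχ.smooth hχ.hasCompactSupport
  have hcross : IntegrableOn (crossDensity χ u vt vx) (slab T) :=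
    integrableOn_crossDensity hχ.smooth hχ.hasCompactSupport hu.smooth
      (cylinderIntegrable_of_memLp_two hv.memLp_dt)
      (fun i => cylinderIntegrable_of_memLp_two fun _ hS => hv.memLp_dx hS i) T
  have hdissipation := hχ.integrableOn_mul hv.cylinderSqIntegrable_dt.cylinderIntegrable_sq T
  obtain ⟨hresidual, hresidual_eq⟩ := hv.integral_geometricResidual
    (contDiffOn_cutoff_smul hχ.smooth (contDiffOn_dirDeriv hu.smooth timeDir))
    (hu.hasBoundedSupport_cutoff_smul_dt hχ) hT
  have hflux_cross : IntegrableOn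
      (fun z => energyFlux χ u z - 2 * crossDensity χ u vt vx z) (slab T) :=
    hflux.sub (hcross.const_mul 2)
  have hsub : IntegrableOn (fun z => energyFlux χ u z - 2 * crossDensity χ u vt vx z -
      χ z.2 * ‖vt z‖ ^ 2) (slab T) := hflux_cross.sub hdissipation
  refine ⟨hsub.add hresidual, ?_⟩
  simp only [stabilityDensity]
  rw [integral_add hsub hresidual, hresidual_eq, add_zero, integral_sub hflux_cross hdissipation,
    integral_sub hflux (hcross.const_mul 2), integral_const_mul]

theorem IsTruncatedSolution.sliceEnergy_sub_le (hu : IsTruncatedSolution T M m₀ u)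
    (hv : IsGlobalWeakSolution m₀ v vt vx) (hv_energy : EnergyInequality m₀ vt vx)
    (hm₀ : ContDiff ℝ ∞ m₀) (hm₀_grad : ∀ i, MemLp (fun x => fderiv ℝ m₀ x (basisVec i)) 2 volume)
    (hχ : IsCutoff L R χ) :
    ∀ᵐ S ∂(volume.restrict (Ioo 0 T)), sliceEnergy χ (fun i z => vx i z - ∂ₓ[i] u z) S ≤
      totalEnergy m₀ - initialEnergy χ m₀ + ∫ z in slab S, stabilityDensity χ u v vt vx z := by
  have hux := fun i => cylinderSqIntegrable_of_continuousOn
    (contDiffOn_dirDeriv hu.smooth (spaceDir i)).continuousOn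
  filter_upwards [ae_restrict_mem measurableSet_Ioo,
    ae_restrict_of_ae_restrict_of_subset Ioo_subset_Ioi_self
      ((hv.isEvolution hm₀.continuous).cross_energy_identity hm₀ hχ.smooth hχ.hasCompactSupport
        hu.smooth hu.initial),
    hv_energy.sliceEnergy_add_le hm₀_grad hv.cylinderSqIntegrable_dt hv.cylinderSqIntegrable_dx hχ,
    ae_sliceEnergy_sub hv.cylinderSqIntegrable_dx hux hχ] with S hS hcross hweak hsub
  have huS := hu.mono hS.2.le
  rw [hsub, hcross, huS.energy_identity hχ.smooth hχ.hasCompactSupport hS.1.le,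
    (huS.integral_stabilityDensity hv hχ hS.1).2]
  linarith

theorem IsTruncatedSolution.cylinderIntegrable_gradSq (hu : IsTruncatedSolution T M m₀ u) :
    CylinderIntegrable (gradSq (∂ₜ u) fun i => ∂ₓ[i] u) := fun S R =>
  (hu.cylinderIntegrable_sq_dirDeriv timeDir S R).add (hu.cylinderIntegrable_sum_sq_dx S R)

theorem IsGlobalWeakSolution.cylinderIntegrable_gradSq (hv : IsGlobalWeakSolution m₀ v vt vx) :
    CylinderIntegrable (gradSq vt vx) := fun S R =>
  (hv.cylinderSqIntegrable_dt.cylinderIntegrable_sq S R).add (integrable_finsetSum _ fun i _ =>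
    (hv.cylinderSqIntegrable_dx i).cylinderIntegrable_sq S R)

theorem IsTruncatedSolution.cylinderSqIntegrable_sub (hu : IsTruncatedSolution T M m₀ u)
    (hv : IsGlobalWeakSolution m₀ v vt vx) : CylinderSqIntegrable fun z => v z - u z :=
  hv.cylinderSqIntegrable.sub (cylinderSqIntegrable_of_continuousOn hu.smooth.continuousOn)

theorem IsTruncatedSolution.cylinderSqIntegrable_sub_dt (hu : IsTruncatedSolution T M m₀ u)
    (hv : IsGlobalWeakSolution m₀ v vt vx) : CylinderSqIntegrable fun z => vt z - ∂ₜ u z :=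
  hv.cylinderSqIntegrable_dt.sub
    (cylinderSqIntegrable_of_continuousOn (contDiffOn_dirDeriv hu.smooth timeDir).continuousOn)

theorem IsTruncatedSolution.cylinderSqIntegrable_sub_dx (hu : IsTruncatedSolution T M m₀ u)
    (hv : IsGlobalWeakSolution m₀ v vt vx) (i : Fin 3) :
    CylinderSqIntegrable fun z => vx i z - ∂ₓ[i] u z :=
  (hv.cylinderSqIntegrable_dx i).sub
    (cylinderSqIntegrable_of_continuousOn (contDiffOn_dirDeriv hu.smooth (spaceDir i)).continuousOn)

theorem IsTruncatedSolution.cylinderIntegrable_relativeDensity (hu : IsTruncatedSolution T M m₀ u)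
    (hv : IsGlobalWeakSolution m₀ v vt vx) : CylinderIntegrable (relativeDensity u v vx) :=
  fun S R => ((hu.cylinderSqIntegrable_sub hv).cylinderIntegrable_sq S R).add
    (integrable_finsetSum _ fun i _ =>
      (hu.cylinderSqIntegrable_sub_dx hv i).cylinderIntegrable_sq S R)

theorem IsTruncatedSolution.integral_stabilityDensity_le (hu : IsTruncatedSolution T M m₀ u)
    (hv : IsGlobalWeakSolution m₀ v vt vx) (hχ : IsCutoff L R χ) (hLR : 0 ≤ L / R) (hT : 0 < T) :
    ∫ z in slab T, stabilityDensity χ u v vt vx z ≤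
      -(1 / 2) * (∫ z in slab T, χ z.2 * ‖vt z - ∂ₜ u z‖ ^ 2) +
        stabilityConst M * (∫ z in slab T, χ z.2 * relativeDensity u v vx z) +
        6 * (L / R) * ∫ z in cylinder T (2 * R),
          (gradSq (∂ₜ u) (fun i => ∂ₓ[i] u) z + gradSq vt vx z) := by
  have hdt := hχ.integrableOn_mul (hu.cylinderSqIntegrable_sub_dt hv).cylinderIntegrable_sq T
  have hrel := hχ.integrableOn_mul (hu.cylinderIntegrable_relativeDensity hv) T
  have hgrad : CylinderIntegrable fun z => gradSq (∂ₜ u) (fun i => ∂ₓ[i] u) z + gradSq vt vx z :=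
    fun S R' => (hu.cylinderIntegrable_gradSq S R').add (hv.cylinderIntegrable_gradSq S R')
  have hbulk : IntegrableOn (fun z => -(1 / 2) * (χ z.2 * ‖vt z - ∂ₜ u z‖ ^ 2) +
      stabilityConst M * (χ z.2 * relativeDensity u v vx z)) (slab T) :=
    (hdt.const_mul _).add (hrel.const_mul _)
  have hle := hχ.integral_le_add_integral_cylinder (hu.integral_stabilityDensity hv hχ hT).1 hbulk
    (fun S R' => (hgrad S R').const_mul (6 * (L / R)))
    (fun z => mul_nonneg (by positivity) (add_nonneg (gradSq_nonneg _ _ z) (gradSq_nonneg _ _ z)))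
    (fun z hz hχz => by
      simp [hχ.stabilityDensity_eq_zero hu.smooth (slab_subset_closedHalfSpace T hz) hχz, hχz])
    (by
      filter_upwards [hv.ae_norm T, hv.ae_inner_dt_eq_zero T,
        ae_restrict_mem (measurableSet_slab T)] with z hnorm hinner hz
        using hu.stabilityDensity_le hχ hLR hz hnorm hinner)
  rwa [integral_add (hdt.const_mul _) (hrel.const_mul _), integral_const_mul, integral_const_mul,
    integral_const_mul] at hle

end Stability

theorem integral_Ioo_le_gronwallBound {G : ℝ → ℝ} {α β T : ℝ} (hβ : 0 ≤ β) (hT : 0 ≤ T)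
    (hG : IntegrableOn G (Ioo 0 T))
    (hle : ∀ᵐ S ∂(volume.restrict (Ioo 0 T)), G S ≤ α + β * ∫ t in Ioo 0 S, G t) :
    ∫ t in Ioo 0 T, G t ≤ gronwallBound 0 β α T := by
  set P : ℝ → ℝ := fun S => ∫ t in (0 : ℝ)..S, (Ioo 0 T).indicator G t
  have hG_int : Integrable ((Ioo 0 T).indicator G) := hG.integrable_indicator measurableSet_Ioo
  have hP_eq : ∀ S ∈ Icc 0 T, P S = ∫ t in Ioo 0 S, G t := fun S hS => by
    simp only [P]
    rw [intervalIntegral.integral_of_le hS.1, integral_Ioc_eq_integral_Ioo,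
      setIntegral_indicator measurableSet_Ioo,
      inter_eq_self_of_subset_left (Ioo_subset_Ioo_right hS.2)]
  have hrate : Continuous fun S => α + β * P S :=
    continuous_const.add (continuous_const.mul
      (intervalIntegral.continuous_primitive (fun _ _ => hG_int.intervalIntegrable) 0))
  have hQ : ∀ S, HasDerivAt (fun S => ∫ s in (0 : ℝ)..S, (α + β * P s)) (α + β * P S) S :=
    fun S => (hrate.integral_hasStrictDerivAt 0 S).hasDerivAt
  have hPQ : ∀ S ∈ Icc 0 T, P S ≤ ∫ s in (0 : ℝ)..S, (α + β * P s) := fun S hS => by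
    rw [hP_eq S hS, intervalIntegral.integral_of_le hS.1, integral_Ioc_eq_integral_Ioo]
    have hsub : Ioo 0 S ⊆ Ioo 0 T := Ioo_subset_Ioo_right hS.2
    refine setIntegral_mono_on_ae (hG.mono_set hsub)
      ((hrate.integrableOn_Icc).mono_set Ioo_subset_Icc_self) measurableSet_Ioo ?_
    filter_upwards [(ae_restrict_iff' measurableSet_Ioo).1 hle] with s hs hsS
    rw [hP_eq s (Ioo_subset_Icc_self (hsub hsS))]
    exact hs (hsub hsS)
  have hgronwall := le_gronwallBound_of_liminf_deriv_right_le (a := 0) (b := T) (δ := 0) (K := β)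
    (ε := α) (fun S _ => (hQ S).continuousAt.continuousWithinAt)
    (fun S _ r hr => (hQ S).hasDerivWithinAt.liminf_right_slope_le hr)
    intervalIntegral.integral_same.le
    (fun S hS => by linarith [mul_le_mul_of_nonneg_left (hPQ S (Ico_subset_Icc_self hS)) hβ])
    T (right_mem_Icc.2 hT)
  rw [sub_zero] at hgronwall
  exact (hP_eq T (right_mem_Icc.2 hT)).ge.trans ((hPQ T (right_mem_Icc.2 hT)).trans hgronwall)

section RelativeEnergy

variable {L R T M : ℝ} {χ : E3 → ℝ} {m₀ : E3 → E3} {u v vt : ℝ × E3 → E3}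
  {vx : Fin 3 → ℝ × E3 → E3}

theorem stabilityConst_nonneg (hM : 0 ≤ M) : 0 ≤ stabilityConst M := by
  rw [stabilityConst]
  positivity

theorem IsTruncatedSolution.integral_slice_sq_norm (hu : IsTruncatedSolution T M m₀ u)
    (hχ : IsCutoff L R χ) (hT : 0 ≤ T) :
    ∫ x, χ x * ‖u (T, x)‖ ^ 2 = ∫ x, χ x * ‖m₀ x‖ ^ 2 := by
  have hsq := hu.smooth.inner ℝ hu.smooth
  have hslice := integral_slice_eq_add_integral_slab (contDiffOn_cutoff_smul hχ.smooth hsq)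
    (hasBoundedSpatialSupport_cutoff_smul hχ.hasCompactSupport _) hT
  rw [setIntegral_eq_zero_of_forall_eq_zero fun z hz => ?_, add_zero] at hslice
  · simpa only [smul_eq_mul, real_inner_self_eq_norm_sq, hu.initial] using hslice
  · have hzc := slab_subset_closedHalfSpace T hz
    rw [dirDeriv_timeDir_cutoff_smul hχ.smooth hsq hzc, dirDeriv_inner hu.smooth hu.smooth _ hzc,
      real_inner_comm (u z), hu.orthogonal_dt z hz, add_zero, smul_zero]

theorem IsGlobalWeakSolution.ae_integral_slice_sq_norm (hv : IsGlobalWeakSolution m₀ v vt vx)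
    (χ : E3 → ℝ) (T : ℝ) :
    ∀ᵐ S ∂(volume.restrict (Ioo 0 T)), ∫ x, χ x * ‖v (S, x)‖ ^ 2 = ∫ x, χ x := by
  have hnorm := hv.ae_norm T
  rw [restrict_slab] at hnorm
  filter_upwards [Measure.ae_ae_of_ae_prod hnorm] with S hS
  refine integral_congr_ae ?_
  filter_upwards [hS] with x hx
  rw [hx, one_pow, mul_one]

theorem IsTruncatedSolution.integral_slice_inner (hu : IsTruncatedSolution T M m₀ u)
    (hv : IsGlobalWeakSolution m₀ v vt vx) (hm₀ : Continuous m₀) (hχ : IsCutoff L R χ) :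
    ∀ᵐ S ∂(volume.restrict (Ioo 0 T)), ∫ x, χ x * inner ℝ (u (S, x)) (v (S, x)) =
      (∫ x, χ x * ‖m₀ x‖ ^ 2) -
        ∫ z in slab S, χ z.2 * inner ℝ (v z - u z) (vt z - ∂ₜ u z) := by
  filter_upwards [ae_restrict_mem measurableSet_Ioo,
    ae_restrict_of_ae_restrict_of_subset Ioo_subset_Ioi_self
      ((hv.isEvolution hm₀).integral_slice _ (contDiffOn_cutoff_smul hχ.smooth hu.smooth)
        (hasBoundedSpatialSupport_cutoff_smul hχ.hasCompactSupport u))] with S hS hslice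
  have hrate : ∫ z in slab S, pairingRate (fun z => χ z.2 • u z) v vt z =
      -∫ z in slab S, χ z.2 * inner ℝ (v z - u z) (vt z - ∂ₜ u z) := by
    rw [← integral_neg]
    refine integral_congr_ae ?_
    filter_upwards [hv.ae_inner_dt_eq_zero S, ae_restrict_mem (measurableSet_slab S)]
      with z hvz hz
    have huz := hu.orthogonal_dt z (slab_subset_slab hS.2.le hz)
    simp only [pairingRate, dirDeriv_timeDir_cutoff_smul hχ.smooth hu.smooth
      (slab_subset_closedHalfSpace S hz), real_inner_smul_left, inner_sub_left, inner_sub_right,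
      hvz, huz, real_inner_comm (∂ₜ u z) (v z)]
    ring
  rw [hrate, ← sub_eq_add_neg] at hslice
  simpa only [real_inner_smul_left, hu.initial, real_inner_self_eq_norm_sq] using hslice

theorem IsTruncatedSolution.integral_slice_sq_norm_sub (hu : IsTruncatedSolution T M m₀ u)
    (hv : IsGlobalWeakSolution m₀ v vt vx) (hm₀ : Continuous m₀) (hχ : IsCutoff L R χ) :
    ∀ᵐ S ∂(volume.restrict (Ioo 0 T)), ∫ x, χ x * ‖v (S, x) - u (S, x)‖ ^ 2 =
      2 * ∫ z in slab S, χ z.2 * inner ℝ (v z - u z) (vt z - ∂ₜ u z) := by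
  filter_upwards [ae_restrict_mem measurableSet_Ioo, hu.integral_slice_inner hv hm₀ hχ,
    hv.ae_integral_slice_sq_norm χ T, hv.cylinderSqIntegrable.ae_integral_slice_sub
      (cylinderSqIntegrable_of_continuousOn hu.smooth.continuousOn) hχ] with S hS hinner hvS hsub
  have huS : ∫ x, χ x * ‖u (S, x)‖ ^ 2 = ∫ x, χ x := integral_congr_ae <|
    Eventually.of_forall fun x => by
      simp only [hu.norm_eq_one (S, x) (mem_slab.2 hS), one_pow, mul_one]
  rw [hsub, hvS, hinner, ← (hu.mono hS.2.le).integral_slice_sq_norm hχ hS.1.le, huS]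
  ring

theorem IsTruncatedSolution.integral_slice_sq_norm_sub_le (hu : IsTruncatedSolution T M m₀ u)
    (hv : IsGlobalWeakSolution m₀ v vt vx) (hm₀ : Continuous m₀) (hχ : IsCutoff L R χ) :
    ∀ᵐ S ∂(volume.restrict (Ioo 0 T)), ∫ x, χ x * ‖v (S, x) - u (S, x)‖ ^ 2 ≤
      (∫ z in slab S, χ z.2 * ‖v z - u z‖ ^ 2) +
        ∫ z in slab S, χ z.2 * ‖vt z - ∂ₜ u z‖ ^ 2 := by
  filter_upwards [hu.integral_slice_sq_norm_sub hv hm₀ hχ] with S hS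
  have hsq := hχ.integrableOn_mul (hu.cylinderSqIntegrable_sub hv).cylinderIntegrable_sq S
  have hdt := hχ.integrableOn_mul (hu.cylinderSqIntegrable_sub_dt hv).cylinderIntegrable_sq S
  rw [hS, ← integral_const_mul, ← integral_add hsq hdt]
  refine (le_abs_self _).trans ((abs_integral_le_integral_abs).trans (integral_mono_of_nonneg
    (Eventually.of_forall fun z => abs_nonneg _) (hsq.add hdt) (Eventually.of_forall fun z => ?_)))
  have hyoung := mul_le_mul_of_nonneg_left (two_mul_abs_inner_le (v z - u z) (vt z - ∂ₜ u z))
    (hχ.nonneg z.2)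
  simp only [abs_mul, abs_two, abs_of_nonneg (hχ.nonneg z.2)]
  linarith

/-- The relative energy `∫ χ(x) (|v - u|² + |∇v - ∇u|²)(S, x) dx` of two maps at time `S`, where
`vx` is the gradient of `v`. -/
def relativeEnergy (χ : E3 → ℝ) (u v : ℝ × E3 → E3) (vx : Fin 3 → ℝ × E3 → E3) (S : ℝ) : ℝ :=
  ∫ x, χ x * relativeDensity u v vx (S, x)

theorem IsTruncatedSolution.relativeEnergy_eq (hu : IsTruncatedSolution T M m₀ u)
    (hv : IsGlobalWeakSolution m₀ v vt vx) (hχ : IsCutoff L R χ) :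
    ∀ᵐ S ∂(volume.restrict (Ioo 0 T)), relativeEnergy χ u v vx S =
      (∫ x, χ x * ‖v (S, x) - u (S, x)‖ ^ 2) + sliceEnergy χ (fun i z => vx i z - ∂ₓ[i] u z) S := by
  filter_upwards [ae_integrable_slice (hχ.integrableOn_mul
      (hu.cylinderSqIntegrable_sub hv).cylinderIntegrable_sq T),
    ae_all_iff.2 fun i => ae_integrable_slice (hχ.integrableOn_mul
      (hu.cylinderSqIntegrable_sub_dx hv i).cylinderIntegrable_sq T)] with S hS hSx
  simp only [relativeEnergy, relativeDensity, sliceEnergy, mul_add, Finset.mul_sum]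
  rw [integral_add hS (integrable_finsetSum _ fun i _ => hSx i),
    integral_finsetSum _ fun i _ => hSx i]

/-- The error made in the relative energy estimate by localizing it with the cutoff `χ` of
radius `R`: the energy of the initial value seen only outside of `χ`, and the boundary terms. -/
def localizationError (L R T : ℝ) (χ : E3 → ℝ) (m₀ : E3 → E3) (u vt : ℝ × E3 → E3)
    (vx : Fin 3 → ℝ × E3 → E3) : ℝ :=
  totalEnergy m₀ - initialEnergy χ m₀ + 6 * (L / R) * ∫ z in cylinder T (2 * R),
    (gradSq (∂ₜ u) (fun i => ∂ₓ[i] u) z + gradSq vt vx z)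

theorem IsTruncatedSolution.sliceEnergy_sub_add_le (hu : IsTruncatedSolution T M m₀ u)
    (hv : IsGlobalWeakSolution m₀ v vt vx) (hv_energy : EnergyInequality m₀ vt vx)
    (hm₀ : ContDiff ℝ ∞ m₀) (hm₀_grad : ∀ i, MemLp (fun x => fderiv ℝ m₀ x (basisVec i)) 2 volume)
    (hχ : IsCutoff L R χ) (hLR : 0 ≤ L / R) :
    ∀ᵐ S ∂(volume.restrict (Ioo 0 T)), sliceEnergy χ (fun i z => vx i z - ∂ₓ[i] u z) S +
        1 / 2 * (∫ z in slab S, χ z.2 * ‖vt z - ∂ₜ u z‖ ^ 2) ≤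
      localizationError L R T χ m₀ u vt vx +
        stabilityConst M * ∫ z in slab S, χ z.2 * relativeDensity u v vx z := by
  filter_upwards [ae_restrict_mem measurableSet_Ioo,
    hu.sliceEnergy_sub_le hv hv_energy hm₀ hm₀_grad hχ] with S hS hslice
  have hdensity := (hu.mono hS.2.le).integral_stabilityDensity_le hv hχ hLR hS.1
  have hboundary := mul_le_mul_of_nonneg_left (setIntegral_mono_set
    ((hu.cylinderIntegrable_gradSq T (2 * R)).add (hv.cylinderIntegrable_gradSq T (2 * R)))
    (Eventually.of_forall fun z => add_nonneg (gradSq_nonneg _ _ z) (gradSq_nonneg _ _ z))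
    (cylinder_mono hS.2.le le_rfl).eventuallyLE) (show 0 ≤ 6 * (L / R) by positivity)
  simp only [Pi.add_apply] at hboundary
  rw [localizationError]
  linarith

theorem IsTruncatedSolution.relativeEnergy_le (hu : IsTruncatedSolution T M m₀ u)
    (hv : IsGlobalWeakSolution m₀ v vt vx) (hv_energy : EnergyInequality m₀ vt vx)
    (hm₀ : ContDiff ℝ ∞ m₀) (hm₀_grad : ∀ i, MemLp (fun x => fderiv ℝ m₀ x (basisVec i)) 2 volume)
    (hχ : IsCutoff L R χ) (hLR : 0 ≤ L / R) :
    ∀ᵐ S ∂(volume.restrict (Ioo 0 T)), relativeEnergy χ u v vx S ≤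
      2 * localizationError L R T χ m₀ u vt vx +
        (2 * stabilityConst M + 1) * ∫ t in Ioo 0 S, relativeEnergy χ u v vx t := by
  filter_upwards [hu.relativeEnergy_eq hv hχ, hu.integral_slice_sq_norm_sub_le hv hm₀.continuous hχ,
    hu.sliceEnergy_sub_add_le hv hv_energy hm₀ hm₀_grad hχ hLR] with S hS hdist henergy
  have hrel := hχ.integrableOn_mul (hu.cylinderIntegrable_relativeDensity hv) S
  have hsq_le : ∫ z in slab S, χ z.2 * ‖v z - u z‖ ^ 2 ≤
      ∫ z in slab S, χ z.2 * relativeDensity u v vx z :=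
    integral_mono (hχ.integrableOn_mul (hu.cylinderSqIntegrable_sub hv).cylinderIntegrable_sq S)
      hrel fun z => mul_le_mul_of_nonneg_left
        (le_add_of_nonneg_right (sum_sq_norm_nonneg fun i => vx i z - ∂ₓ[i] u z)) (hχ.nonneg z.2)
  have henergy_nonneg := sliceEnergy_nonneg hχ.nonneg (fun i z => vx i z - ∂ₓ[i] u z) S
  have hslab : ∫ z in slab S, χ z.2 * relativeDensity u v vx z =
      ∫ t in Ioo 0 S, relativeEnergy χ u v vx t := integral_slab hrel
  rw [hS, ← hslab]
  linarith

theorem IsTruncatedSolution.integral_cylinder_sq_norm_sub_le (hu : IsTruncatedSolution T M m₀ u)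
    (hv : IsGlobalWeakSolution m₀ v vt vx) (hv_energy : EnergyInequality m₀ vt vx)
    (hm₀ : ContDiff ℝ ∞ m₀) (hm₀_grad : ∀ i, MemLp (fun x => fderiv ℝ m₀ x (basisVec i)) 2 volume)
    (hχ : IsCutoff L R χ) (hLR : 0 ≤ L / R) (hM : 0 ≤ M) (hT : 0 ≤ T) :
    ∫ z in cylinder T R, ‖v z - u z‖ ^ 2 ≤ gronwallBound 0 (2 * stabilityConst M + 1)
      (2 * localizationError L R T χ m₀ u vt vx) T := by
  have hrel := hχ.integrableOn_mul (hu.cylinderIntegrable_relativeDensity hv) T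
  have hgronwall := integral_Ioo_le_gronwallBound
    (add_nonneg (mul_nonneg zero_le_two (stabilityConst_nonneg hM)) zero_le_one) hT
    (integrableOn_integral_slab hrel)
    (hu.relativeEnergy_le hv hv_energy hm₀ hm₀_grad hχ hLR)
  calc ∫ z in cylinder T R, ‖v z - u z‖ ^ 2
      ≤ ∫ z in cylinder T R, relativeDensity u v vx z :=
        integral_mono ((hu.cylinderSqIntegrable_sub hv).cylinderIntegrable_sq T R)
          (hu.cylinderIntegrable_relativeDensity hv T R) fun z =>
            le_add_of_nonneg_right (sum_sq_norm_nonneg fun i => vx i z - ∂ₓ[i] u z)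
    _ ≤ ∫ z in slab T, χ z.2 * relativeDensity u v vx z :=
        hχ.integral_cylinder_le (hu.cylinderIntegrable_relativeDensity hv)
          (fun z => add_nonneg (sq_nonneg _) (sum_sq_norm_nonneg fun i => vx i z - ∂ₓ[i] u z)) T
    _ ≤ _ := (integral_slab hrel).trans_le hgronwall

end RelativeEnergy

section Uniqueness

variable {L T M : ℝ} {m₀ : E3 → E3} {u v vt : ℝ × E3 → E3} {vx : Fin 3 → ℝ × E3 → E3}
  {χ : ℕ → E3 → ℝ}

theorem tendsto_initialEnergy (hχ : ∀ n : ℕ, IsCutoff L (n + 1) (χ n))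
    (hm₀ : ∀ i, MemLp (fun x => fderiv ℝ m₀ x (basisVec i)) 2 volume) :
    Tendsto (fun n => initialEnergy (χ n) m₀) atTop (𝓝 (totalEnergy m₀)) := by
  refine tendsto_finsetSum _ fun i _ => ?_
  have hint := (memLp_two_iff_integrable_sq_norm (hm₀ i).1).1 (hm₀ i)
  refine tendsto_integral_of_dominated_convergence _
    (fun n => (hχ n).smooth.continuous.aestronglyMeasurable.mul hint.1) hint
    (fun n => Eventually.of_forall fun x => ?_) (Eventually.of_forall fun x => ?_)
  · rw [Real.norm_of_nonneg (mul_nonneg ((hχ n).nonneg _) (sq_nonneg _))]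
    exact mul_le_of_le_one_left (sq_nonneg _) ((hχ n).le_one x)
  · refine tendsto_const_nhds.congr' ?_
    filter_upwards [eventually_ge_atTop ⌈‖x‖⌉₊] with n hn
    rw [(hχ n).eq_one x ((Nat.ceil_le.1 hn).trans (by linarith)), one_mul]

theorem IsTruncatedSolution.exists_integral_cylinder_gradSq_add_le
    (hu : IsTruncatedSolution T M m₀ u) (hv : IsGlobalWeakSolution m₀ v vt vx) (hT : 0 < T)
    (hm₀ : ∀ i, MemLp (fun x => fderiv ℝ m₀ x (basisVec i)) 2 volume) :
    ∃ B, ∀ R, 1 ≤ R → ∫ z in cylinder T R,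
      (gradSq (∂ₜ u) (fun i => ∂ₓ[i] u) z + gradSq vt vx z) ≤ B := by
  obtain ⟨B, hB⟩ := hu.exists_integral_cylinder_gradSq_le hT.le hm₀
  have hv_int : IntegrableOn (gradSq vt vx) (slab T) :=
    ((hv.memLp_dt T hT).integrable_norm_pow two_ne_zero).add (integrable_finsetSum _ fun i _ =>
      (hv.memLp_dx hT i).integrable_norm_pow two_ne_zero)
  refine ⟨B + ∫ z in slab T, gradSq vt vx z, fun R hR => ?_⟩
  rw [integral_add (hu.cylinderIntegrable_gradSq T R) (hv.cylinderIntegrable_gradSq T R)]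
  exact add_le_add (hB R hR) (setIntegral_mono_set hv_int
    (Eventually.of_forall (gradSq_nonneg vt vx)) (cylinder_subset_slab T R).eventuallyLE)

theorem IsTruncatedSolution.tendsto_localizationError (hu : IsTruncatedSolution T M m₀ u)
    (hv : IsGlobalWeakSolution m₀ v vt vx) (hT : 0 < T)
    (hm₀ : ∀ i, MemLp (fun x => fderiv ℝ m₀ x (basisVec i)) 2 volume)
    (hχ : ∀ n : ℕ, IsCutoff L (n + 1) (χ n)) :
    Tendsto (fun n : ℕ => localizationError L (n + 1) T (χ n) m₀ u vt vx) atTop (𝓝 0) := by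
  obtain ⟨B, hB⟩ := hu.exists_integral_cylinder_gradSq_add_le hv hT hm₀
  have hradius : Tendsto (fun n : ℕ => L / ((n : ℝ) + 1)) atTop (𝓝 0) :=
    tendsto_const_nhds.div_atTop (tendsto_natCast_atTop_atTop.atTop_add tendsto_const_nhds)
  have henergy := (tendsto_initialEnergy hχ hm₀).const_sub (totalEnergy m₀)
  have hboundary : Tendsto (fun n : ℕ => 6 * (L / ((n : ℝ) + 1)) *
      ∫ z in cylinder T (2 * ((n : ℝ) + 1)),
        (gradSq (∂ₜ u) (fun i => ∂ₓ[i] u) z + gradSq vt vx z)) atTop (𝓝 0) := by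
    refine Tendsto.zero_mul_isBoundedUnder_le (by simpa using hradius.const_mul 6)
      (isBoundedUnder_of ⟨B, fun n => ?_⟩)
    rw [Function.comp_apply, Real.norm_of_nonneg (integral_nonneg fun z =>
      add_nonneg (gradSq_nonneg _ _ z) (gradSq_nonneg _ _ z))]
    exact hB _ (by linarith [n.cast_nonneg (α := ℝ)])
  simpa only [localizationError, sub_self, add_zero] using henergy.add hboundary

theorem IsTruncatedSolution.ae_eq (hu : IsTruncatedSolution T M m₀ u)
    (hv : IsGlobalWeakSolution m₀ v vt vx) (hv_energy : EnergyInequality m₀ vt vx)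
    (hm₀ : ContDiff ℝ ∞ m₀) (hm₀_grad : ∀ i, MemLp (fun x => fderiv ℝ m₀ x (basisVec i)) 2 volume)
    (hT : 0 < T) : ∀ᵐ z ∂(volume.restrict (slab T)), v z = u z := by
  obtain ⟨L, hL, hcutoff⟩ := exists_isCutoff
  choose χ hχ using fun n : ℕ => hcutoff (n + 1) (by positivity)
  have hM : 0 ≤ M := (norm_nonneg _).trans
    (hu.bounded (T / 2, 0) (mem_slab.2 ⟨half_pos hT, half_lt_self hT⟩)).1
  have hlim : Tendsto (fun n : ℕ => gronwallBound 0 (2 * stabilityConst M + 1)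
      (2 * localizationError L (n + 1) T (χ n) m₀ u vt vx) T) atTop (𝓝 0) := by
    have hcont := (gronwallBound_continuous_ε 0 (2 * stabilityConst M + 1) T).tendsto 0
    rw [gronwallBound_ε0_δ0] at hcont
    refine hcont.comp ?_
    simpa using (hu.tendsto_localizationError hv hT hm₀_grad hχ).const_mul 2
  have hsq := (hu.cylinderSqIntegrable_sub hv).cylinderIntegrable_sq
  rw [slab_eq_iUnion_cylinder, ae_restrict_iUnion_iff]
  intro k
  have hle : ∫ z in cylinder T k, ‖v z - u z‖ ^ 2 ≤ 0 := by
    refine ge_of_tendsto hlim ?_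
    filter_upwards [eventually_ge_atTop k] with n hn
    refine le_trans ?_ (hu.integral_cylinder_sq_norm_sub_le hv hv_energy hm₀ hm₀_grad (hχ n)
      (by positivity) hM hT.le)
    refine setIntegral_mono_set (hsq T _) (Eventually.of_forall fun z => sq_nonneg _)
      (cylinder_mono le_rfl ?_).eventuallyLE
    exact (Nat.cast_le.2 hn).trans (le_add_of_nonneg_right zero_le_one)
  have hzero := (integral_eq_zero_iff_of_nonneg (fun z => sq_nonneg _) (hsq T k)).1
    (hle.antisymm (integral_nonneg fun z => sq_nonneg _))
  filter_upwards [hzero] with z hz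
  exact sub_eq_zero.1 (norm_eq_zero.1 (pow_eq_zero_iff two_ne_zero |>.1 hz))

theorem slab_eq_iUnion_slab {s : ℕ → ℝ} (hs : ∀ n, s n < T) (hlim : Tendsto s atTop (𝓝 T)) :
    slab T = ⋃ n, slab (s n) := by
  ext z
  simp only [slab, mem_prod, mem_univ, and_true, mem_iUnion, mem_Ioo, exists_and_left]
  exact ⟨fun hz => ⟨hz.1, (hlim.eventually (lt_mem_nhds hz.2)).exists⟩,
    fun ⟨hz, n, hn⟩ => ⟨hz, hn.trans (hs n)⟩⟩

end Uniqueness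

end LandauLifshitz

end

theorem theorem2p3
    (m₀ : LandauLifshitz.E3 → LandauLifshitz.E3)
    (hm₀_smooth : ContDiff ℝ ∞ m₀)
    (hm₀_norm : ∀ᵐ x, ‖m₀ x‖ = 1)
    (hm₀_grad : ∀ i, MemLp (fun x => fderiv ℝ m₀ x (LandauLifshitz.basisVec i)) 2 volume)
    (m₂ m₂t : ℝ × LandauLifshitz.E3 → LandauLifshitz.E3)
    (m₂x : Fin 3 → ℝ × LandauLifshitz.E3 → LandauLifshitz.E3)
    (hm₂ : LandauLifshitz.IsGlobalWeakSolution m₀ m₂ m₂t m₂x)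
    (hm₂_energy : LandauLifshitz.EnergyInequality m₀ m₂t m₂x)
    (T : ℝ) (hT : 0 < T)
    (m₁ : ℝ × LandauLifshitz.E3 → LandauLifshitz.E3)
    (hm₁ : LandauLifshitz.IsSmoothSolution T m₀ m₁) :
    ∀ᵐ z ∂(volume.restrict (LandauLifshitz.slab T)), m₂ z = m₁ z := by
  have hnorm : ∀ x, ‖m₀ x‖ = 1 := fun x => congrFun
    ((hm₀_smooth.continuous.norm.ae_eq_iff_eq (μ := volume) continuous_const).1 hm₀_norm) x
  obtain ⟨s, -, hs, hsT⟩ := exists_seq_strictMono_tendsto' hT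
  rw [LandauLifshitz.slab_eq_iUnion_slab (fun n => (hs n).2) hsT, ae_restrict_iUnion_iff]
  intro n
  obtain ⟨M, u, hu, hum⟩ := hm₁.exists_truncation hnorm (hs n).1 (hs n).2
  filter_upwards [hu.ae_eq hm₂ hm₂_energy hm₀_smooth hm₀_grad (hs n).1,
    ae_restrict_mem (LandauLifshitz.measurableSet_slab (s n))] with z hz hzs
  rw [hz, hum z hzs]
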